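/- Let $P_{XY}$ be a probability distribution on $\mathcal X\times\mathcal Y$, where $\mathcal X,\mathcal Y$ are finite sets, and let $\mathbf W=(W_n)_{n\ge1}$ be an arbitrary channel: each $W_n$ is a conditional distribution from $\mathcal T^n$ to $\mathcal Z^n$, where $\mathcal T,\mathcal Z$ are finite non-empty sets, and no relation between different $n$ is assumed. All logarithms, entropies $H(\cdot)$ and mutual informations $I(\cdot;\cdot)$ are to base $2$. A protocol of block-length $n$ consists of a finite set $\mathcal K$ with $|\mathcal K|\ge 3$ and functions $\Phi:\mathcal X^n\to\mathcal K$, $\Lambda:\mathcal X^n\to\mathcal T^n$, $\Psi:\mathcal Y^n\times\mathcal Z^n\to\mathcal K$. It produces $K=\Phi(X^n)$ and $L=\Psi(Y^n,Z^n)$, where $(X^n,Y^n)$ is i.i.d. with law $P_{XY}$ and, given $(X^n,Y^n)$, $Z^n$ has law $W_n(\cdot\,|\,\Lambda(X^n))$. For $0<\epsilon<1$, a real number $H$ is an achievable $\epsilon$-UCR rate if there is a constant $c\ge0$ such that for all $\beta,\delta>0$ and all sufficiently large $n$ some protocol of block-length $n$ satisfies $$\mathbb P[K\ne L]\le\epsilon,\qquad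 |\mathcal K|\le 2^{cn},\qquad \Big|\tfrac1nH(K)-\tfrac1n\log|\mathcal K|\Big|\le\beta,\qquad \tfrac1nH(K)>H-\delta .$$ The $\epsilon$-UCR capacity $C_{\epsilon,UCR}(P_{XY},\mathbf W)$ is the maximum achievable $\epsilon$-UCR rate. For a sequence $\boldsymbol T=(P_{T^n})_{n\ge1}$ of distributions on $\mathcal T^n$ (not required to be consistent), let $P_{T^nZ^n}(t,z)=P_{T^n}(t)W_n(z|t)$, let $i(t;z)=\log\frac{P_{T^nZ^n}(t,z)}{P_{T^n}(t)P_{Z^n}(z)}$, and let $F_{\boldsymbol T}(R)=\limsup_{n\to\infty}\mathbb P\big[\tfrac1n i(T^n;Z^n)\le R\big]$ for $R\in\mathbb R$. Put $$l(\epsilon)=\sup_{\boldsymbol T}\sup\{R:F_{\boldsymbol T}(R)<\epsilon\},\qquad u(\epsilon)=\sup_{\boldsymbol T}\sup\{R:F_{\boldsymbol T}(R)\le\epsilon\}.$$ For $r\ge 0$ let $M(r)=\max\{I(U;X)\}$, the maximum over all random variables $U$ with a finite alphabet such that $U-X-Y$ is a Markov chain, $(X,Y)$ has law $P_{XY}$,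 and $I(U;X)-I(U;Y)\le r$. Then for every $0<\epsilon<1$ the maxima defining $C_{\epsilon,UCR}(P_{XY},\mathbf W)$, $M(l(\epsilon))$ and $M(u(\epsilon))$ exist, and $$M(l(\epsilon))\ \le\ C_{\epsilon,UCR}(P_{XY},\mathbf W)\ \le\ M(u(\epsilon)).$$ Both inequalities are equalities at every $\epsilon\in(0,1)$ with $l(\epsilon)=u(\epsilon)$, and the set of $\epsilon\in(0,1)$ with $l(\epsilon)\neq u(\epsilon)$ is at most countable. -/

import Mathlib

namespace UCR

/-- Probability mass functions on a finite alphabet `α`. -/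
abbrev FinDist (α : Type*) [Fintype α] : Type _ := stdSimplex ℝ α

/-- Shannon entropy in bits, with `0 log 0 = 0`. -/
noncomputable def entropy {α : Type*} [Fintype α] (p : α → ℝ) : ℝ :=
  -∑ a, p a * Real.logb 2 (p a)

/-- Mutual information in bits of a joint probability mass function `q` on `α × β`;
terms with `q (a, b) = 0` contribute `0`. -/
noncomputable def mutualInfo {α β : Type*} [Fintype α] [Fintype β] (q : α × β → ℝ) : ℝ :=
  ∑ a, ∑ b, q (a, b) * Real.logb 2 (q (a, b) / ((∑ b', q (a, b')) * (∑ a', q (a', b))))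

/-- An arbitrary channel: for each block-length `n`, a conditional distribution `W n`
from `𝒯 ^ n` to `𝒵 ^ n`, with no relation required between different block-lengths. -/
abbrev Channel (𝒯 𝒵 : Type*) [Fintype 𝒯] [Fintype 𝒵] : Type _ :=
  (n : ℕ) → (Fin n → 𝒯) → FinDist (Fin n → 𝒵)

/-! ### Common randomness generation -/

/-- A protocol of block-length `n`. The alphabet of `K` and `L` is a finite set with at least
three elements, labelled by `Fin card`. -/
structure Protocol (𝒳 𝒴 𝒯 𝒵 : Type*) (n : ℕ) where
  /-- size of the common alphabet of `K` and `L` -/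
  card : ℕ
  three_le_card : 3 ≤ card
  /-- `K = Φ (X ^ n)` -/
  Φ : (Fin n → 𝒳) → Fin card
  /-- `T ^ n = Λ (X ^ n)` -/
  Λ : (Fin n → 𝒳) → (Fin n → 𝒯)
  /-- `L = Ψ (Y ^ n, Z ^ n)` -/
  Ψ : (Fin n → 𝒴) → (Fin n → 𝒵) → Fin card

section Protocols

variable {𝒳 𝒴 𝒯 𝒵 : Type*} [Fintype 𝒳] [Fintype 𝒴] [Fintype 𝒯] [Fintype 𝒵]

/-- Law of `(X ^ n, Y ^ n, Z ^ n)`: the source is i.i.d. with law `P`, and `Z ^ n` is the output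
of the channel for the input `Λ (X ^ n)`. -/
noncomputable def jointLaw (P : FinDist (𝒳 × 𝒴)) (W : Channel 𝒯 𝒵) {n : ℕ}
    (π : Protocol 𝒳 𝒴 𝒯 𝒵 n) (x : Fin n → 𝒳) (y : Fin n → 𝒴) (z : Fin n → 𝒵) : ℝ :=
  (∏ i, P.1 (x i, y i)) * (W n (π.Λ x)).1 z

/-- Joint law of the permissible pair `(K, L)`. -/
noncomputable def pairLaw (P : FinDist (𝒳 × 𝒴)) (W : Channel 𝒯 𝒵) {n : ℕ}
    (π : Protocol 𝒳 𝒴 𝒯 𝒵 n) (kl : Fin π.card × Fin π.card) : ℝ :=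
  ∑ x, ∑ y, ∑ z, if π.Φ x = kl.1 ∧ π.Ψ y z = kl.2 then jointLaw P W π x y z else 0

/-- The probability that `K ≠ L`. -/
noncomputable def errorProb (P : FinDist (𝒳 × 𝒴)) (W : Channel 𝒯 𝒵) {n : ℕ}
    (π : Protocol 𝒳 𝒴 𝒯 𝒵 n) : ℝ :=
  ∑ k, ∑ l, if k ≠ l then pairLaw P W π (k, l) else 0

/-- The entropy of `K`. -/
noncomputable def entropyK (P : FinDist (𝒳 × 𝒴)) (W : Channel 𝒯 𝒵) {n : ℕ}
    (π : Protocol 𝒳 𝒴 𝒯 𝒵 n) : ℝ :=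
  entropy fun k => ∑ l, pairLaw P W π (k, l)

/-- `H` is an achievable `ε`-UCR rate. -/
def IsAchievableRate (P : FinDist (𝒳 × 𝒴)) (W : Channel 𝒯 𝒵) (ε H : ℝ) : Prop :=
  ∃ c : ℝ, 0 ≤ c ∧ ∀ β : ℝ, 0 < β → ∀ δ : ℝ, 0 < δ → ∀ᶠ n : ℕ in Filter.atTop,
    ∃ π : Protocol 𝒳 𝒴 𝒯 𝒵 n,
      errorProb P W π ≤ ε ∧
      (π.card : ℝ) ≤ (2 : ℝ) ^ (c * (n : ℝ)) ∧
      |entropyK P W π / (n : ℝ) - Real.logb 2 (π.card : ℝ) / (n : ℝ)| ≤ β ∧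
      entropyK P W π / (n : ℝ) > H - δ

/-- The `ε`-UCR capacity, the largest achievable `ε`-UCR rate. -/
noncomputable def ucrCapacity (P : FinDist (𝒳 × 𝒴)) (W : Channel 𝒯 𝒵) (ε : ℝ) : ℝ :=
  sSup {H : ℝ | IsAchievableRate P W ε H}

end Protocols

/-! ### The auxiliary maximum -/

section Auxiliary

variable {𝒰 𝒳 𝒴 : Type*} [Fintype 𝒰] [Fintype 𝒳] [Fintype 𝒴]

/-- The marginal law of `(U, X)`. -/
def margUX (q : 𝒰 × 𝒳 × 𝒴 → ℝ) : 𝒰 × 𝒳 → ℝ := fun ux => ∑ y, q (ux.1, ux.2, y)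

/-- The marginal law of `(U, Y)`. -/
def margUY (q : 𝒰 × 𝒳 × 𝒴 → ℝ) : 𝒰 × 𝒴 → ℝ := fun uy => ∑ x, q (uy.1, x, uy.2)

/-- The marginal law of `(X, Y)`. -/
def margXY (q : 𝒰 × 𝒳 × 𝒴 → ℝ) : 𝒳 × 𝒴 → ℝ := fun xy => ∑ u, q (u, xy.1, xy.2)

/-- `U – X – Y` is a Markov chain:
`P_{UXY}(u, x, y) P_X(x) = P_{UX}(u, x) P_{XY}(x, y)`. -/
def IsMarkovChain (q : 𝒰 × 𝒳 × 𝒴 → ℝ) : Prop :=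
  ∀ u x y, q (u, x, y) * (∑ u', ∑ y', q (u', x, y')) = margUX q (u, x) * margXY q (x, y)

/-- The values `I(U;X)` over all random variables `U` with a finite alphabet, jointly distributed
with `(X, Y) ∼ P`, such that `U – X – Y` and `I(U;X) - I(U;Y) ≤ r`. -/
def auxRates (P : FinDist (𝒳 × 𝒴)) (r : ℝ) : Set ℝ :=
  {v : ℝ | ∃ (k : ℕ) (q : FinDist (Fin k × 𝒳 × 𝒴)),
    margXY q.1 = P.1 ∧ IsMarkovChain q.1 ∧
    mutualInfo (margUX q.1) - mutualInfo (margUY q.1) ≤ r ∧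
    v = mutualInfo (margUX q.1)}

/-- The maximum of `I(U;X)` over `U – X – Y` with `I(U;X) - I(U;Y) ≤ r`. -/
noncomputable def auxMax (P : FinDist (𝒳 × 𝒴)) (r : ℝ) : ℝ := sSup (auxRates P r)

end Auxiliary

/-! ### The information spectrum of the channel -/

/-- An input process: a sequence of distributions on `𝒯 ^ n`, with no consistency required. -/
abbrev InputProcess (𝒯 : Type*) [Fintype 𝒯] : Type _ := (n : ℕ) → FinDist (Fin n → 𝒯)

section Spectrum

variable {𝒯 𝒵 : Type*} [Fintype 𝒯] [Fintype 𝒵]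

/-- Law of `(T ^ n, Z ^ n)` when `T ^ n` has law `T n` and is sent over the channel. -/
noncomputable def ioLaw (W : Channel 𝒯 𝒵) (T : InputProcess 𝒯) (n : ℕ)
    (t : Fin n → 𝒯) (z : Fin n → 𝒵) : ℝ :=
  (T n).1 t * (W n t).1 z

/-- The information density `i(t ^ n; z ^ n)`, in bits. -/
noncomputable def infoDensity (W : Channel 𝒯 𝒵) (T : InputProcess 𝒯) (n : ℕ)
    (t : Fin n → 𝒯) (z : Fin n → 𝒵) : ℝ :=
  Real.logb 2 (ioLaw W T n t z / ((∑ t', ioLaw W T n t' z) * (T n).1 t))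

/-- The probability that `(1 / n) i(T ^ n; Z ^ n) ≤ R`. -/
noncomputable def spectrumProb (W : Channel 𝒯 𝒵) (T : InputProcess 𝒯) (R : ℝ) (n : ℕ) : ℝ :=
  ∑ t, ∑ z, if infoDensity W T n t z / (n : ℝ) ≤ R then ioLaw W T n t z else 0

/-- `F_T(R) = limsup_n P[(1 / n) i(T ^ n; Z ^ n) ≤ R]`. -/
noncomputable def spectrumLimsup (W : Channel 𝒯 𝒵) (T : InputProcess 𝒯) (R : ℝ) : ℝ :=
  Filter.limsup (spectrumProb W T R) Filter.atTop

/-- `l(ε) = sup_T sup {R : F_T(R) < ε}`. For `0 < ε < 1` each set contains all negative numbers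
and is bounded above by `log |𝒯|`, so these are suprema of nonempty bounded sets. -/
noncomputable def lowerRate (W : Channel 𝒯 𝒵) (ε : ℝ) : ℝ :=
  ⨆ T : InputProcess 𝒯, sSup {R : ℝ | spectrumLimsup W T R < ε}

/-- `u(ε) = sup_T sup {R : F_T(R) ≤ ε}`; the remark on `lowerRate` applies. -/
noncomputable def upperRate (W : Channel 𝒯 𝒵) (ε : ℝ) : ℝ :=
  ⨆ T : InputProcess 𝒯, sSup {R : ℝ | spectrumLimsup W T R ≤ ε}

end Spectrum

end UCR

/-!
The converse rests on a change of measure. Let `R > u(ε)`. Along infinitely many `n`, for a protocol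
of error probability at most `ε`, the event that `K = L` while the information density of the
channel is at most `n R` has probability at least some `η > 0` that does not depend on `n`, by the
definition of `u(ε)` with the law of the channel input as input process. Conditioning on this event
multiplies densities by at most `1 / η`, which is negligible on the scale of `n`; afterwards decoding
is free of error, and `H(K | Y ^ n)` is at most about `n R` (`ent_pair_sub_le`). The law of `K` is
nearly uniform, and remains so (`le_entropy_of_le_mul`). The usual single-letterization, with
`U_i = (K, X_1, …, X_{i-1}, Y_{i+1}, …, Y_n)`, then gives an auxiliary variable that satisfies the
constraints up to a vanishing error (`exists_mem_auxRegion`).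

Approximate solutions are turned into exact ones by compactness. The entropies of `X`, `Y` and
`(X, Y)` conditioned on `U`, together with the law of `(X, Y)`, range over the convex hull of the
compact set of points of the unconditional laws (`auxRegion`), so that no bound on the alphabet of
`U` is needed. The Markov property is the entropy inequality `H(Y|X) ≤ H(Y|X,U)`
(`isMarkovChain_iff`). This also shows that the auxiliary maxima are attained (`isGreatest_auxMax`).

For the direct part with `l(ε) > 0`, sequences `U ^ n` from a random codebook of size about
`2 ^ (n I(U;X))` cover `X ^ n`. They are placed at random in about `2 ^ (n (I(U;X) - I(U;Y)))` bins,
and the index of the bin, together with `Y ^ n`, determines the sequence (`eventually_sourceCode`).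
The bin is sent over the channel by a code with small maximal error probability, which exists by
Feinstein's lemma (`exists_channel_codes`) as soon as the rate is below `l(ε)`; time sharing with a
constant `U` provides that margin. When `l(ε) = 0` there is no margin, but `I(U;X) ≤ I(U;Y)` makes
the conditional law of `U` a common function of `X` and `Y`, and its entropy is achieved without
using the channel (`exists_common_function`).

Finally `u(ε) ≤ l(ε')` for `ε < ε'`, so that the open intervals `(l(ε), u(ε))` are pairwise disjoint
and at most countably many of them are nonempty.
-/

namespace UCR

set_option linter.unusedSectionVars false

/-! ### Gibbs' inequality -/

theorem mul_logb_sub_le {w r : ℝ} (hw : 0 ≤ w) (hr : 0 ≤ r) (h : 0 < w → 0 < r) :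
    w * (Real.logb 2 r - Real.logb 2 w) ≤ (r - w) / Real.log 2 := by
  have h2 : 0 < Real.log 2 := Real.log_pos (by norm_num)
  rcases hw.eq_or_lt with rfl | hw'
  · simp only [zero_mul, sub_zero]; positivity
  · have hr' := h hw'
    have := Real.log_le_sub_one_of_pos (div_pos hr' hw')
    rw [Real.log_div hr'.ne' hw'.ne'] at this
    rw [Real.logb, Real.logb, ← sub_div, mul_div_assoc']
    refine div_le_div_of_nonneg_right ?_ h2.le
    calc w * (Real.log r - Real.log w) ≤ w * (r / w - 1) := by gcongr
      _ = r - w := by field_simp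

theorem eq_of_mul_logb_sub_eq {w r : ℝ} (hw : 0 ≤ w) (h : 0 < w → 0 < r)
    (he : w * (Real.logb 2 r - Real.logb 2 w) = (r - w) / Real.log 2) : w = r := by
  have h2 : 0 < Real.log 2 := Real.log_pos (by norm_num)
  rcases hw.eq_or_lt with rfl | hw'
  · simp only [zero_mul, sub_zero] at he
    rcases div_eq_zero_iff.1 he.symm with h0 | h0
    · exact h0.symm
    · exact absurd h0 h2.ne'
  · have hr' := h hw'
    by_contra hne
    have h1 : r / w ≠ 1 := fun hh => hne ((div_eq_one_iff_eq hw'.ne').1 hh).symm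
    have := Real.log_lt_sub_one_of_pos (div_pos hr' hw') h1
    rw [Real.log_div hr'.ne' hw'.ne'] at this
    rw [Real.logb, Real.logb, ← sub_div, mul_div_assoc', div_left_inj' h2.ne'] at he
    have h3 : w * (Real.log r - Real.log w) < w * (r / w - 1) := by gcongr
    have h4 : w * (r / w - 1) = r - w := by field_simp
    linarith

section Gibbs

variable {Ω : Type*} [Fintype Ω]

/-- **Gibbs' inequality**, for a nonnegative `w` and an `r` of no larger total mass. -/
theorem gibbs {w r : Ω → ℝ} (hw : ∀ ω, 0 ≤ w ω) (hr : ∀ ω, 0 ≤ r ω)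
    (h : ∀ ω, 0 < w ω → 0 < r ω) (hs : ∑ ω, r ω ≤ ∑ ω, w ω) :
    ∑ ω, w ω * (Real.logb 2 (r ω) - Real.logb 2 (w ω)) ≤ 0 := by
  have h2 : 0 < Real.log 2 := Real.log_pos (by norm_num)
  calc _ ≤ ∑ ω, (r ω - w ω) / Real.log 2 :=
        Finset.sum_le_sum fun ω _ => mul_logb_sub_le (hw ω) (hr ω) (h ω)
    _ = (∑ ω, r ω - ∑ ω, w ω) / Real.log 2 := by
        rw [← Finset.sum_sub_distrib, Finset.sum_div]
    _ ≤ 0 := div_nonpos_of_nonpos_of_nonneg (by linarith) h2.le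

/-- The equality case of Gibbs' inequality. -/
theorem eq_of_gibbs {w r : Ω → ℝ} (hw : ∀ ω, 0 ≤ w ω) (hr : ∀ ω, 0 ≤ r ω)
    (h : ∀ ω, 0 < w ω → 0 < r ω) (hs : ∑ ω, r ω ≤ ∑ ω, w ω)
    (he : 0 ≤ ∑ ω, w ω * (Real.logb 2 (r ω) - Real.logb 2 (w ω))) : w = r := by
  have h2 : 0 < Real.log 2 := Real.log_pos (by norm_num)
  have h3 : ∑ ω, (r ω - w ω) / Real.log 2 ≤ 0 := by
    rw [← Finset.sum_div, Finset.sum_sub_distrib]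
    exact div_nonpos_of_nonpos_of_nonneg (by linarith) h2.le
  have hle : ∀ ω ∈ Finset.univ, 0 ≤ (r ω - w ω) / Real.log 2
      - w ω * (Real.logb 2 (r ω) - Real.logb 2 (w ω)) := fun ω _ =>
    sub_nonneg.2 (mul_logb_sub_le (hw ω) (hr ω) (h ω))
  have h4 : ∑ ω, ((r ω - w ω) / Real.log 2
      - w ω * (Real.logb 2 (r ω) - Real.logb 2 (w ω))) = 0 := by
    refine le_antisymm ?_ (Finset.sum_nonneg hle)
    rw [Finset.sum_sub_distrib]; linarith
  funext ω
  have h5 := (Finset.sum_eq_zero_iff_of_nonneg hle).1 h4 ω (Finset.mem_univ _)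
  exact eq_of_mul_logb_sub_eq (hw ω) (h ω) (by linarith)

end Gibbs

/-! ### Entropies of functions on a finite weighted space -/

section Ent

variable {Ω α β γ : Type*} [Fintype Ω]

open Classical in
/-- The image of the weight `w` under `f`: the total weight of the fibre of `f` over `a`. -/
noncomputable def mass (w : Ω → ℝ) (f : Ω → α) (a : α) : ℝ := ∑ ω, if f ω = a then w ω else 0

/-- The entropy in bits of the random variable `f` under the weight `w`. It is written as an
average over `Ω`, so that `f` may take values in any type and only the partition of `Ω` into the
fibres of `f` matters. -/
noncomputable def ent (w : Ω → ℝ) (f : Ω → α) : ℝ := -∑ ω, w ω * Real.logb 2 (mass w f (f ω))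

theorem mass_nonneg {w : Ω → ℝ} (hw : ∀ ω, 0 ≤ w ω) (f : Ω → α) (a : α) : 0 ≤ mass w f a := by
  classical
  exact Finset.sum_nonneg fun ω _ => by split_ifs <;> simp [hw]

theorem le_mass {w : Ω → ℝ} (hw : ∀ ω, 0 ≤ w ω) (f : Ω → α) (ω : Ω) : w ω ≤ mass w f (f ω) := by
  classical
  unfold mass
  calc w ω = if f ω = f ω then w ω else 0 := by simp
    _ ≤ _ := Finset.single_le_sum (f := fun ω' => if f ω' = f ω then w ω' else 0)
        (fun ω' _ => by split_ifs <;> simp [hw]) (Finset.mem_univ ω)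

theorem sum_mass_mul [Fintype α] (w : Ω → ℝ) (f : Ω → α) (F : α → ℝ) :
    ∑ a, mass w f a * F a = ∑ ω, w ω * F (f ω) := by
  classical
  simp only [mass, Finset.sum_mul]
  rw [Finset.sum_comm]
  refine Finset.sum_congr rfl fun ω _ => ?_
  simp [ite_mul]

theorem sum_mass [Fintype α] (w : Ω → ℝ) (f : Ω → α) : ∑ a, mass w f a = ∑ ω, w ω := by
  simpa using sum_mass_mul w f fun _ => 1

theorem mass_mem_stdSimplex [Fintype α] {w : Ω → ℝ} (hw : w ∈ stdSimplex ℝ Ω) (f : Ω → α) :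
    mass w f ∈ stdSimplex ℝ α :=
  ⟨mass_nonneg hw.1 f, by rw [sum_mass]; exact hw.2⟩

theorem mass_comp [Fintype α] (w : Ω → ℝ) (f : Ω → α) (g : α → β) (b : β) :
    mass w (fun ω => g (f ω)) b = mass (mass w f) g b := by
  classical
  have := sum_mass_mul w f fun a => if g a = b then 1 else 0
  simp only [mul_ite, mul_one, mul_zero] at this
  rw [mass, mass]
  exact this.symm

theorem entropy_mass [Fintype α] (w : Ω → ℝ) (f : Ω → α) : entropy (mass w f) = ent w f := by
  rw [entropy, ent, sum_mass_mul w f fun a => Real.logb 2 (mass w f a)]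

theorem ent_congr {w : Ω → ℝ} {f : Ω → α} {g : Ω → β}
    (h : ∀ ω ω', w ω ≠ 0 → w ω' ≠ 0 → (f ω = f ω' ↔ g ω = g ω')) : ent w f = ent w g := by
  classical
  unfold ent
  congr 1
  refine Finset.sum_congr rfl fun ω _ => ?_
  by_cases hω : w ω = 0
  · simp [hω]
  congr 2
  unfold mass
  refine Finset.sum_congr rfl fun ω' _ => ?_
  by_cases hω' : w ω' = 0
  · simp [hω']
  · simp [h ω' ω hω' hω]

theorem ent_mono {w : Ω → ℝ} (hw : ∀ ω, 0 ≤ w ω) {f : Ω → α} {g : Ω → β}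
    (h : ∀ ω ω', g ω = g ω' → f ω = f ω') : ent w f ≤ ent w g := by
  classical
  unfold ent
  refine neg_le_neg (Finset.sum_le_sum fun ω _ => ?_)
  rcases (hw ω).eq_or_lt with h0 | h0
  · simp [← h0]
  refine mul_le_mul_of_nonneg_left ?_ (hw ω)
  refine Real.logb_le_logb_of_le (by norm_num) (h0.trans_le (le_mass hw g ω)) ?_
  unfold mass
  refine Finset.sum_le_sum fun ω' _ => ?_
  split_ifs with h1 h2 h2
  · exact le_rfl
  · exact absurd (h _ _ h1) h2
  · exact hw _
  · exact le_rfl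

/-- Entropy is at most the cross entropy relative to any `r` of total mass at most one. -/
theorem ent_le_cross [Fintype α] {w : Ω → ℝ} (hw : w ∈ stdSimplex ℝ Ω) (f : Ω → α) {r : α → ℝ}
    (hr : ∀ a, 0 ≤ r a) (hs : ∑ a, r a ≤ 1) (h : ∀ ω, 0 < w ω → 0 < r (f ω)) :
    ent w f ≤ -∑ ω, w ω * Real.logb 2 (r (f ω)) := by
  classical
  have key := gibbs (w := mass w f) (r := r) (mass_nonneg hw.1 f) hr (fun a ha => by
    by_contra hra
    have h0 : mass w f a = 0 := by
      unfold mass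
      refine Finset.sum_eq_zero fun ω _ => ?_
      split_ifs with h1
      · by_contra h2
        exact hra (h1 ▸ h ω (lt_of_le_of_ne (hw.1 ω) (Ne.symm h2)))
      · rfl
    exact ha.ne' h0) (by rw [sum_mass, hw.2]; exact hs)
  rw [sum_mass_mul w f fun a => Real.logb 2 (r a) - Real.logb 2 (mass w f a)] at key
  simp only [mul_sub, Finset.sum_sub_distrib] at key
  unfold ent
  linarith

/-- If the law of `f` is at most `C` times `r`, the entropy of `f` falls short of the cross entropy
relative to `r` by at most `log C`. -/
theorem cross_le_ent {w : Ω → ℝ} (hw : w ∈ stdSimplex ℝ Ω) (f : Ω → α) {r : α → ℝ} {C : ℝ}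
    (hC : 0 < C) (h : ∀ ω, 0 < w ω → mass w f (f ω) ≤ C * r (f ω)) :
    -∑ ω, w ω * Real.logb 2 (r (f ω)) - Real.logb 2 C ≤ ent w f := by
  have h1 : ∑ ω, w ω * Real.logb 2 (mass w f (f ω)) ≤
      ∑ ω, w ω * (Real.logb 2 C + Real.logb 2 (r (f ω))) := by
    refine Finset.sum_le_sum fun ω _ => ?_
    rcases (hw.1 ω).eq_or_lt with h0 | h0
    · simp [← h0]
    have hm : 0 < mass w f (f ω) := h0.trans_le (le_mass hw.1 f ω)
    have hr : 0 < r (f ω) := by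
      have := hm.trans_le (h ω h0)
      exact (pos_iff_pos_of_mul_pos this).1 hC
    rw [← Real.logb_mul hC.ne' hr.ne']
    exact mul_le_mul_of_nonneg_left (Real.logb_le_logb_of_le (by norm_num) hm (h ω h0)) (hw.1 ω)
  simp only [mul_add, Finset.sum_add_distrib, ← Finset.sum_mul, hw.2, one_mul] at h1
  unfold ent
  linarith

theorem ent_nonneg {w : Ω → ℝ} (hw : w ∈ stdSimplex ℝ Ω) (f : Ω → α) : 0 ≤ ent w f := by
  classical
  unfold ent
  rw [neg_nonneg]
  refine Finset.sum_nonpos fun ω _ => mul_nonpos_of_nonneg_of_nonpos (hw.1 ω) ?_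
  refine Real.logb_nonpos (by norm_num) (mass_nonneg hw.1 f _) ?_
  unfold mass
  rw [← hw.2]
  refine Finset.sum_le_sum fun ω' _ => ?_
  split_ifs
  · exact le_rfl
  · exact hw.1 _

theorem ent_le_logb_card [Fintype α] [Nonempty α] {w : Ω → ℝ} (hw : w ∈ stdSimplex ℝ Ω)
    (f : Ω → α) : ent w f ≤ Real.logb 2 (Fintype.card α) := by
  have hc : (0 : ℝ) < Fintype.card α := by exact_mod_cast Fintype.card_pos
  have := ent_le_cross hw f (r := fun _ => (Fintype.card α : ℝ)⁻¹) (fun _ => by positivity)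
    (by simp) (fun _ _ => by positivity)
  simpa [← Finset.sum_mul, hw.2, Real.logb_inv] using this

/-- **Strong subadditivity** of entropy. -/
theorem ent_submod [Fintype α] [Fintype β] [Fintype γ] {w : Ω → ℝ} (hw : w ∈ stdSimplex ℝ Ω)
    (f : Ω → α) (g : Ω → β) (h : Ω → γ) :
    ent w (fun ω => (f ω, g ω, h ω)) + ent w f ≤
      ent w (fun ω => (f ω, g ω)) + ent w (fun ω => (f ω, h ω)) := by
  classical
  set mf := mass w f
  set mg := mass w (fun ω => (f ω, g ω)) with hmg
  set mh := mass w (fun ω => (f ω, h ω)) with hmh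
  have hsg : ∀ a, ∑ b, mg (a, b) = mf a := fun a => by
    simp only [hmg, mf, mass, Prod.mk.injEq, ite_and]
    rw [Finset.sum_comm]
    refine Finset.sum_congr rfl fun ω _ => ?_
    split_ifs <;> simp
  have hsh : ∀ a, ∑ b, mh (a, b) = mf a := fun a => by
    simp only [hmh, mf, mass, Prod.mk.injEq, ite_and]
    rw [Finset.sum_comm]
    refine Finset.sum_congr rfl fun ω _ => ?_
    split_ifs <;> simp
  have p1 : ∀ ω, 0 < w ω → 0 < mf (f ω) := fun ω h0 => h0.trans_le (le_mass hw.1 f ω)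
  have p2 : ∀ ω, 0 < w ω → 0 < mg (f ω, g ω) := fun ω h0 =>
    h0.trans_le (le_mass hw.1 (fun ω => (f ω, g ω)) ω)
  have p3 : ∀ ω, 0 < w ω → 0 < mh (f ω, h ω) := fun ω h0 =>
    h0.trans_le (le_mass hw.1 (fun ω => (f ω, h ω)) ω)
  have key := ent_le_cross hw (fun ω => (f ω, g ω, h ω))
    (r := fun t => mg (t.1, t.2.1) * mh (t.1, t.2.2) / mf t.1)
    (fun t => div_nonneg (mul_nonneg (mass_nonneg hw.1 _ _) (mass_nonneg hw.1 _ _))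
      (mass_nonneg hw.1 _ _)) (by
      rw [Fintype.sum_prod_type]
      simp only [Fintype.sum_prod_type, ← Finset.sum_div, ← Finset.mul_sum, ← Finset.sum_mul, hsg,
        hsh]
      rw [← hw.2, ← sum_mass w f]
      refine Finset.sum_le_sum fun a _ => ?_
      rw [mul_self_div_self]) (fun ω h0 => by
      have := p1 ω h0; have := p2 ω h0; have := p3 ω h0; positivity)
  have e : ∑ ω, w ω * Real.logb 2 (mg (f ω, g ω) * mh (f ω, h ω) / mf (f ω)) =
      ∑ ω, (w ω * Real.logb 2 (mg (f ω, g ω)) + w ω * Real.logb 2 (mh (f ω, h ω))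
        - w ω * Real.logb 2 (mf (f ω))) := by
    refine Finset.sum_congr rfl fun ω _ => ?_
    rcases (hw.1 ω).eq_or_lt with h0 | h0
    · simp [← h0]
    rw [Real.logb_div (mul_pos (p2 ω h0) (p3 ω h0)).ne' (p1 ω h0).ne',
      Real.logb_mul (p2 ω h0).ne' (p3 ω h0).ne']
    ring
  rw [e, Finset.sum_sub_distrib, Finset.sum_add_distrib] at key
  have d1 : ent w f = -∑ ω, w ω * Real.logb 2 (mf (f ω)) := rfl
  have d2 : ent w (fun ω => (f ω, g ω)) = -∑ ω, w ω * Real.logb 2 (mg (f ω, g ω)) := rfl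
  have d3 : ent w (fun ω => (f ω, h ω)) = -∑ ω, w ω * Real.logb 2 (mh (f ω, h ω)) := rfl
  linarith

/-- Conditioning on the finer variable `f` gives the smaller conditional entropy of `g`. -/
theorem ent_cond_anti [Fintype α] [Fintype β] [Fintype γ] {w : Ω → ℝ} (hw : w ∈ stdSimplex ℝ Ω)
    (f : Ω → α) (f' : Ω → γ) (g : Ω → β) (hf : ∀ ω ω', f ω = f ω' → f' ω = f' ω') :
    ent w (fun ω => (f ω, g ω)) - ent w f ≤ ent w (fun ω => (f' ω, g ω)) - ent w f' := by
  have h1 := ent_submod hw f' g f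
  have h2 : ent w (fun ω => (f' ω, g ω, f ω)) = ent w (fun ω => (f ω, g ω)) :=
    ent_congr fun ω ω' _ _ => by
      simp only [Prod.mk.injEq]; have := hf ω ω'; tauto
  have h3 : ent w (fun ω => (f' ω, f ω)) = ent w f :=
    ent_congr fun ω ω' _ _ => by
      simp only [Prod.mk.injEq]; have := hf ω ω'; tauto
  linarith

end Ent

/-! ### The convex region of auxiliary variables -/

/-- Carathéodory's theorem makes the convex hull of a compact set in finite dimension the image of
a compact set of weights and points. -/
theorem isCompact_convexHull_of_isCompact {E : Type*} [NormedAddCommGroup E] [NormedSpace ℝ E]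
    [FiniteDimensional ℝ E] {s : Set E} (hs : IsCompact s) : IsCompact (convexHull ℝ s) := by
  rcases s.eq_empty_or_nonempty with rfl | ⟨e, he⟩
  · simp
  set N := Module.finrank ℝ E + 1
  have hK : IsCompact (stdSimplex ℝ (Fin N) ×ˢ Set.univ.pi fun _ : Fin N => s) :=
    (isCompact_stdSimplex ℝ (Fin N)).prod (isCompact_univ_pi fun _ => hs)
  have himg := hK.image (f := fun t : (Fin N → ℝ) × (Fin N → E) => ∑ i, t.1 i • t.2 i)
    (by fun_prop)
  convert himg using 1
  refine Set.Subset.antisymm ?_ ?_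
  · intro x hx
    obtain ⟨ι, _, z, w, hz, hind, hw, hw1, hx⟩ := eq_pos_convex_span_of_mem_convexHull hx
    classical
    have hcard : Fintype.card ι ≤ Fintype.card (Fin N) := by
      rw [Fintype.card_fin]
      exact hind.card_le_finrank_succ.trans (by
        have := Submodule.finrank_le (vectorSpan ℝ (Set.range z)); omega)
    obtain ⟨f⟩ := Function.Embedding.nonempty_of_card_le hcard
    refine ⟨(fun j => ∑ i, if f i = j then w i else 0,
      fun j => if h : ∃ i, f i = j then z h.choose else e), ⟨⟨fun j => ?_, ?_⟩, fun j _ => ?_⟩, ?_⟩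
    · exact Finset.sum_nonneg fun i _ => by split_ifs <;> simp [(hw i).le]
    · simp only
      rw [Finset.sum_comm]
      simpa using hw1
    · dsimp only
      split_ifs with h
      · exact hz ⟨_, rfl⟩
      · exact he
    · simp only [Finset.sum_smul]
      rw [Finset.sum_comm, ← hx]
      refine Finset.sum_congr rfl fun i _ => ?_
      rw [Finset.sum_eq_single (f i)]
      · have h : ∃ i', f i' = f i := ⟨i, rfl⟩
        rw [dif_pos h, f.injective h.choose_spec]
        simp
      · intro j _ hj
        simp [Ne.symm hj]
      · simp
  · rintro x ⟨⟨w, z⟩, ⟨hw, hz⟩, rfl⟩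
    exact (convex_convexHull ℝ s).sum_mem (fun i _ => hw.1 i) hw.2
      fun i _ => subset_convexHull ℝ s (hz i trivial)

theorem continuous_entropy {α : Type*} [Fintype α] : Continuous (entropy : (α → ℝ) → ℝ) := by
  unfold entropy
  refine (continuous_finsetSum _ fun a _ => ?_).neg
  have : Continuous fun x : ℝ => x * Real.logb 2 x := by
    simp only [Real.logb, mul_div_assoc']
    exact Real.continuous_mul_log.div_const _
  exact this.comp (continuous_apply a)

section Region

variable {𝒳 𝒴 : Type*} [Fintype 𝒳] [Fintype 𝒴]

/-- The law of `(X, Y)` together with the entropies of `X`, of `Y` and of the pair. -/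
noncomputable def auxPoint (q : 𝒳 × 𝒴 → ℝ) : (𝒳 × 𝒴 → ℝ) × ℝ × ℝ × ℝ :=
  (q, entropy fun x => ∑ y, q (x, y), entropy fun y => ∑ x, q (x, y), entropy q)

variable (𝒳 𝒴) in
/-- The set of all tuples consisting of the law of `(X, Y)` and the conditional entropies
`H(X|U)`, `H(Y|U)`, `H(X,Y|U)`, over all auxiliary variables `U` with a finite alphabet. Averaging
over `U` is taking a convex combination of the points belonging to the conditional laws. -/
def auxRegion : Set ((𝒳 × 𝒴 → ℝ) × ℝ × ℝ × ℝ) :=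
  convexHull ℝ (auxPoint '' stdSimplex ℝ (𝒳 × 𝒴))

theorem isCompact_auxRegion : IsCompact (auxRegion 𝒳 𝒴) := by
  refine isCompact_convexHull_of_isCompact ((isCompact_stdSimplex ℝ _).image ?_)
  unfold auxPoint
  refine continuous_id.prodMk ((continuous_entropy.comp ?_).prodMk
    ((continuous_entropy.comp ?_).prodMk continuous_entropy))
  · fun_prop
  · fun_prop

theorem entropy_mul {α β : Type*} [Fintype α] [Fintype β] (w : α → ℝ) (p : α → β → ℝ)
    (hp : ∀ a, ∑ b, p a b = 1) :
    entropy (fun t : α × β => w t.1 * p t.1 t.2) = entropy w + ∑ a, w a * entropy (p a) := by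
  have h : ∀ a b, w a * p a b * Real.logb 2 (w a * p a b) =
      p a b * (w a * Real.logb 2 (w a)) + w a * (p a b * Real.logb 2 (p a b)) := fun a b => by
    by_cases h1 : w a = 0
    · simp [h1]
    by_cases h2 : p a b = 0
    · simp [h2]
    rw [Real.logb_mul h1 h2]; ring
  simp only [entropy, Fintype.sum_prod_type, h, Finset.sum_add_distrib, ← Finset.sum_mul, hp,
    ← Finset.mul_sum, one_mul, mul_neg, Finset.sum_neg_distrib]
  ring

variable {𝒰 : Type*} [Fintype 𝒰]

/-- The law of `U`. -/
def margU (q : 𝒰 × 𝒳 × 𝒴 → ℝ) : 𝒰 → ℝ := fun u => ∑ xy, q (u, xy)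

/-- The point of `auxRegion` given by a joint law of `(U, X, Y)`. -/
noncomputable def jointPoint (q : 𝒰 × 𝒳 × 𝒴 → ℝ) : (𝒳 × 𝒴 → ℝ) × ℝ × ℝ × ℝ :=
  (margXY q, entropy (margUX q) - entropy (margU q), entropy (margUY q) - entropy (margU q),
    entropy q - entropy (margU q))

theorem jointPoint_mul (w : 𝒰 → ℝ) (p : 𝒰 → 𝒳 × 𝒴 → ℝ) (hp : ∀ u, ∑ t, p u t = 1) :
    jointPoint (fun t : 𝒰 × 𝒳 × 𝒴 => w t.1 * p t.1 t.2) = ∑ u, w u • auxPoint (p u) := by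
  have h0 : margU (fun t : 𝒰 × 𝒳 × 𝒴 => w t.1 * p t.1 t.2) = w := by
    funext u; simp [margU, ← Finset.mul_sum, hp]
  have h1 : margUX (fun t : 𝒰 × 𝒳 × 𝒴 => w t.1 * p t.1 t.2) =
      fun t : 𝒰 × 𝒳 => w t.1 * ∑ y, p t.1 (t.2, y) := by
    funext u; simp [margUX, ← Finset.mul_sum]
  have h2 : margUY (fun t : 𝒰 × 𝒳 × 𝒴 => w t.1 * p t.1 t.2) =
      fun t : 𝒰 × 𝒴 => w t.1 * ∑ x, p t.1 (x, t.2) := by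
    funext u; simp [margUY, ← Finset.mul_sum]
  unfold jointPoint
  rw [h0, h1, h2, entropy_mul w p hp, entropy_mul w (fun u x => ∑ y, p u (x, y)),
    entropy_mul w (fun u y => ∑ x, p u (x, y))]
  · simp only [auxPoint, Prod.smul_mk, smul_eq_mul, add_sub_cancel_left]
    ext t
    · simp [margXY, Prod.fst_sum, Finset.sum_apply]
    · simp [Prod.fst_sum, Prod.snd_sum]
    · simp [Prod.fst_sum, Prod.snd_sum]
    · simp [Prod.snd_sum]
  · intro u; rw [← hp u, Fintype.sum_prod_type_right]
  · intro u; rw [← hp u, Fintype.sum_prod_type]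

theorem exists_disintegration {α β : Type*} [Fintype α] [Fintype β] {q : α × β → ℝ}
    (hq : q ∈ stdSimplex ℝ (α × β)) : ∃ w ∈ stdSimplex ℝ α, ∃ p : α → β → ℝ,
      (∀ a, p a ∈ stdSimplex ℝ β) ∧ q = fun t => w t.1 * p t.1 t.2 := by
  classical
  have hne : Nonempty β := by
    by_contra h
    rw [not_nonempty_iff] at h
    have := hq.2
    simp at this
  have hw : ∀ a, 0 ≤ ∑ b, q (a, b) := fun a => Finset.sum_nonneg fun b _ => hq.1 _
  refine ⟨fun a => ∑ b, q (a, b), ⟨hw, by rw [← hq.2, Fintype.sum_prod_type]⟩,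
    fun a b => if ∑ b, q (a, b) = 0 then (if b = Classical.arbitrary β then 1 else 0)
      else q (a, b) / ∑ b, q (a, b), fun a => ⟨fun b => ?_, ?_⟩, ?_⟩
  · dsimp only
    split_ifs
    · norm_num
    · norm_num
    · exact div_nonneg (hq.1 _) (hw a)
  · by_cases h : ∑ b, q (a, b) = 0
    · simp [h]
    · simp only [h, if_false, ← Finset.sum_div]
      exact div_self h
  · funext ⟨a, b⟩
    dsimp only
    by_cases h : ∑ b, q (a, b) = 0
    · rw [h, zero_mul]
      exact (Finset.sum_eq_zero_iff_of_nonneg fun b _ => hq.1 _).1 h b (Finset.mem_univ _)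
    · rw [if_neg h, mul_div_cancel₀ _ h]

theorem jointPoint_mem {q : 𝒰 × 𝒳 × 𝒴 → ℝ} (hq : q ∈ stdSimplex ℝ (𝒰 × 𝒳 × 𝒴)) :
    jointPoint q ∈ auxRegion 𝒳 𝒴 := by
  obtain ⟨w, hw, p, hp, rfl⟩ := exists_disintegration hq
  rw [jointPoint_mul w p fun u => (hp u).2]
  exact (convex_convexHull ℝ _).sum_mem (fun i _ => hw.1 i) hw.2
      fun i _ => subset_convexHull ℝ _ ⟨_, hp i, rfl⟩

theorem exists_jointPoint_eq {s : (𝒳 × 𝒴 → ℝ) × ℝ × ℝ × ℝ} (hs : s ∈ auxRegion 𝒳 𝒴) :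
    ∃ (k : ℕ) (q : FinDist (Fin k × 𝒳 × 𝒴)), jointPoint q.1 = s := by
  obtain ⟨ι, _, w, z, hw0, hw1, hz, rfl⟩ := mem_convexHull_iff_exists_fintype.1 hs
  choose p hp hpz using hz
  let e := (Fintype.equivFin ι).symm
  have hp1 : ∀ u, ∑ t, p u t = 1 := fun u => (hp u).2
  refine ⟨Fintype.card ι, ⟨fun t => w (e t.1) * p (e t.1) t.2,
    fun t => mul_nonneg (hw0 _) ((hp _).1 _), ?_⟩, ?_⟩
  · rw [Fintype.sum_prod_type]
    simp only [← Finset.mul_sum, hp1, mul_one]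
    rw [e.sum_comp]; exact hw1
  · rw [jointPoint_mul (fun u => w (e u)) (fun u => p (e u)) fun u => hp1 _,
      e.sum_comp fun i => w i • auxPoint (p i)]
    exact Finset.sum_congr rfl fun i _ => by rw [hpz]

theorem mutualInfo_eq {α β : Type*} [Fintype α] [Fintype β] {q : α × β → ℝ}
    (hq : ∀ t, 0 ≤ q t) : mutualInfo q =
      entropy (fun a => ∑ b, q (a, b)) + entropy (fun b => ∑ a, q (a, b)) - entropy q := by
  have h : ∀ a b, q (a, b) * Real.logb 2 (q (a, b) / ((∑ b', q (a, b')) * ∑ a', q (a', b))) =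
      q (a, b) * Real.logb 2 (q (a, b)) - q (a, b) * Real.logb 2 (∑ b', q (a, b'))
        - q (a, b) * Real.logb 2 (∑ a', q (a', b)) := fun a b => by
    rcases (hq (a, b)).eq_or_lt with h0 | h0
    · simp [← h0]
    have h1 : q (a, b) ≤ ∑ b', q (a, b') :=
      Finset.single_le_sum (f := fun b' => q (a, b')) (fun b _ => hq _) (Finset.mem_univ b)
    have h2 : q (a, b) ≤ ∑ a', q (a', b) :=
      Finset.single_le_sum (f := fun a' => q (a', b)) (fun b _ => hq _) (Finset.mem_univ a)
    have h1' := h0.trans_le h1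
    have h2' := h0.trans_le h2
    rw [Real.logb_div h0.ne' (by positivity), Real.logb_mul h1'.ne' h2'.ne']
    ring
  simp only [mutualInfo, h, Finset.sum_sub_distrib, entropy, Fintype.sum_prod_type]
  rw [Finset.sum_comm (f := fun a b => q (a, b) * Real.logb 2 (∑ a', q (a', b)))]
  simp only [← Finset.sum_mul]
  ring

theorem margU_eq_sum_margUX (q : 𝒰 × 𝒳 × 𝒴 → ℝ) (u : 𝒰) : ∑ x, margUX q (u, x) = margU q u := by
  simp [margUX, margU, Fintype.sum_prod_type]

theorem margU_eq_sum_margUY (q : 𝒰 × 𝒳 × 𝒴 → ℝ) (u : 𝒰) : ∑ y, margUY q (u, y) = margU q u := by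
  simp [margUY, margU, Fintype.sum_prod_type_right]

theorem sum_margUX (q : 𝒰 × 𝒳 × 𝒴 → ℝ) (x : 𝒳) :
    ∑ u, margUX q (u, x) = ∑ y, margXY q (x, y) := by
  simp only [margUX, margXY]; exact Finset.sum_comm

theorem sum_margUY (q : 𝒰 × 𝒳 × 𝒴 → ℝ) (y : 𝒴) :
    ∑ u, margUY q (u, y) = ∑ x, margXY q (x, y) := by
  simp only [margUY, margXY]; exact Finset.sum_comm

theorem margUX_nonneg {q : 𝒰 × 𝒳 × 𝒴 → ℝ} (hq : ∀ t, 0 ≤ q t) (t : 𝒰 × 𝒳) : 0 ≤ margUX q t :=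
  Finset.sum_nonneg fun _ _ => hq _

theorem margUY_nonneg {q : 𝒰 × 𝒳 × 𝒴 → ℝ} (hq : ∀ t, 0 ≤ q t) (t : 𝒰 × 𝒴) : 0 ≤ margUY q t :=
  Finset.sum_nonneg fun _ _ => hq _

theorem margXY_nonneg {q : 𝒰 × 𝒳 × 𝒴 → ℝ} (hq : ∀ t, 0 ≤ q t) (t : 𝒳 × 𝒴) : 0 ≤ margXY q t :=
  Finset.sum_nonneg fun _ _ => hq _

/-- The entropy of the first component of a pair of finite-alphabet random variables. -/
noncomputable def entropyFst (P : 𝒳 × 𝒴 → ℝ) : ℝ := entropy fun x => ∑ y, P (x, y)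

/-- The entropy of the second component of a pair of finite-alphabet random variables. -/
noncomputable def entropySnd (P : 𝒳 × 𝒴 → ℝ) : ℝ := entropy fun y => ∑ x, P (x, y)

theorem mutualInfo_margUX {q : 𝒰 × 𝒳 × 𝒴 → ℝ} (hq : ∀ t, 0 ≤ q t) :
    mutualInfo (margUX q) = entropyFst (margXY q) - (jointPoint q).2.1 := by
  rw [mutualInfo_eq (margUX_nonneg hq)]
  simp only [margU_eq_sum_margUX, sum_margUX, jointPoint, entropyFst]
  have : entropy (fun u => margU q u) = entropy (margU q) := rfl
  linarith

theorem mutualInfo_margUY {q : 𝒰 × 𝒳 × 𝒴 → ℝ} (hq : ∀ t, 0 ≤ q t) :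
    mutualInfo (margUY q) = entropySnd (margXY q) - (jointPoint q).2.2.1 := by
  rw [mutualInfo_eq (margUY_nonneg hq)]
  simp only [margU_eq_sum_margUY, sum_margUY, jointPoint, entropySnd]
  have : entropy (fun u => margU q u) = entropy (margU q) := rfl
  linarith

theorem le_margUX {q : 𝒰 × 𝒳 × 𝒴 → ℝ} (hq : ∀ t, 0 ≤ q t) (u : 𝒰) (x : 𝒳) (y : 𝒴) :
    q (u, x, y) ≤ margUX q (u, x) :=
  Finset.single_le_sum (f := fun y => q (u, x, y)) (fun _ _ => hq _) (Finset.mem_univ y)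

theorem le_margXY {q : 𝒰 × 𝒳 × 𝒴 → ℝ} (hq : ∀ t, 0 ≤ q t) (u : 𝒰) (x : 𝒳) (y : 𝒴) :
    q (u, x, y) ≤ margXY q (x, y) :=
  Finset.single_le_sum (f := fun u => q (u, x, y)) (fun _ _ => hq _) (Finset.mem_univ u)

/-- `U – X – Y` is a Markov chain exactly when `H(Y|X,U) ≥ H(Y|X)`: this is the equality case of
Gibbs' inequality for the law of `(U, X, Y)` relative to its Markov version. -/
theorem isMarkovChain_iff {q : 𝒰 × 𝒳 × 𝒴 → ℝ} (hq : ∀ t, 0 ≤ q t) : IsMarkovChain q ↔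
    entropy (margXY q) - entropyFst (margXY q) ≤ (jointPoint q).2.2.2 - (jointPoint q).2.1 := by
  set pX : 𝒳 → ℝ := fun x => ∑ y, margXY q (x, y) with hpX
  have hpX' : ∀ x, ∑ u', ∑ y', q (u', x, y') = pX x := fun x => by
    simp only [hpX, margXY]; exact Finset.sum_comm
  have hpX0 : ∀ x, 0 ≤ pX x := fun x => Finset.sum_nonneg fun y _ => margXY_nonneg hq _
  have hle : ∀ x y, margXY q (x, y) ≤ pX x := fun x y =>
    Finset.single_le_sum (f := fun y => margXY q (x, y)) (fun _ _ => margXY_nonneg hq _)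
      (Finset.mem_univ y)
  set r : 𝒰 × 𝒳 × 𝒴 → ℝ := fun t => margUX q (t.1, t.2.1) * margXY q t.2 / pX t.2.1 with hr
  have hr0 : ∀ t, 0 ≤ r t := fun t =>
    div_nonneg (mul_nonneg (margUX_nonneg hq _) (margXY_nonneg hq _)) (hpX0 _)
  have hpos : ∀ t, 0 < q t → 0 < margUX q (t.1, t.2.1) ∧ 0 < margXY q t.2 ∧ 0 < pX t.2.1 :=
    fun t h => ⟨h.trans_le (le_margUX hq _ _ _), h.trans_le (le_margXY hq t.1 t.2.1 t.2.2),
      (h.trans_le (le_margXY hq t.1 t.2.1 t.2.2)).trans_le (hle _ _)⟩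
  have hrpos : ∀ t, 0 < q t → 0 < r t := fun t h => by
    obtain ⟨h1, h2, h3⟩ := hpos t h
    exact div_pos (mul_pos h1 h2) h3
  -- the Markov version `r` of `q` has the same total mass
  have hrs : ∑ t, r t ≤ ∑ t, q t := by
    have e : ∑ t, q t = ∑ u, ∑ x, margUX q (u, x) := by
      simp only [Fintype.sum_prod_type, margUX]
    rw [e, Fintype.sum_prod_type]
    refine Finset.sum_le_sum fun u _ => ?_
    rw [Fintype.sum_prod_type]
    refine Finset.sum_le_sum fun x _ => ?_
    simp only [hr, ← Finset.mul_sum, ← Finset.sum_div]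
    change margUX q (u, x) * pX x / pX x ≤ _
    by_cases h : pX x = 0
    · simp [h, margUX_nonneg hq]
    · rw [mul_div_cancel_right₀ _ h]
  have hdiv : ∑ t, q t * (Real.logb 2 (r t) - Real.logb 2 (q t)) =
      entropy q - entropy (margUX q) - (entropy (margXY q) - entropyFst (margXY q)) := by
    have e1 : ∀ t, q t * (Real.logb 2 (r t) - Real.logb 2 (q t)) =
        q t * Real.logb 2 (margUX q (t.1, t.2.1)) + q t * Real.logb 2 (margXY q t.2)
          - q t * Real.logb 2 (pX t.2.1) - q t * Real.logb 2 (q t) := fun t => by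
      rcases (hq t).eq_or_lt with h0 | h0
      · simp [← h0]
      obtain ⟨h1, h2, h3⟩ := hpos t h0
      simp only [hr]
      rw [Real.logb_div (by positivity) h3.ne', Real.logb_mul h1.ne' h2.ne']
      ring
    have e2 : ∑ t : 𝒰 × 𝒳 × 𝒴, q t * Real.logb 2 (margUX q (t.1, t.2.1)) = -entropy (margUX q) := by
      simp only [entropy, neg_neg, Fintype.sum_prod_type, ← Finset.sum_mul]
      rfl
    have e3 : ∑ t : 𝒰 × 𝒳 × 𝒴, q t * Real.logb 2 (margXY q t.2) = -entropy (margXY q) := by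
      rw [Fintype.sum_prod_type_right]
      simp only [entropy, neg_neg, ← Finset.sum_mul]
      rfl
    have e4 : ∑ t : 𝒰 × 𝒳 × 𝒴, q t * Real.logb 2 (pX t.2.1) = -entropyFst (margXY q) := by
      rw [Fintype.sum_prod_type_right, Fintype.sum_prod_type]
      simp only [entropy, entropyFst, neg_neg, ← Finset.sum_mul]
      rfl
    have e5 : ∑ t : 𝒰 × 𝒳 × 𝒴, q t * Real.logb 2 (q t) = -entropy q := by
      simp only [entropy, neg_neg]
    simp only [e1, Finset.sum_sub_distrib, Finset.sum_add_distrib]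
    rw [e2, e3, e4, e5]
    ring
  have hjp : (jointPoint q).2.2.2 - (jointPoint q).2.1 = entropy q - entropy (margUX q) := by
    simp [jointPoint]
  rw [hjp]
  constructor
  · intro hM
    have : q = r := by
      funext ⟨u, x, y⟩
      have h := hM u x y
      rw [hpX'] at h
      simp only [hr]
      by_cases h0 : pX x = 0
      · rw [h0, div_zero]
        refine le_antisymm ?_ (hq _)
        exact (le_margXY hq u x y).trans ((hle x y).trans h0.le)
      · rw [eq_div_iff h0]; exact h
    have h2 : ∑ t, q t * (Real.logb 2 (r t) - Real.logb 2 (q t)) = 0 := by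
      rw [← this]; simp
    linarith
  · intro h u x y
    have hqr : q = r := eq_of_gibbs hq hr0 hrpos hrs (by linarith)
    rw [hpX']
    by_cases h0 : pX x = 0
    · have h1 : margXY q (x, y) = 0 :=
        le_antisymm ((hle x y).trans h0.le) (margXY_nonneg hq _)
      rw [h0, h1, mul_zero, mul_zero]
    · have := congrFun hqr (u, x, y)
      simp only [hr] at this
      rw [this, div_mul_cancel₀ _ h0]

/-- The rates of the auxiliary problem, read off from the convex region. -/
theorem mem_auxRates_iff (P : FinDist (𝒳 × 𝒴)) (r v : ℝ) : v ∈ auxRates P r ↔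
    ∃ s ∈ auxRegion 𝒳 𝒴, s.1 = P.1 ∧ entropy P.1 - entropyFst P.1 ≤ s.2.2.2 - s.2.1 ∧
      (entropyFst P.1 - s.2.1) - (entropySnd P.1 - s.2.2.1) ≤ r ∧ v = entropyFst P.1 - s.2.1 := by
  constructor
  · rintro ⟨k, q, hP, hM, hr, rfl⟩
    rw [isMarkovChain_iff q.2.1, hP] at hM
    rw [mutualInfo_margUX q.2.1, mutualInfo_margUY q.2.1, hP] at hr
    exact ⟨_, jointPoint_mem q.2, hP, hM, hr, by rw [mutualInfo_margUX q.2.1, hP]⟩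
  · rintro ⟨s, hs, hP, hM, hr, rfl⟩
    obtain ⟨k, q, rfl⟩ := exists_jointPoint_eq hs
    have hP' : margXY q.1 = P.1 := hP
    refine ⟨k, q, hP, ?_, ?_, ?_⟩
    · rw [isMarkovChain_iff q.2.1, hP']; exact hM
    · rw [mutualInfo_margUX q.2.1, mutualInfo_margUY q.2.1, hP']; exact hr
    · rw [mutualInfo_margUX q.2.1, hP']

/-- The constant auxiliary variable gives the point with no mutual information. -/
theorem auxPoint_mem (P : FinDist (𝒳 × 𝒴)) : auxPoint P.1 ∈ auxRegion 𝒳 𝒴 :=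
  subset_convexHull ℝ _ ⟨P.1, P.2, rfl⟩

theorem zero_mem_auxRates (P : FinDist (𝒳 × 𝒴)) {r : ℝ} (hr : 0 ≤ r) : 0 ∈ auxRates P r := by
  rw [mem_auxRates_iff]
  refine ⟨_, auxPoint_mem P, rfl, ?_, ?_, ?_⟩ <;> simp [auxPoint, entropyFst, entropySnd, hr]

/-- Time sharing with a constant auxiliary variable. -/
theorem mul_mem_auxRates {P : FinDist (𝒳 × 𝒴)} {r v t : ℝ} (hv : v ∈ auxRates P r)
    (ht0 : 0 ≤ t) (ht1 : t ≤ 1) : t * v ∈ auxRates P (t * r) := by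
  rw [mem_auxRates_iff] at hv ⊢
  obtain ⟨s, hs, hP, hM, hr, rfl⟩ := hv
  refine ⟨t • s + (1 - t) • auxPoint P.1,
    (convex_convexHull ℝ _) hs (auxPoint_mem P) ht0 (by linarith) (by ring), ?_, ?_, ?_, ?_⟩
  · simp only [Prod.fst_add, Prod.smul_fst, hP, auxPoint]
    rw [← add_smul]; simp
  · have := mul_le_mul_of_nonneg_left hM ht0
    simp only [Prod.snd_add, Prod.fst_add, Prod.smul_snd, Prod.smul_fst, smul_eq_mul]
    change _ ≤ t * s.2.2.2 + (1 - t) * entropy P.1 - (t * s.2.1 + (1 - t) * entropyFst P.1)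
    linarith
  · have := mul_le_mul_of_nonneg_left hr ht0
    simp only [Prod.snd_add, Prod.fst_add, Prod.smul_snd, Prod.smul_fst, smul_eq_mul]
    change entropyFst P.1 - (t * s.2.1 + (1 - t) * entropyFst P.1) -
      (entropySnd P.1 - (t * s.2.2.1 + (1 - t) * entropySnd P.1)) ≤ _
    linarith
  · simp only [Prod.snd_add, Prod.fst_add, Prod.smul_snd, Prod.smul_fst, smul_eq_mul]
    change _ = entropyFst P.1 - (t * s.2.1 + (1 - t) * entropyFst P.1)
    ring

theorem isCompact_auxRates (P : FinDist (𝒳 × 𝒴)) (r : ℝ) : IsCompact (auxRates P r) := by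
  have h : auxRates P r = (fun s : (𝒳 × 𝒴 → ℝ) × ℝ × ℝ × ℝ => entropyFst P.1 - s.2.1) ''
      (auxRegion 𝒳 𝒴 ∩ ({s | s.1 = P.1} ∩ ({s | entropy P.1 - entropyFst P.1 ≤ s.2.2.2 - s.2.1} ∩
        {s | (entropyFst P.1 - s.2.1) - (entropySnd P.1 - s.2.2.1) ≤ r}))) := by
    ext v
    rw [mem_auxRates_iff]
    constructor
    · rintro ⟨s, hs, h1, h2, h3, rfl⟩
      exact ⟨s, ⟨hs, h1, h2, h3⟩, rfl⟩
    · rintro ⟨s, ⟨hs, h1, h2, h3⟩, rfl⟩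
      exact ⟨s, hs, h1, h2, h3, rfl⟩
  rw [h]
  refine (isCompact_auxRegion.inter_right ?_).image (by fun_prop)
  refine (isClosed_eq (by fun_prop) (by fun_prop)).inter
    ((isClosed_le (by fun_prop) (by fun_prop)).inter (isClosed_le (by fun_prop) (by fun_prop)))

theorem isGreatest_auxMax (P : FinDist (𝒳 × 𝒴)) {r : ℝ} (hr : 0 ≤ r) :
    IsGreatest (auxRates P r) (auxMax P r) :=
  (isCompact_auxRates P r).isGreatest_sSup ⟨0, zero_mem_auxRates P hr⟩

end Region

/-! ### Single-letterization under a change of measure -/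

theorem sum_prod_eq_one {α : Type*} [Fintype α] {p : α → ℝ} (hp : ∑ a, p a = 1) (n : ℕ) :
    ∑ x : Fin n → α, ∏ i, p (x i) = 1 := by
  classical
  have := Finset.prod_univ_sum (fun _ : Fin n => (Finset.univ : Finset α)) fun _ a => p a
  rw [Fintype.piFinset_univ] at this
  rw [← this]; simp [hp]

theorem sum_prod_pair_snd {α β : Type*} [Fintype α] [Fintype β] (p : α × β → ℝ) {n : ℕ}
    (x : Fin n → α) : ∑ y : Fin n → β, ∏ i, p (x i, y i) = ∏ i, ∑ b, p (x i, b) := by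
  classical
  have := Finset.prod_univ_sum (fun _ : Fin n => (Finset.univ : Finset β)) fun i b => p (x i, b)
  rw [Fintype.piFinset_univ] at this
  exact this.symm

theorem sum_prod_pair_fst {α β : Type*} [Fintype α] [Fintype β] (p : α × β → ℝ) {n : ℕ}
    (y : Fin n → β) : ∑ x : Fin n → α, ∏ i, p (x i, y i) = ∏ i, ∑ a, p (a, y i) := by
  classical
  have := Finset.prod_univ_sum (fun _ : Fin n => (Finset.univ : Finset α)) fun i a => p (a, y i)
  rw [Fintype.piFinset_univ] at this
  exact this.symm

/-- The first `i` letters of `x`, the others being masked. -/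
def prefixMask {α : Type*} {n : ℕ} (i : ℕ) (x : Fin n → α) : Fin n → Option α :=
  fun j => if j.val < i then some (x j) else none

/-- The letters of `x` from position `i` on, the others being masked. -/
def suffixMask {α : Type*} {n : ℕ} (i : ℕ) (x : Fin n → α) : Fin n → Option α :=
  fun j => if i ≤ j.val then some (x j) else none

theorem prefixMask_eq_iff {α : Type*} {n : ℕ} {i : ℕ} {x x' : Fin n → α} :
    prefixMask i x = prefixMask i x' ↔ ∀ j : Fin n, j.val < i → x j = x' j := by
  rw [funext_iff]
  refine forall_congr' fun j => ?_
  unfold prefixMask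
  split_ifs with h <;> simp [h]

theorem suffixMask_eq_iff {α : Type*} {n : ℕ} {i : ℕ} {x x' : Fin n → α} :
    suffixMask i x = suffixMask i x' ↔ ∀ j : Fin n, i ≤ j.val → x j = x' j := by
  rw [funext_iff]
  refine forall_congr' fun j => ?_
  unfold suffixMask
  split_ifs with h <;> simp [h]

theorem prefixMask_succ_eq_iff {α : Type*} {n : ℕ} {i : Fin n} {x x' : Fin n → α} :
    prefixMask (i + 1) x = prefixMask (i + 1) x' ↔
      prefixMask i x = prefixMask i x' ∧ x i = x' i := by
  simp only [prefixMask_eq_iff]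
  constructor
  · intro h
    exact ⟨fun j hj => h j (by omega), h i (by omega)⟩
  · rintro ⟨h1, h2⟩ j hj
    rcases Nat.lt_succ_iff_lt_or_eq.1 hj with h | h
    · exact h1 j h
    · rwa [Fin.ext h]

theorem suffixMask_eq_succ_iff {α : Type*} {n : ℕ} {i : Fin n} {x x' : Fin n → α} :
    suffixMask i x = suffixMask i x' ↔
      suffixMask (i + 1) x = suffixMask (i + 1) x' ∧ x i = x' i := by
  simp only [suffixMask_eq_iff]
  constructor
  · intro h
    exact ⟨fun j hj => h j (by omega), h i le_rfl⟩
  · rintro ⟨h1, h2⟩ j hj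
    rcases hj.eq_or_lt with h | h
    · rwa [Fin.ext h.symm]
    · exact h1 j h

theorem prefixMask_full_eq_iff {α : Type*} {n : ℕ} {x x' : Fin n → α} :
    prefixMask n x = prefixMask n x' ↔ x = x' := by
  rw [prefixMask_eq_iff, funext_iff]; simp

theorem prefixMask_zero_eq {α : Type*} {n : ℕ} (x x' : Fin n → α) :
    prefixMask 0 x = prefixMask 0 x' := by
  rw [prefixMask_eq_iff]; simp

theorem suffixMask_zero_eq_iff {α : Type*} {n : ℕ} {x x' : Fin n → α} :
    suffixMask 0 x = suffixMask 0 x' ↔ x = x' := by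
  rw [suffixMask_eq_iff, funext_iff]; simp

theorem suffixMask_full_eq {α : Type*} {n : ℕ} (x x' : Fin n → α) :
    suffixMask n x = suffixMask n x' := by
  rw [suffixMask_eq_iff]; intro j hj; omega

theorem sum_fin_sub {n : ℕ} (f : ℕ → ℝ) : ∑ i : Fin n, (f (i + 1) - f i) = f n - f 0 := by
  rw [← Finset.sum_range fun i => f (i + 1) - f i, Finset.sum_range_sub]

section SingleLetter

variable {Ω 𝒳 𝒴 κ : Type*} [Fintype Ω] [Fintype 𝒳] [Fintype 𝒴] [Fintype κ]

/-- The cross entropy of `q` relative to `P`. -/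
noncomputable def crossEntropy (P q : 𝒳 × 𝒴 → ℝ) : ℝ := -∑ t, q t * Real.logb 2 (P t)

/-- The cross entropy of the first marginal of `q` relative to that of `P`. -/
noncomputable def crossEntropyFst (P q : 𝒳 × 𝒴 → ℝ) : ℝ :=
  -∑ t, q t * Real.logb 2 (∑ y, P (t.1, y))

/-- The cross entropy of the second marginal of `q` relative to that of `P`. -/
noncomputable def crossEntropySnd (P q : 𝒳 × 𝒴 → ℝ) : ℝ :=
  -∑ t, q t * Real.logb 2 (∑ x, P (x, t.2))

theorem logb_prod_pos {α : Type*} {n : ℕ} (w : Ω → ℝ) (hw : ∀ ω, 0 ≤ w ω) (g : Ω → Fin n → α)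
    (r : α → ℝ) (hr : ∀ ω, 0 < w ω → ∀ i, 0 < r (g ω i)) :
    ∑ ω, w ω * Real.logb 2 (∏ i, r (g ω i)) = ∑ i, ∑ ω, w ω * Real.logb 2 (r (g ω i)) := by
  rw [Finset.sum_comm]
  refine Finset.sum_congr rfl fun ω _ => ?_
  rcases (hw ω).eq_or_lt with h0 | h0
  · simp [← h0]
  rw [Real.logb_prod _ _ fun i _ => (hr ω h0 i).ne', Finset.mul_sum]

set_option maxHeartbeats 1000000 in
/-- The letters of `(X ^ n, Y ^ n)` under a law that is at most `C` times an i.i.d. law, with the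
auxiliary variables `U_i = (K, X_1, …, X_{i-1}, Y_{i+1}, …, Y_n)` for a function `K` of `X ^ n`,
give on average a point of the convex region that satisfies, up to `(log C) / n`, the constraints of
the auxiliary problem. Bounds are in terms of cross entropies relative to `P`, as these are linear
in the law of a letter. -/
theorem exists_mem_auxRegion {w : Ω → ℝ} (hw : w ∈ stdSimplex ℝ Ω) {n : ℕ} (hn : 0 < n)
    (xs : Ω → Fin n → 𝒳) (ys : Ω → Fin n → 𝒴) (K : Ω → κ)
    (hK : ∀ ω ω', xs ω = xs ω' → K ω = K ω') (P : FinDist (𝒳 × 𝒴)) {C : ℝ} (hC : 0 < C)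
    (hdom : ∀ x y, mass w (fun ω => (xs ω, ys ω)) (x, y) ≤ C * ∏ i, P.1 (x i, y i)) :
    ∃ s ∈ auxRegion 𝒳 𝒴, (∀ t, P.1 t = 0 → s.1 t = 0) ∧
      crossEntropy P.1 s.1 - entropy s.1 ≤ Real.logb 2 C / n ∧
      crossEntropy P.1 s.1 - crossEntropyFst P.1 s.1 - (s.2.2.2 - s.2.1) ≤ Real.logb 2 C / n ∧
      ent w K / n ≤ crossEntropyFst P.1 s.1 - s.2.1 ∧
      crossEntropyFst P.1 s.1 - crossEntropySnd P.1 s.1 - (s.2.1 - s.2.2.1) ≤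
        (ent w (fun ω => (K ω, ys ω)) - ent w ys + Real.logb 2 C) / n := by
  classical
  have hn' : (0 : ℝ) < n := by exact_mod_cast hn
  set U : Fin n → Ω → κ × (Fin n → Option 𝒳) × (Fin n → Option 𝒴) := fun i ω =>
    (K ω, prefixMask i (xs ω), suffixMask (i + 1) (ys ω)) with hU
  set A : ℕ → Ω → κ × (Fin n → Option 𝒳) × (Fin n → Option 𝒴) := fun i ω =>
    (K ω, prefixMask i (xs ω), suffixMask i (ys ω)) with hA
  set B : ℕ → Ω → κ × (Fin n → Option 𝒳) := fun i ω => (K ω, prefixMask i (xs ω)) with hB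
  set D : ℕ → Ω → (Fin n → 𝒳) × (Fin n → Option 𝒴) := fun i ω =>
    (xs ω, suffixMask i (ys ω)) with hD
  set T : Fin n → Ω → 𝒳 × 𝒴 := fun i ω => (xs ω i, ys ω i) with hT
  -- the law of one letter is absolutely continuous with respect to `P`
  have hP1 : ∀ ω, 0 < w ω → 0 < ∏ i, P.1 (xs ω i, ys ω i) := fun ω h0 => by
    have h1 := (h0.trans_le (le_mass hw.1 (fun ω => (xs ω, ys ω)) ω)).trans_le (hdom _ _)
    exact (pos_iff_pos_of_mul_pos h1).1 hC
  have hPpos : ∀ ω, 0 < w ω → ∀ i, 0 < P.1 (xs ω i, ys ω i) := fun ω h0 i => by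
    refine lt_of_le_of_ne (P.2.1 _) fun h => ?_
    exact (hP1 ω h0).ne' (Finset.prod_eq_zero (Finset.mem_univ i) h.symm)
  have hPX1 : ∑ x, (fun x => ∑ y, P.1 (x, y)) x = 1 := by
    rw [← Fintype.sum_prod_type]; exact P.2.2
  have hPY1 : ∑ y, (fun y => ∑ x, P.1 (x, y)) y = 1 := by
    rw [← Fintype.sum_prod_type_right]; exact P.2.2
  have hPX : ∀ ω, 0 < w ω → ∀ i, 0 < ∑ y, P.1 (xs ω i, y) := fun ω h0 i =>
    (hPpos ω h0 i).trans_le (Finset.single_le_sum (f := fun y => P.1 (xs ω i, y))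
      (fun _ _ => P.2.1 _) (Finset.mem_univ _))
  have hPY : ∀ ω, 0 < w ω → ∀ i, 0 < ∑ x, P.1 (x, ys ω i) := fun ω h0 i =>
    (hPpos ω h0 i).trans_le (Finset.single_le_sum (f := fun x => P.1 (x, ys ω i))
      (fun _ _ => P.2.1 _) (Finset.mem_univ _))
  set s : (𝒳 × 𝒴 → ℝ) × ℝ × ℝ × ℝ :=
    ∑ i : Fin n, (1 / (n : ℝ)) • jointPoint (mass w fun ω => (U i ω, T i ω)) with hs
  have hs1 : ∀ t, s.1 t = (∑ i, mass w (T i) t) / n := fun t => by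
    rw [hs, Prod.fst_sum, Finset.sum_apply, Finset.sum_div]
    refine Finset.sum_congr rfl fun i _ => ?_
    simp only [Prod.smul_fst, Pi.smul_apply, smul_eq_mul, jointPoint]
    have : margXY (mass w fun ω => (U i ω, T i ω)) t = mass w (T i) t := by
      simp only [margXY, mass, Prod.mk.injEq]
      rw [Finset.sum_comm]
      refine Finset.sum_congr rfl fun ω _ => ?_
      by_cases h : T i ω = t <;> simp [h]
    rw [this]; ring
  have hjX : ∀ i, margUX (mass w fun ω => (U i ω, T i ω)) = mass w fun ω => (U i ω, xs ω i) := by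
    intro i; funext t
    simp only [margUX, mass, hT, Prod.mk.injEq]
    rw [Finset.sum_comm]
    refine Finset.sum_congr rfl fun ω _ => ?_
    by_cases h1 : U i ω = t.1 <;> by_cases h2 : xs ω i = t.2 <;> simp [h1, h2, Prod.ext_iff]
  have hjY : ∀ i, margUY (mass w fun ω => (U i ω, T i ω)) = mass w fun ω => (U i ω, ys ω i) := by
    intro i; funext t
    simp only [margUY, mass, hT, Prod.mk.injEq]
    rw [Finset.sum_comm]
    refine Finset.sum_congr rfl fun ω _ => ?_
    by_cases h1 : U i ω = t.1 <;> by_cases h2 : ys ω i = t.2 <;> simp [h1, h2, Prod.ext_iff]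
  have hjU : ∀ i, margU (mass w fun ω => (U i ω, T i ω)) = mass w (U i) := by
    intro i; funext t
    simp only [margU, mass, Prod.mk.injEq]
    rw [Finset.sum_comm]
    refine Finset.sum_congr rfl fun ω _ => ?_
    by_cases h1 : U i ω = t <;> simp [h1]
  have hsa : n * s.2.1 = ∑ i, (ent w (fun ω => (U i ω, xs ω i)) - ent w (U i)) := by
    rw [hs, Prod.snd_sum, Prod.fst_sum, Finset.mul_sum]
    refine Finset.sum_congr rfl fun i _ => ?_
    simp only [Prod.smul_snd, Prod.smul_fst, smul_eq_mul, jointPoint, hjX, hjU, entropy_mass]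
    field_simp
  have hsb : n * s.2.2.1 = ∑ i, (ent w (fun ω => (U i ω, ys ω i)) - ent w (U i)) := by
    rw [hs, Prod.snd_sum, Prod.snd_sum, Prod.fst_sum, Finset.mul_sum]
    refine Finset.sum_congr rfl fun i _ => ?_
    simp only [Prod.smul_snd, Prod.smul_fst, smul_eq_mul, jointPoint, hjY, hjU, entropy_mass]
    field_simp
  have hsc : n * s.2.2.2 = ∑ i, (ent w (fun ω => (U i ω, T i ω)) - ent w (U i)) := by
    rw [hs, Prod.snd_sum, Prod.snd_sum, Prod.snd_sum, Finset.mul_sum]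
    refine Finset.sum_congr rfl fun i _ => ?_
    simp only [Prod.smul_snd, smul_eq_mul, jointPoint, hjU, entropy_mass]
    field_simp
  have hmem : s ∈ auxRegion 𝒳 𝒴 :=
    (convex_convexHull ℝ _).sum_mem (fun i _ => by positivity) (by simp [hn'.ne'])
      fun i _ => jointPoint_mem (mass_mem_stdSimplex hw _)
  have hs0 : ∀ t, 0 ≤ s.1 t := fun t => by
    rw [hs1]; exact div_nonneg (Finset.sum_nonneg fun i _ => mass_nonneg hw.1 _ _) hn'.le
  have hsum : ∀ F : 𝒳 × 𝒴 → ℝ, n * ∑ t, s.1 t * F t = ∑ i, ∑ ω, w ω * F (xs ω i, ys ω i) := by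
    intro F
    rw [Finset.mul_sum]
    have : ∀ t, n * (s.1 t * F t) = ∑ i, mass w (T i) t * F t := fun t => by
      rw [hs1, ← Finset.sum_mul]; field_simp
    simp only [this]
    rw [Finset.sum_comm]
    exact Finset.sum_congr rfl fun i _ => sum_mass_mul w (T i) F
  have hsum1 : ∑ t, s.1 t = 1 := by
    have := hsum fun _ => 1
    simp only [mul_one, hw.2, Finset.sum_const, Finset.card_univ, Fintype.card_fin, nsmul_eq_mul]
      at this
    exact mul_left_cancel₀ hn'.ne' (by linarith)
  -- entropies of the blocks against cross entropies of the letters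
  have cXY : n * crossEntropy P.1 s.1 =
      -∑ ω, w ω * Real.logb 2 (∏ i, P.1 (xs ω i, ys ω i)) := by
    rw [crossEntropy, mul_neg, hsum,
      logb_prod_pos w hw.1 (fun ω i => (xs ω i, ys ω i)) P.1 hPpos]
  have cX : n * crossEntropyFst P.1 s.1 =
      -∑ ω, w ω * Real.logb 2 (∏ i, ∑ y, P.1 (xs ω i, y)) := by
    rw [crossEntropyFst, mul_neg, hsum fun t => Real.logb 2 (∑ y, P.1 (t.1, y)),
      logb_prod_pos w hw.1 xs (fun x => ∑ y, P.1 (x, y)) hPX]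
  have cY : n * crossEntropySnd P.1 s.1 =
      -∑ ω, w ω * Real.logb 2 (∏ i, ∑ x, P.1 (x, ys ω i)) := by
    rw [crossEntropySnd, mul_neg, hsum fun t => Real.logb 2 (∑ x, P.1 (x, t.2)),
      logb_prod_pos w hw.1 ys (fun y => ∑ x, P.1 (x, y)) hPY]
  have b1 : n * crossEntropy P.1 s.1 - Real.logb 2 C ≤ ent w fun ω => (xs ω, ys ω) := by
    rw [cXY]
    exact cross_le_ent hw (fun ω => (xs ω, ys ω))
      (r := fun t => ∏ i, P.1 (t.1 i, t.2 i)) hC fun ω _ => hdom _ _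
  have b2 : n * crossEntropyFst P.1 s.1 - Real.logb 2 C ≤ ent w xs := by
    rw [cX]
    refine cross_le_ent hw xs (r := fun x => ∏ i, ∑ y, P.1 (x i, y)) hC fun ω _ => ?_
    have e : mass w xs (xs ω) = ∑ y, mass w (fun ω => (xs ω, ys ω)) (xs ω, y) := by
      simp only [mass, Prod.mk.injEq, ite_and]
      rw [Finset.sum_comm]
      refine Finset.sum_congr rfl fun ω' _ => ?_
      split_ifs <;> simp
    rw [e, ← sum_prod_pair_snd, Finset.mul_sum]
    exact Finset.sum_le_sum fun y _ => hdom _ _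
  have b3 : ent w xs ≤ n * crossEntropyFst P.1 s.1 := by
    rw [cX]
    refine ent_le_cross hw xs (r := fun x => ∏ i, ∑ y, P.1 (x i, y))
      (fun x => Finset.prod_nonneg fun i _ => Finset.sum_nonneg fun y _ => P.2.1 _)
      (sum_prod_eq_one hPX1 n).le fun ω h0 => Finset.prod_pos fun i _ => hPX ω h0 i
  have b4 : ent w ys ≤ n * crossEntropySnd P.1 s.1 := by
    rw [cY]
    refine ent_le_cross hw ys (r := fun y => ∏ i, ∑ x, P.1 (x, y i))
      (fun x => Finset.prod_nonneg fun i _ => Finset.sum_nonneg fun y _ => P.2.1 _)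
      (sum_prod_eq_one hPY1 n).le fun ω h0 => Finset.prod_pos fun i _ => hPY ω h0 i
  have b5 : ent w (fun ω => (xs ω, ys ω)) ≤ n * entropy s.1 := by
    have hqpos : ∀ ω, 0 < w ω → ∀ i, 0 < s.1 (xs ω i, ys ω i) := fun ω h0 i => by
      rw [hs1]
      refine div_pos ?_ hn'
      exact (h0.trans_le (le_mass hw.1 (T i) ω)).trans_le
        (Finset.single_le_sum (f := fun j => mass w (T j) (xs ω i, ys ω i))
          (fun j _ => mass_nonneg hw.1 _ _) (Finset.mem_univ i))
    have e : n * entropy s.1 = -∑ ω, w ω * Real.logb 2 (∏ i, s.1 (xs ω i, ys ω i)) := by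
      rw [entropy, mul_neg, hsum fun t => Real.logb 2 (s.1 t),
        logb_prod_pos w hw.1 (fun ω i => (xs ω i, ys ω i)) s.1 hqpos]
    rw [e]
    refine ent_le_cross hw (fun ω => (xs ω, ys ω)) (r := fun t => ∏ i, s.1 (t.1 i, t.2 i))
      (fun t => Finset.prod_nonneg fun i _ => hs0 _) ?_
      fun ω h0 => Finset.prod_pos fun i _ => hqpos ω h0 i
    rw [Fintype.sum_prod_type]
    simp only [sum_prod_pair_snd]
    exact (sum_prod_eq_one (p := fun x => ∑ y, s.1 (x, y))
      (by rw [← Fintype.sum_prod_type]; exact hsum1) n).le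
  -- telescoping sums over hybrids of `X ^ n` and `Y ^ n`
  have eA1 : ∀ i : Fin n, ent w (fun ω => (U i ω, xs ω i)) = ent w (A (i + 1)) := fun i =>
    ent_congr fun ω ω' _ _ => by
      simp only [hU, hA, Prod.mk.injEq, prefixMask_succ_eq_iff]; tauto
  have eA0 : ∀ i : Fin n, ent w (fun ω => (U i ω, ys ω i)) = ent w (A i) := fun i =>
    ent_congr fun ω ω' _ _ => by
      simp only [hU, hA, Prod.mk.injEq, suffixMask_eq_succ_iff]; tauto
  have tA : n * s.2.1 - n * s.2.2.1 = ent w xs - ent w (fun ω => (K ω, ys ω)) := by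
    have e1 : ent w (A n) = ent w xs := ent_congr fun ω ω' _ _ => by
      simp only [hA, Prod.mk.injEq, prefixMask_full_eq_iff,
        suffixMask_full_eq (ys ω) (ys ω'), and_true]
      exact ⟨fun h => h.2, fun h => ⟨hK _ _ h, h⟩⟩
    have e2 : ent w (A 0) = ent w (fun ω => (K ω, ys ω)) := ent_congr fun ω ω' _ _ => by
      simp only [hA, Prod.mk.injEq, suffixMask_zero_eq_iff,
        prefixMask_zero_eq (xs ω) (xs ω'), true_and]
    rw [hsa, hsb, ← Finset.sum_sub_distrib, ← e1, ← e2, ← sum_fin_sub fun i => ent w (A i)]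
    refine Finset.sum_congr rfl fun i _ => ?_
    rw [eA1, eA0]; ring
  have tB : n * s.2.1 ≤ ent w xs - ent w K := by
    have e1 : ent w (B n) = ent w xs := ent_congr fun ω ω' _ _ => by
      simp only [hB, Prod.mk.injEq, prefixMask_full_eq_iff]
      exact ⟨fun h => h.2, fun h => ⟨hK _ _ h, h⟩⟩
    have e2 : ent w (B 0) = ent w K := ent_congr fun ω ω' _ _ => by
      simp only [hB, Prod.mk.injEq, prefixMask_zero_eq (xs ω) (xs ω'), and_true]
    rw [hsa, ← e1, ← e2, ← sum_fin_sub fun i => ent w (B i)]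
    refine Finset.sum_le_sum fun i _ => ?_
    have h1 := ent_cond_anti hw (U i) (B i) (fun ω => xs ω i) fun ω ω' h => by
      simp only [hU, hB, Prod.mk.injEq] at h ⊢; tauto
    have h2 : ent w (B (i + 1)) = ent w (fun ω => (B i ω, xs ω i)) := ent_congr fun ω ω' _ _ => by
      simp only [hB, Prod.mk.injEq, prefixMask_succ_eq_iff]; tauto
    rw [h2]; exact h1
  have tD : ent w (fun ω => (xs ω, ys ω)) - ent w xs ≤ n * s.2.2.2 - n * s.2.1 := by
    have e1 : ent w (D 0) = ent w (fun ω => (xs ω, ys ω)) := ent_congr fun ω ω' _ _ => by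
      simp only [hD, Prod.mk.injEq, suffixMask_zero_eq_iff]
    have e2 : ent w (D n) = ent w xs := ent_congr fun ω ω' _ _ => by
      simp only [hD, Prod.mk.injEq, suffixMask_full_eq (ys ω) (ys ω'), and_true]
    have e3 := sum_fin_sub (n := n) fun i => -ent w (D i)
    rw [hsa, hsc, ← Finset.sum_sub_distrib, ← e1, ← e2]
    have e4 : ent w (D 0) - ent w (D n) = ∑ i : Fin n, (-ent w (D (i + 1)) - -ent w (D i)) := by
      rw [e3]; ring
    rw [e4]
    refine Finset.sum_le_sum fun i _ => ?_
    have h1 := ent_cond_anti hw (D (i + 1)) (fun ω => (U i ω, xs ω i)) (fun ω => ys ω i)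
      fun ω ω' h => by
        simp only [hU, hD, Prod.mk.injEq] at h ⊢
        obtain ⟨h1, h2⟩ := h
        exact ⟨⟨hK _ _ h1, by rw [h1], h2⟩, by rw [h1]⟩
    have h2 : ent w (D i) = ent w (fun ω => (D (i + 1) ω, ys ω i)) := ent_congr fun ω ω' _ _ => by
      simp only [hD, Prod.mk.injEq, suffixMask_eq_succ_iff]; tauto
    have h3 : ent w (fun ω => (U i ω, T i ω)) = ent w (fun ω => ((U i ω, xs ω i), ys ω i)) :=
      ent_congr fun ω ω' _ _ => by
        simp only [hT, Prod.mk.injEq]; tauto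
    rw [h2, h3]
    linarith
  refine ⟨s, hmem, fun t ht => ?_, ?_, ?_, ?_, ?_⟩
  · rw [hs1]
    have : ∀ i, mass w (T i) t = 0 := fun i => by
      unfold mass
      refine Finset.sum_eq_zero fun ω _ => ?_
      split_ifs with h
      · by_contra h0
        have := hPpos ω (lt_of_le_of_ne (hw.1 ω) (Ne.symm h0)) i
        change T i ω = t at h
        have h' : P.1 (T i ω) = 0 := by rw [h, ht]
        exact this.ne' h'
      · rfl
    simp [this]
  · rw [le_div_iff₀ hn']; linarith
  · rw [le_div_iff₀ hn']; linarith
  · rw [div_le_iff₀ hn']; linarith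
  · rw [le_div_iff₀ hn']; linarith

end SingleLetter

/-! ### The information spectrum of the channel -/

section SpectrumLemmas

variable {𝒯 𝒵 : Type*} [Fintype 𝒯] [Fintype 𝒵]

theorem ioLaw_nonneg (W : Channel 𝒯 𝒵) (T : InputProcess 𝒯) (n : ℕ) (t : Fin n → 𝒯)
    (z : Fin n → 𝒵) : 0 ≤ ioLaw W T n t z :=
  mul_nonneg ((T n).2.1 _) ((W n t).2.1 _)

theorem ioLaw_le_sum (W : Channel 𝒯 𝒵) (T : InputProcess 𝒯) (n : ℕ) (t : Fin n → 𝒯)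
    (z : Fin n → 𝒵) : ioLaw W T n t z ≤ ∑ t', ioLaw W T n t' z :=
  Finset.single_le_sum (f := fun t' => ioLaw W T n t' z) (fun _ _ => ioLaw_nonneg _ _ _ _ _)
    (Finset.mem_univ t)

theorem sum_ioLaw (W : Channel 𝒯 𝒵) (T : InputProcess 𝒯) (n : ℕ) :
    ∑ t, ∑ z, ioLaw W T n t z = 1 := by
  have h : ∀ t, ∑ z, (W n t).1 z = 1 := fun t => (W n t).2.2
  simp only [ioLaw, ← Finset.mul_sum, h, mul_one]
  exact (T n).2.2

theorem infoDensity_eq {W : Channel 𝒯 𝒵} {T : InputProcess 𝒯} {n : ℕ} {t : Fin n → 𝒯}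
    {z : Fin n → 𝒵} (h : 0 < ioLaw W T n t z) : infoDensity W T n t z =
      Real.logb 2 ((W n t).1 z) - Real.logb 2 (∑ t', ioLaw W T n t' z) := by
  have hZ := h.trans_le (ioLaw_le_sum W T n t z)
  have hT : (T n).1 t ≠ 0 := fun h0 => by simp [ioLaw, h0] at h
  have hW : (W n t).1 z ≠ 0 := fun h0 => by simp [ioLaw, h0] at h
  rw [← Real.logb_div hW hZ.ne', infoDensity]
  congr 1
  rw [ioLaw, mul_comm ((T n).1 t), mul_div_mul_right _ _ hT]

theorem spectrumProb_nonneg (W : Channel 𝒯 𝒵) (T : InputProcess 𝒯) (R : ℝ) (n : ℕ) :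
    0 ≤ spectrumProb W T R n :=
  Finset.sum_nonneg fun t _ => Finset.sum_nonneg fun z _ => by
    split_ifs
    · exact ioLaw_nonneg _ _ _ _ _
    · exact le_rfl

theorem spectrumProb_le_one (W : Channel 𝒯 𝒵) (T : InputProcess 𝒯) (R : ℝ) (n : ℕ) :
    spectrumProb W T R n ≤ 1 := by
  rw [← sum_ioLaw W T n]
  refine Finset.sum_le_sum fun t _ => Finset.sum_le_sum fun z _ => ?_
  split_ifs
  · exact le_rfl
  · exact ioLaw_nonneg _ _ _ _ _

theorem isBoundedUnder_spectrumProb (W : Channel 𝒯 𝒵) (T : InputProcess 𝒯) (R : ℝ) :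
    Filter.IsBoundedUnder (· ≤ ·) Filter.atTop (spectrumProb W T R) :=
  Filter.isBoundedUnder_of ⟨1, fun n => spectrumProb_le_one W T R n⟩

theorem isCoboundedUnder_spectrumProb (W : Channel 𝒯 𝒵) (T : InputProcess 𝒯) (R : ℝ) :
    Filter.IsCoboundedUnder (· ≤ ·) Filter.atTop (spectrumProb W T R) :=
  (Filter.isBoundedUnder_of ⟨0, fun n => spectrumProb_nonneg W T R n⟩ :
    Filter.IsBoundedUnder (· ≥ ·) Filter.atTop (spectrumProb W T R)).isCoboundedUnder_le

theorem two_rpow_mul_tendsto {R : ℝ} (hR : R < 0) :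
    Filter.Tendsto (fun n : ℕ => (2 : ℝ) ^ ((n : ℝ) * R)) Filter.atTop (nhds 0) := by
  have h : (fun n : ℕ => (2 : ℝ) ^ ((n : ℝ) * R)) = fun n : ℕ => ((2 : ℝ) ^ R) ^ n := by
    funext n
    rw [mul_comm, Real.rpow_mul (by norm_num), Real.rpow_natCast]
  rw [h]
  exact tendsto_pow_atTop_nhds_zero_of_lt_one (by positivity)
    (Real.rpow_lt_one_of_one_lt_of_neg (by norm_num) hR)

/-- A negative information density is exponentially unlikely. -/
theorem spectrumLimsup_eq_zero (W : Channel 𝒯 𝒵) (T : InputProcess 𝒯) {R : ℝ} (hR : R < 0) :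
    spectrumLimsup W T R = 0 := by
  refine Filter.Tendsto.limsup_eq ?_
  refine tendsto_of_tendsto_of_tendsto_of_le_of_le' tendsto_const_nhds (two_rpow_mul_tendsto hR)
    (Filter.Eventually.of_forall fun n => spectrumProb_nonneg W T R n) ?_
  filter_upwards [Filter.eventually_gt_atTop 0] with n hn
  have hn' : (0 : ℝ) < n := by exact_mod_cast hn
  have key : ∀ t z, (if infoDensity W T n t z / n ≤ R then ioLaw W T n t z else 0) ≤
      (T n).1 t * ((2 : ℝ) ^ ((n : ℝ) * R) * ∑ t', ioLaw W T n t' z) := fun t z => by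
    have hZ0 : 0 ≤ ∑ t', ioLaw W T n t' z := Finset.sum_nonneg fun _ _ => ioLaw_nonneg _ _ _ _ _
    split_ifs with h
    · rcases (ioLaw_nonneg W T n t z).eq_or_lt with h0 | h0
      · rw [← h0]
        exact mul_nonneg ((T n).2.1 _) (by positivity)
      · have hZ := h0.trans_le (ioLaw_le_sum W T n t z)
        have hW : 0 < (W n t).1 z := lt_of_le_of_ne ((W n t).2.1 z) fun h1 => by
          simp [ioLaw, ← h1] at h0
        rw [div_le_iff₀ hn', infoDensity_eq h0, ← Real.logb_div hW.ne' hZ.ne',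
          Real.logb_le_iff_le_rpow (by norm_num) (by positivity), div_le_iff₀ hZ] at h
        rw [mul_comm (n : ℝ)]
        exact mul_le_mul_of_nonneg_left h ((T n).2.1 _)
    · exact mul_nonneg ((T n).2.1 _) (by positivity)
  have hT1 : ∑ t, (T n).1 t = 1 := (T n).2.2
  calc spectrumProb W T R n ≤
      ∑ t, ∑ z, (T n).1 t * ((2 : ℝ) ^ ((n : ℝ) * R) * ∑ t', ioLaw W T n t' z) :=
        Finset.sum_le_sum fun t _ => Finset.sum_le_sum fun z _ => key t z
    _ = (2 : ℝ) ^ ((n : ℝ) * R) := by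
        simp only [← Finset.mul_sum, ← Finset.sum_mul, hT1, one_mul]
        rw [Finset.sum_comm, sum_ioLaw, mul_one]

/-- An information density exceeding `log |𝒯| + 1` per letter is exponentially unlikely. -/
theorem spectrumLimsup_eq_one [Nonempty 𝒯] (W : Channel 𝒯 𝒵) (T : InputProcess 𝒯) {R : ℝ}
    (hR : Real.logb 2 (Fintype.card 𝒯) + 1 < R) : spectrumLimsup W T R = 1 := by
  have hc : (0 : ℝ) < Fintype.card 𝒯 := by exact_mod_cast Fintype.card_pos
  refine Filter.Tendsto.limsup_eq ?_
  have hlim : Filter.Tendsto (fun n : ℕ => 1 - (2 : ℝ) ^ ((n : ℝ) * (-1))) Filter.atTop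
      (nhds 1) := by
    simpa using (two_rpow_mul_tendsto (R := -1) (by norm_num)).const_sub 1
  refine tendsto_of_tendsto_of_tendsto_of_le_of_le' hlim tendsto_const_nhds ?_
    (Filter.Eventually.of_forall fun n => spectrumProb_le_one W T R n)
  filter_upwards [Filter.eventually_gt_atTop 0] with n hn
  have hn' : (0 : ℝ) < n := by exact_mod_cast hn
  set b : ℝ := (2 : ℝ) ^ (-((n : ℝ) * (Real.logb 2 (Fintype.card 𝒯) + 1))) with hb
  have key : ∀ t z, ioLaw W T n t z ≤
      (if infoDensity W T n t z / n ≤ R then ioLaw W T n t z else 0) + b * (W n t).1 z := by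
    intro t z
    have hbW : 0 ≤ b * (W n t).1 z := mul_nonneg (by positivity) ((W n t).2.1 z)
    split_ifs with h
    · linarith
    · rcases (ioLaw_nonneg W T n t z).eq_or_lt with h0 | h0
      · rw [← h0]; linarith
      · have hZ := h0.trans_le (ioLaw_le_sum W T n t z)
        have hW : 0 < (W n t).1 z := lt_of_le_of_ne ((W n t).2.1 z) fun h1 => by
          simp [ioLaw, ← h1] at h0
        have hT : 0 < (T n).1 t := lt_of_le_of_ne ((T n).2.1 t) fun h1 => by
          simp [ioLaw, ← h1] at h0
        rw [not_le, lt_div_iff₀ hn', infoDensity_eq h0] at h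
        have h2 : Real.logb 2 (ioLaw W T n t z) ≤ Real.logb 2 (∑ t', ioLaw W T n t' z) :=
          Real.logb_le_logb_of_le (by norm_num) h0 (ioLaw_le_sum W T n t z)
        rw [ioLaw, Real.logb_mul hT.ne' hW.ne'] at h2
        have h3 : Real.logb 2 ((T n).1 t) ≤ -((n : ℝ) * (Real.logb 2 (Fintype.card 𝒯) + 1)) := by
          nlinarith
        rw [Real.logb_le_iff_le_rpow (by norm_num) hT] at h3
        rw [zero_add, ioLaw]
        exact mul_le_mul_of_nonneg_right h3 hW.le
  have hW1 : ∀ t, ∑ z, (W n t).1 z = 1 := fun t => (W n t).2.2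
  have h1 : (1 : ℝ) ≤ spectrumProb W T R n + ∑ _t : Fin n → 𝒯, b := by
    have hsum := Finset.sum_le_sum fun t (_ : t ∈ Finset.univ) =>
      Finset.sum_le_sum fun z (_ : z ∈ Finset.univ) => key t z
    rw [sum_ioLaw] at hsum
    simp only [Finset.sum_add_distrib, ← Finset.mul_sum, hW1, mul_one] at hsum
    exact hsum
  have h2 : ∑ _t : Fin n → 𝒯, b = (2 : ℝ) ^ ((n : ℝ) * (-1)) := by
    rw [Finset.sum_const, Finset.card_univ, Fintype.card_fun, Fintype.card_fin, nsmul_eq_mul,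
      hb, Nat.cast_pow]
    have e : ((Fintype.card 𝒯 : ℝ)) ^ n = (2 : ℝ) ^ ((n : ℝ) * Real.logb 2 (Fintype.card 𝒯)) := by
      rw [mul_comm, Real.rpow_mul (by norm_num), Real.rpow_logb (by norm_num) (by norm_num) hc,
        Real.rpow_natCast]
    rw [e, ← Real.rpow_add (by norm_num)]
    congr 1; ring
  linarith

theorem spectrum_subset (W : Channel 𝒯 𝒵) (T : InputProcess 𝒯) (ε : ℝ) :
    {R : ℝ | spectrumLimsup W T R < ε} ⊆ {R : ℝ | spectrumLimsup W T R ≤ ε} :=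
  fun R (h : spectrumLimsup W T R < ε) => h.le

theorem mem_upperBounds_spectrum [Nonempty 𝒯] (W : Channel 𝒯 𝒵) (T : InputProcess 𝒯) {ε : ℝ}
    (h1 : ε < 1) : Real.logb 2 (Fintype.card 𝒯) + 1 ∈
      upperBounds {R : ℝ | spectrumLimsup W T R ≤ ε} := by
  intro R hR
  by_contra h
  rw [not_le] at h
  have := spectrumLimsup_eq_one W T h
  change spectrumLimsup W T R ≤ ε at hR
  linarith

theorem neg_mem_spectrum (W : Channel 𝒯 𝒵) (T : InputProcess 𝒯) {ε R : ℝ} (h0 : 0 < ε)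
    (hR : R < 0) : R ∈ {R : ℝ | spectrumLimsup W T R < ε} := by
  change spectrumLimsup W T R < ε
  rw [spectrumLimsup_eq_zero W T hR]; exact h0

theorem bddAbove_upper [Nonempty 𝒯] (W : Channel 𝒯 𝒵) {ε : ℝ} (h0 : 0 < ε) (h1 : ε < 1) :
    BddAbove (Set.range fun T : InputProcess 𝒯 => sSup {R : ℝ | spectrumLimsup W T R ≤ ε}) := by
  refine ⟨Real.logb 2 (Fintype.card 𝒯) + 1, ?_⟩
  rintro _ ⟨T, rfl⟩
  exact csSup_le ⟨-1, spectrum_subset W T ε (neg_mem_spectrum W T h0 (by norm_num))⟩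
    (mem_upperBounds_spectrum W T h1)

theorem sSup_spectrum_le [Nonempty 𝒯] (W : Channel 𝒯 𝒵) (T : InputProcess 𝒯) {ε : ℝ}
    (h0 : 0 < ε) (h1 : ε < 1) : sSup {R : ℝ | spectrumLimsup W T R < ε} ≤
      sSup {R : ℝ | spectrumLimsup W T R ≤ ε} :=
  csSup_le_csSup ⟨_, mem_upperBounds_spectrum W T h1⟩
    ⟨-1, neg_mem_spectrum W T h0 (by norm_num)⟩ (spectrum_subset W T ε)

theorem bddAbove_lower [Nonempty 𝒯] (W : Channel 𝒯 𝒵) {ε : ℝ} (h0 : 0 < ε) (h1 : ε < 1) :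
    BddAbove (Set.range fun T : InputProcess 𝒯 => sSup {R : ℝ | spectrumLimsup W T R < ε}) := by
  obtain ⟨b, hb⟩ := bddAbove_upper W h0 h1
  refine ⟨b, ?_⟩
  rintro _ ⟨T, rfl⟩
  exact (sSup_spectrum_le W T h0 h1).trans (hb ⟨T, rfl⟩)

theorem nonempty_inputProcess [Nonempty 𝒯] : Nonempty (InputProcess 𝒯) := by
  classical
  exact ⟨fun n => ⟨Pi.single (Classical.arbitrary _) 1, single_mem_stdSimplex ℝ _⟩⟩

theorem le_upperRate [Nonempty 𝒯] {W : Channel 𝒯 𝒵} {T : InputProcess 𝒯} {ε R : ℝ}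
    (h0 : 0 < ε) (h1 : ε < 1) (h : spectrumLimsup W T R ≤ ε) : R ≤ upperRate W ε :=
  (le_csSup ⟨_, mem_upperBounds_spectrum W T h1⟩ h).trans
    (le_ciSup (bddAbove_upper W h0 h1) T)

theorem exists_of_lt_lowerRate [Nonempty 𝒯] {W : Channel 𝒯 𝒵} {ε r : ℝ} (h0 : 0 < ε)
    (h : r < lowerRate W ε) : ∃ (T : InputProcess 𝒯) (R : ℝ), r < R ∧ spectrumLimsup W T R < ε := by
  have := nonempty_inputProcess (𝒯 := 𝒯)
  obtain ⟨T, hT⟩ := exists_lt_of_lt_ciSup h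
  obtain ⟨R, hR, hr⟩ := exists_lt_of_lt_csSup
    ⟨-1, neg_mem_spectrum W T h0 (by norm_num)⟩ hT
  exact ⟨T, R, hr, hR⟩

theorem lowerRate_nonneg [Nonempty 𝒯] (W : Channel 𝒯 𝒵) {ε : ℝ} (h0 : 0 < ε) (h1 : ε < 1) :
    0 ≤ lowerRate W ε := by
  obtain ⟨T⟩ := nonempty_inputProcess (𝒯 := 𝒯)
  refine le_trans ?_ (le_ciSup (bddAbove_lower W h0 h1) T)
  refine le_of_forall_lt_imp_le_of_dense fun R hR => ?_
  exact le_csSup ⟨_, fun R hR => mem_upperBounds_spectrum W T h1 (spectrum_subset W T ε hR)⟩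
    (neg_mem_spectrum W T h0 hR)

theorem lowerRate_le_upperRate [Nonempty 𝒯] (W : Channel 𝒯 𝒵) {ε : ℝ} (h0 : 0 < ε) (h1 : ε < 1) :
    lowerRate W ε ≤ upperRate W ε :=
  ciSup_mono (bddAbove_upper W h0 h1) fun T => sSup_spectrum_le W T h0 h1

theorem upperRate_le_lowerRate [Nonempty 𝒯] (W : Channel 𝒯 𝒵) {ε ε' : ℝ} (h0 : 0 < ε)
    (h : ε < ε') (h1 : ε' < 1) : upperRate W ε ≤ lowerRate W ε' := by
  refine ciSup_mono (bddAbove_lower W (h0.trans h) h1) fun T => ?_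
  refine csSup_le_csSup
    ⟨_, fun R hR => mem_upperBounds_spectrum W T h1 (spectrum_subset W T ε' hR)⟩
    ⟨-1, spectrum_subset W T ε (neg_mem_spectrum W T h0 (by norm_num))⟩ ?_
  intro R hR
  exact lt_of_le_of_lt hR h

/-- The open intervals `(l(ε), u(ε))` are pairwise disjoint. -/
theorem countable_lowerRate_ne_upperRate [Nonempty 𝒯] (W : Channel 𝒯 𝒵) :
    {ε : ℝ | 0 < ε ∧ ε < 1 ∧ lowerRate W ε ≠ upperRate W ε}.Countable := by
  have hdisj : ∀ a ∈ {ε : ℝ | 0 < ε ∧ ε < 1 ∧ lowerRate W ε ≠ upperRate W ε},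
      ∀ b ∈ {ε : ℝ | 0 < ε ∧ ε < 1 ∧ lowerRate W ε ≠ upperRate W ε}, a < b →
      Disjoint (Set.Ioo (lowerRate W a) (upperRate W a))
        (Set.Ioo (lowerRate W b) (upperRate W b)) := by
    rintro a ⟨ha, -, -⟩ b ⟨-, hb, -⟩ hab
    rw [Set.disjoint_left]
    rintro x ⟨-, hx⟩ ⟨hx', -⟩
    have := upperRate_le_lowerRate W ha hab hb
    linarith
  refine Set.PairwiseDisjoint.countable_of_isOpen
    (s := fun ε => Set.Ioo (lowerRate W ε) (upperRate W ε))
    (fun a ha b hb hab => ?_) (fun _ _ => isOpen_Ioo) fun a ha => ?_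
  · rcases lt_or_gt_of_ne hab with h | h
    · exact hdisj a ha b hb h
    · exact (hdisj b hb a ha h).symm
  · obtain ⟨h0, h1, hne⟩ := ha
    exact Set.nonempty_Ioo.2 (lt_of_le_of_ne (lowerRate_le_upperRate W h0 h1) hne)

end SpectrumLemmas

/-! ### The converse -/

theorem mass_id {Ω : Type*} [Fintype Ω] (w : Ω → ℝ) : mass w (fun ω => ω) = w := by
  classical
  funext ω
  rw [mass, Finset.sum_eq_single ω] <;> simp +contextual

theorem mass_le_mul {Ω α : Type*} [Fintype Ω] {w w' : Ω → ℝ} {C : ℝ} (h : ∀ ω, w ω ≤ C * w' ω)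
    (f : Ω → α) (a : α) : mass w f a ≤ C * mass w' f a := by
  unfold mass
  rw [Finset.mul_sum]
  refine Finset.sum_le_sum fun t _ => ?_
  split_ifs
  · exact h t
  · simp

/-- If `q ≤ C p` and `p` is nearly uniform in the sense of entropy, then so is `q`. -/
theorem le_entropy_of_le_mul {κ : Type*} [Fintype κ] [Nonempty κ] {p q : κ → ℝ}
    (hp : p ∈ stdSimplex ℝ κ) (hq : q ∈ stdSimplex ℝ κ) {C : ℝ} (hC : 1 ≤ C)
    (hqp : ∀ k, q k ≤ C * p k) :
    Real.logb 2 (Fintype.card κ) - C * (Real.logb 2 (Fintype.card κ) - entropy p + 2)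
      - Real.logb 2 C ≤ entropy q := by
  have hN : (0 : ℝ) < Fintype.card κ := by exact_mod_cast Fintype.card_pos
  have hC0 : 0 < C := by linarith
  have hl2 : 1 / 2 ≤ Real.log 2 := by linarith [Real.log_two_gt_d9]
  set N : ℝ := (Fintype.card κ : ℝ) with hNdef
  have h1 : ∀ k, q k * (Real.logb 2 N + Real.logb 2 (p k)) ≤
      C * (p k * (Real.logb 2 N + Real.logb 2 (p k)) + 2 / N) := fun k => by
    rcases (hp.1 k).eq_or_lt with h0 | h0
    · have : q k = 0 := le_antisymm (by have := hqp k; rw [← h0] at this; simpa using this) (hq.1 k)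
      rw [this, ← h0]; simp only [zero_mul, zero_add]; positivity
    rw [← Real.logb_mul hN.ne' h0.ne']
    rcases le_total 0 (Real.logb 2 (N * p k)) with h | h
    · calc q k * Real.logb 2 (N * p k) ≤ C * p k * Real.logb 2 (N * p k) :=
            mul_le_mul_of_nonneg_right (hqp k) h
        _ ≤ _ := by
            rw [mul_assoc]
            refine mul_le_mul_of_nonneg_left ?_ hC0.le
            have : 0 ≤ 2 / N := by positivity
            linarith
    · have h2 : q k * Real.logb 2 (N * p k) ≤ 0 := mul_nonpos_of_nonneg_of_nonpos (hq.1 k) h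
      -- `t log t ≥ t - 1` at `t = N p k`
      have h3 : -2 / N ≤ p k * Real.logb 2 (N * p k) := by
        have ht : 0 < N * p k := by positivity
        have h4 := Real.one_sub_inv_le_log_of_pos ht
        have h5 : -1 ≤ N * p k * Real.log (N * p k) := by
          have := mul_le_mul_of_nonneg_left h4 ht.le
          rw [mul_sub, mul_inv_cancel₀ ht.ne'] at this
          linarith
        rw [Real.logb, div_le_iff₀ hN, mul_comm, ← mul_assoc, mul_div_assoc',
          le_div_iff₀ (by linarith)]
        nlinarith
      refine h2.trans (mul_nonneg hC0.le ?_)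
      have : -2 / N = -(2 / N) := by ring
      linarith
  have h2 := Finset.sum_le_sum fun k (_ : k ∈ Finset.univ) => h1 k
  have h3 : ∑ k, q k * Real.logb 2 (q k) ≤ ∑ k, q k * (Real.logb 2 C + Real.logb 2 (p k)) := by
    refine Finset.sum_le_sum fun k _ => ?_
    rcases (hq.1 k).eq_or_lt with h0 | h0
    · simp [← h0]
    have hpk : 0 < p k := (pos_iff_pos_of_mul_pos (h0.trans_le (hqp k))).1 hC0
    rw [← Real.logb_mul hC0.ne' hpk.ne']
    exact mul_le_mul_of_nonneg_left (Real.logb_le_logb_of_le (by norm_num) h0 (hqp k)) h0.le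
  have hN2 : (∑ _k : κ, 2 / N) = 2 := by
    rw [Finset.sum_const, Finset.card_univ, nsmul_eq_mul, ← hNdef]; field_simp
  simp only [mul_add, Finset.sum_add_distrib, ← Finset.mul_sum, ← Finset.sum_mul, hq.2, hp.2,
    one_mul, hN2] at h2 h3
  have e1 : entropy p = -∑ k, p k * Real.logb 2 (p k) := rfl
  have e2 : entropy q = -∑ k, q k * Real.logb 2 (q k) := rfl
  rw [e1, e2]
  linarith

/-- A decoder that recovers a function `K` of `x` from `y` and the output `z` of a channel with
input `x` bounds `H(K|Y)` by the information density of the channel, under any law `Q` dominated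
by the law `p(x, y) V(z|x)` of the three variables. -/
theorem ent_pair_sub_le {𝒜 ℬ 𝒞 κ : Type*} [Fintype 𝒜] [Fintype ℬ] [Fintype 𝒞] [Fintype κ]
    {Q : 𝒜 × ℬ × 𝒞 → ℝ} (hQ : Q ∈ stdSimplex ℝ (𝒜 × ℬ × 𝒞)) {p : 𝒜 × ℬ → ℝ}
    (hp : p ∈ stdSimplex ℝ (𝒜 × ℬ)) (V : 𝒜 → 𝒞 → ℝ) {r : 𝒞 → ℝ} (hr : r ∈ stdSimplex ℝ 𝒞)
    {C ρ : ℝ} (hC : 0 < C) (hdom : ∀ t, Q t ≤ C * (p (t.1, t.2.1) * V t.1 t.2.2))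
    (K : 𝒜 → κ) (Ψ : ℬ → 𝒞 → κ)
    (hsupp : ∀ t, 0 < Q t → 0 < p (t.1, t.2.1) ∧ 0 < V t.1 t.2.2 ∧ 0 < r t.2.2 ∧
      K t.1 = Ψ t.2.1 t.2.2 ∧ Real.logb 2 (V t.1 t.2.2) - Real.logb 2 (r t.2.2) ≤ ρ) :
    ent Q (fun t => (K t.1, t.2.1)) - ent Q (fun t => t.2.1) ≤ ρ + Real.logb 2 C := by
  have a1 := ent_cond_anti hQ (fun t => t.2.1) (fun _ => ()) (fun t => t.2.2)
    fun _ _ _ => rfl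
  have a2 : ent Q (fun t => ((), t.2.2)) = ent Q fun t => t.2.2 :=
    ent_congr fun ω ω' _ _ => by simp
  have a3 := ent_nonneg hQ fun _ => ()
  have a4 : ent Q (fun t => (t.2.1, t.2.2)) = ent Q fun t => ((K t.1, t.2.1), t.2.2) :=
    ent_congr fun ω ω' h h' => by
      have k1 := (hsupp ω (lt_of_le_of_ne (hQ.1 ω) (Ne.symm h))).2.2.2.1
      have k2 := (hsupp ω' (lt_of_le_of_ne (hQ.1 ω') (Ne.symm h'))).2.2.2.1
      simp only [Prod.mk.injEq, k1, k2]
      constructor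
      · rintro ⟨h1, h2⟩; exact ⟨⟨by rw [h1, h2], h1⟩, h2⟩
      · rintro ⟨⟨-, h1⟩, h2⟩; exact ⟨h1, h2⟩
  have a5 := ent_cond_anti hQ (fun t => (t.1, t.2.1)) (fun t => (K t.1, t.2.1)) (fun t => t.2.2)
    fun ω ω' h => by
      simp only [Prod.mk.injEq] at h ⊢; exact ⟨by rw [h.1], h.2⟩
  have a6 : ent Q (fun t => ((t.1, t.2.1), t.2.2)) = ent Q fun t => t :=
    ent_congr fun ω ω' _ _ => by
      simp only [Prod.ext_iff]; tauto
  have g1 := ent_le_cross hQ (fun t => t.2.2) hr.1 hr.2.le fun t h => (hsupp t h).2.2.1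
  have g2 := ent_le_cross hQ (fun t => (t.1, t.2.1)) hp.1 hp.2.le fun t h => (hsupp t h).1
  have g3 := cross_le_ent hQ (fun t => t) (r := fun t => p (t.1, t.2.1) * V t.1 t.2.2) hC
    fun t _ => by rw [mass_id]; exact hdom t
  have g4 : ∑ t, Q t * Real.logb 2 (p (t.1, t.2.1) * V t.1 t.2.2) ≤
      ∑ t, (Q t * Real.logb 2 (p (t.1, t.2.1)) + (Q t * Real.logb 2 (r t.2.2) + Q t * ρ)) := by
    refine Finset.sum_le_sum fun t _ => ?_
    rcases (hQ.1 t).eq_or_lt with h0 | h0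
    · simp [← h0]
    obtain ⟨h1, h2, -, -, h5⟩ := hsupp t h0
    rw [Real.logb_mul h1.ne' h2.ne', ← mul_add, ← mul_add]
    exact mul_le_mul_of_nonneg_left (by linarith) h0.le
  simp only [Finset.sum_add_distrib, ← Finset.sum_mul, hQ.2, one_mul] at g4
  linarith

section Converse

variable {𝒳 𝒴 𝒯 𝒵 : Type*} [Fintype 𝒳] [Fintype 𝒴] [Fintype 𝒯] [Fintype 𝒵]

/-- The law of `(X ^ n, Y ^ n, Z ^ n)` as a function of the triple. -/
noncomputable def tripleLaw (P : FinDist (𝒳 × 𝒴)) (W : Channel 𝒯 𝒵) {n : ℕ}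
    (π : Protocol 𝒳 𝒴 𝒯 𝒵 n) (t : (Fin n → 𝒳) × (Fin n → 𝒴) × (Fin n → 𝒵)) : ℝ :=
  jointLaw P W π t.1 t.2.1 t.2.2

/-- The law of `(X ^ n, Y ^ n)`. -/
noncomputable def sourceLaw (P : FinDist (𝒳 × 𝒴)) (n : ℕ) (t : (Fin n → 𝒳) × (Fin n → 𝒴)) : ℝ :=
  ∏ i, P.1 (t.1 i, t.2 i)

theorem sourceLaw_mem (P : FinDist (𝒳 × 𝒴)) (n : ℕ) :
    sourceLaw P n ∈ stdSimplex ℝ ((Fin n → 𝒳) × (Fin n → 𝒴)) := by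
  refine ⟨fun t => Finset.prod_nonneg fun i _ => P.2.1 _, ?_⟩
  rw [Fintype.sum_prod_type]
  simp only [sourceLaw, sum_prod_pair_snd]
  exact sum_prod_eq_one (p := fun x => ∑ y, P.1 (x, y))
    (by rw [← Fintype.sum_prod_type]; exact P.2.2) n

theorem tripleLaw_eq (P : FinDist (𝒳 × 𝒴)) (W : Channel 𝒯 𝒵) {n : ℕ} (π : Protocol 𝒳 𝒴 𝒯 𝒵 n)
    (t : (Fin n → 𝒳) × (Fin n → 𝒴) × (Fin n → 𝒵)) :
    tripleLaw P W π t = sourceLaw P n (t.1, t.2.1) * (W n (π.Λ t.1)).1 t.2.2 := rfl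

theorem sum_tripleLaw_mul (P : FinDist (𝒳 × 𝒴)) (W : Channel 𝒯 𝒵) {n : ℕ}
    (π : Protocol 𝒳 𝒴 𝒯 𝒵 n) (F : (Fin n → 𝒳) → (Fin n → 𝒴) → ℝ) :
    ∑ t, tripleLaw P W π t * F t.1 t.2.1 = ∑ t, sourceLaw P n t * F t.1 t.2 := by
  have h : ∀ x, ∑ z, (W n (π.Λ x)).1 z = 1 := fun x => (W n (π.Λ x)).2.2
  simp only [Fintype.sum_prod_type, tripleLaw_eq]
  refine Finset.sum_congr rfl fun x _ => Finset.sum_congr rfl fun y _ => ?_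
  simp only [mul_right_comm _ _ (F x y), ← Finset.mul_sum, h, mul_one]

theorem tripleLaw_mem (P : FinDist (𝒳 × 𝒴)) (W : Channel 𝒯 𝒵) {n : ℕ}
    (π : Protocol 𝒳 𝒴 𝒯 𝒵 n) :
    tripleLaw P W π ∈ stdSimplex ℝ ((Fin n → 𝒳) × (Fin n → 𝒴) × (Fin n → 𝒵)) := by
  refine ⟨fun t => mul_nonneg ((sourceLaw_mem P n).1 (t.1, t.2.1)) ((W n _).2.1 _), ?_⟩
  have := sum_tripleLaw_mul P W π fun _ _ => 1
  simpa [(sourceLaw_mem P n).2] using this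

theorem pairLaw_eq (P : FinDist (𝒳 × 𝒴)) (W : Channel 𝒯 𝒵) {n : ℕ} (π : Protocol 𝒳 𝒴 𝒯 𝒵 n) :
    pairLaw P W π = mass (tripleLaw P W π) fun t => (π.Φ t.1, π.Ψ t.2.1 t.2.2) := by
  funext kl
  simp only [pairLaw, mass, Fintype.sum_prod_type, Prod.ext_iff, tripleLaw]

theorem errorProb_eq (P : FinDist (𝒳 × 𝒴)) (W : Channel 𝒯 𝒵) {n : ℕ} (π : Protocol 𝒳 𝒴 𝒯 𝒵 n) :
    errorProb P W π = ∑ t, tripleLaw P W π t * if π.Φ t.1 = π.Ψ t.2.1 t.2.2 then 0 else 1 := by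
  have := sum_mass_mul (tripleLaw P W π) (fun t => (π.Φ t.1, π.Ψ t.2.1 t.2.2))
    fun kl => if kl.1 = kl.2 then 0 else 1
  rw [← this, errorProb, Fintype.sum_prod_type, ← pairLaw_eq]
  refine Finset.sum_congr rfl fun k _ => Finset.sum_congr rfl fun l _ => ?_
  by_cases h : k = l <;> simp [h]

theorem mass_tripleLaw {α : Type*} (P : FinDist (𝒳 × 𝒴)) (W : Channel 𝒯 𝒵) {n : ℕ}
    (π : Protocol 𝒳 𝒴 𝒯 𝒵 n) (f : (Fin n → 𝒳) → (Fin n → 𝒴) → α) :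
    mass (tripleLaw P W π) (fun t => f t.1 t.2.1) = mass (sourceLaw P n) fun t => f t.1 t.2 := by
  classical
  funext a
  have h := sum_tripleLaw_mul P W π fun x y => if f x y = a then 1 else 0
  simp only [mul_ite, mul_one, mul_zero] at h
  exact h

theorem sum_pairLaw (P : FinDist (𝒳 × 𝒴)) (W : Channel 𝒯 𝒵) {n : ℕ} (π : Protocol 𝒳 𝒴 𝒯 𝒵 n) :
    (fun k => ∑ l, pairLaw P W π (k, l)) = mass (sourceLaw P n) fun t => π.Φ t.1 := by
  rw [← mass_tripleLaw P W π fun x _ => π.Φ x, pairLaw_eq]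
  classical
  funext k
  simp only [mass]
  rw [Finset.sum_comm]
  refine Finset.sum_congr rfl fun t _ => ?_
  by_cases h : π.Φ t.1 = k <;> simp [h]

theorem entropyK_eq (P : FinDist (𝒳 × 𝒴)) (W : Channel 𝒯 𝒵) {n : ℕ} (π : Protocol 𝒳 𝒴 𝒯 𝒵 n) :
    entropyK P W π = ent (sourceLaw P n) fun t => π.Φ t.1 := by
  rw [entropyK, sum_pairLaw, entropy_mass]

theorem nonempty_fin_card {n : ℕ} (π : Protocol 𝒳 𝒴 𝒯 𝒵 n) : Nonempty (Fin π.card) :=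
  ⟨⟨0, by have := π.three_le_card; omega⟩⟩

theorem entropyK_le_logb_card (P : FinDist (𝒳 × 𝒴)) (W : Channel 𝒯 𝒵) {n : ℕ}
    (π : Protocol 𝒳 𝒴 𝒯 𝒵 n) : entropyK P W π ≤ Real.logb 2 π.card := by
  have := nonempty_fin_card π
  rw [entropyK_eq]
  simpa using ent_le_logb_card (sourceLaw_mem P n) fun t => π.Φ t.1

theorem entropyK_nonneg (P : FinDist (𝒳 × 𝒴)) (W : Channel 𝒯 𝒵) {n : ℕ}
    (π : Protocol 𝒳 𝒴 𝒯 𝒵 n) : 0 ≤ entropyK P W π := by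
  rw [entropyK_eq]; exact ent_nonneg (sourceLaw_mem P n) _

/-- The law of the channel input of a protocol. -/
noncomputable def inputLaw (P : FinDist (𝒳 × 𝒴)) {n : ℕ} (π : Protocol 𝒳 𝒴 𝒯 𝒵 n) :
    FinDist (Fin n → 𝒯) :=
  ⟨mass (sourceLaw P n) fun t => π.Λ t.1, mass_mem_stdSimplex (sourceLaw_mem P n) _⟩

theorem spectrumProb_eq (P : FinDist (𝒳 × 𝒴)) (W : Channel 𝒯 𝒵) {n : ℕ}
    (π : Protocol 𝒳 𝒴 𝒯 𝒵 n) (T : InputProcess 𝒯) (hT : T n = inputLaw P π) (R : ℝ) :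
    spectrumProb W T R n = ∑ t, tripleLaw P W π t *
      if infoDensity W T n (π.Λ t.1) t.2.2 / n ≤ R then 1 else 0 := by
  have h := sum_mass_mul (sourceLaw P n) (fun t => π.Λ t.1)
    fun t => ∑ z, (W n t).1 z * if infoDensity W T n t z / n ≤ R then 1 else 0
  have e1 : spectrumProb W T R n = ∑ t, (T n).1 t *
      ∑ z, (W n t).1 z * if infoDensity W T n t z / n ≤ R then 1 else 0 := by
    unfold spectrumProb
    refine Finset.sum_congr rfl fun t _ => ?_
    rw [Finset.mul_sum]
    refine Finset.sum_congr rfl fun z _ => ?_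
    rw [ioLaw]; split_ifs <;> ring
  rw [e1]
  have e2 : ∀ t, (T n).1 t = mass (sourceLaw P n) (fun t => π.Λ t.1) t := fun t => by rw [hT]; rfl
  simp only [e2]
  rw [h]
  simp only [Fintype.sum_prod_type, tripleLaw_eq, Finset.mul_sum, mul_assoc]

set_option maxHeartbeats 400000 in
/-- Conditioning the law of a protocol on the event that `K = L` and that the information density
is at most `n R` costs a factor `1 / η` in the densities, after which decoding is free of error. -/
theorem exists_mem_auxRegion_of_protocol (P : FinDist (𝒳 × 𝒴)) (W : Channel 𝒯 𝒵) {n : ℕ}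
    (hn : 0 < n) (π : Protocol 𝒳 𝒴 𝒯 𝒵 n) (T : InputProcess 𝒯) (hT : T n = inputLaw P π)
    {R η : ℝ} (hη : 0 < η) (hE : errorProb P W π + η ≤ spectrumProb W T R n) :
    ∃ s ∈ auxRegion 𝒳 𝒴, (∀ t, P.1 t = 0 → s.1 t = 0) ∧
      crossEntropy P.1 s.1 - entropy s.1 ≤ Real.logb 2 η⁻¹ / n ∧
      crossEntropy P.1 s.1 - crossEntropyFst P.1 s.1 - (s.2.2.2 - s.2.1) ≤
        Real.logb 2 η⁻¹ / n ∧
      (Real.logb 2 π.card - η⁻¹ * (Real.logb 2 π.card - entropyK P W π + 2)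
        - Real.logb 2 η⁻¹) / n ≤ crossEntropyFst P.1 s.1 - s.2.1 ∧
      crossEntropyFst P.1 s.1 - crossEntropySnd P.1 s.1 - (s.2.1 - s.2.2.1) ≤
        R + 2 * Real.logb 2 η⁻¹ / n := by
  classical
  have hn' : (0 : ℝ) < n := by exact_mod_cast hn
  have hne := nonempty_fin_card π
  set J := tripleLaw P W π with hJ
  have hJm : J ∈ stdSimplex ℝ _ := tripleLaw_mem P W π
  set good : (Fin n → 𝒳) × (Fin n → 𝒴) × (Fin n → 𝒵) → Prop := fun t =>
    π.Φ t.1 = π.Ψ t.2.1 t.2.2 ∧ infoDensity W T n (π.Λ t.1) t.2.2 / n ≤ R with hgood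
  set e : ℝ := ∑ t, if good t then J t else 0 with he
  have heη : η ≤ e := by
    rw [errorProb_eq, spectrumProb_eq P W π T hT, ← hJ] at hE
    have : (∑ t, J t * if infoDensity W T n (π.Λ t.1) t.2.2 / n ≤ R then 1 else 0) ≤
        (∑ t, J t * if π.Φ t.1 = π.Ψ t.2.1 t.2.2 then 0 else 1) + e := by
      rw [he, ← Finset.sum_add_distrib]
      refine Finset.sum_le_sum fun t _ => ?_
      have := hJm.1 t
      simp only [hgood]
      by_cases h1 : π.Φ t.1 = π.Ψ t.2.1 t.2.2 <;>
        by_cases h2 : infoDensity W T n (π.Λ t.1) t.2.2 / n ≤ R <;> simp [h1, h2, this]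
    linarith
  have he0 : 0 < e := hη.trans_le heη
  set Q : (Fin n → 𝒳) × (Fin n → 𝒴) × (Fin n → 𝒵) → ℝ := fun t =>
    (if good t then J t else 0) / e with hQdef
  have hQ : Q ∈ stdSimplex ℝ _ := by
    refine ⟨fun t => div_nonneg ?_ he0.le, ?_⟩
    · split_ifs
      · exact hJm.1 t
      · exact le_rfl
    · simp only [hQdef]
      rw [← Finset.sum_div, ← he, div_self he0.ne']
  set C : ℝ := η⁻¹ with hC
  have hC0 : 0 < C := inv_pos.2 hη
  have hQJ : ∀ t, Q t ≤ C * J t := fun t => by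
    simp only [hQdef, hC]
    rw [div_eq_inv_mul]
    refine mul_le_mul (inv_anti₀ hη heη) ?_ ?_ (inv_nonneg.2 hη.le)
    · split_ifs
      · exact le_rfl
      · exact hJm.1 t
    · split_ifs
      · exact hJm.1 t
      · exact le_rfl
  have hC1 : 1 ≤ C := by
    have := Finset.sum_le_sum fun t (_ : t ∈ Finset.univ) => hQJ t
    rwa [hQ.2, ← Finset.mul_sum, hJm.2, mul_one] at this
  have hQgood : ∀ t, 0 < Q t → good t ∧ 0 < J t := fun t h => by
    by_contra hcon
    have : Q t ≤ 0 := by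
      by_cases hg : good t
      · have h1 : J t ≤ 0 := by
          by_contra h2; exact hcon ⟨hg, not_le.1 h2⟩
        simp only [hQdef, hg, if_true]
        exact div_nonpos_of_nonpos_of_nonneg h1 he0.le
      · simp [hQdef, hg]
    linarith
  obtain ⟨s, hs, h0, h1, h2, h3, h4⟩ := exists_mem_auxRegion hQ hn (fun t => t.1)
    (fun t => t.2.1) (fun t => π.Φ t.1) (fun ω ω' h => congrArg π.Φ h) P hC0 (fun x y => by
      have := mass_le_mul hQJ (fun t => (t.1, t.2.1)) (x, y)
      rwa [hJ, mass_tripleLaw P W π fun x y => (x, y), mass_id] at this)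
  refine ⟨s, hs, h0, h1, h2, le_trans ?_ h3, h4.trans ?_⟩
  · refine div_le_div_of_nonneg_right ?_ hn'.le
    have hJK : mass J (fun t => π.Φ t.1) = fun k => ∑ l, pairLaw P W π (k, l) := by
      rw [sum_pairLaw]; exact mass_tripleLaw P W π fun x _ => π.Φ x
    have := le_entropy_of_le_mul (mass_mem_stdSimplex hJm fun t => π.Φ t.1)
      (mass_mem_stdSimplex hQ fun t => π.Φ t.1) hC1 fun k => mass_le_mul hQJ _ k
    rw [hJK, entropy_mass, Fintype.card_fin] at this
    exact this
  · have hZ : (fun z => ∑ t', ioLaw W T n t' z) ∈ stdSimplex ℝ (Fin n → 𝒵) :=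
      ⟨fun z => Finset.sum_nonneg fun _ _ => ioLaw_nonneg _ _ _ _ _, by
        rw [Finset.sum_comm, sum_ioLaw]⟩
    have key := ent_pair_sub_le hQ (sourceLaw_mem P n) (fun x z => (W n (π.Λ x)).1 z) hZ
      (ρ := n * R) hC0 hQJ π.Φ π.Ψ (by
        intro t ht
        obtain ⟨⟨hg1, hg2⟩, hJt⟩ := hQgood t ht
        rw [hJ, tripleLaw_eq] at hJt
        have hp : 0 < sourceLaw P n (t.1, t.2.1) :=
          lt_of_le_of_ne ((sourceLaw_mem P n).1 _) fun h => by simp [← h] at hJt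
        have hW : 0 < (W n (π.Λ t.1)).1 t.2.2 :=
          lt_of_le_of_ne ((W n _).2.1 _) fun h => by simp [← h] at hJt
        have hTt : 0 < (T n).1 (π.Λ t.1) := by
          rw [hT]
          exact hp.trans_le (le_mass (sourceLaw_mem P n).1 (fun t => π.Λ t.1) (t.1, t.2.1))
        have hio : 0 < ioLaw W T n (π.Λ t.1) t.2.2 := mul_pos hTt hW
        refine ⟨hp, hW, hio.trans_le (ioLaw_le_sum W T n _ _), hg1, ?_⟩
        rw [infoDensity_eq hio, div_le_iff₀ hn'] at hg2
        linarith)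
    rw [div_le_iff₀ hn', add_mul, div_mul_cancel₀ _ hn'.ne']
    linarith

theorem exists_diagonal {p : ℕ → ℕ → Prop} (h : ∀ k, ∀ᶠ n in Filter.atTop, p k n) :
    ∃ k : ℕ → ℕ, Filter.Tendsto k Filter.atTop Filter.atTop ∧ ∀ᶠ n in Filter.atTop, p (k n) n := by
  classical
  choose N hN using fun k => Filter.eventually_atTop.1 (h k)
  refine ⟨fun n => Nat.findGreatest (fun k => N k ≤ n) n, ?_, ?_⟩
  · rw [Filter.tendsto_atTop]
    intro m
    filter_upwards [Filter.eventually_ge_atTop m, Filter.eventually_ge_atTop (N m)] with n h1 h2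
    exact Nat.le_findGreatest h1 h2
  · filter_upwards [Filter.eventually_ge_atTop (N 0)] with n h0
    exact hN _ _ (Nat.findGreatest_spec (P := fun k => N k ≤ n) (Nat.zero_le n) h0)

theorem fst_mem_of_mem_auxRegion {s : (𝒳 × 𝒴 → ℝ) × ℝ × ℝ × ℝ} (hs : s ∈ auxRegion 𝒳 𝒴) :
    s.1 ∈ stdSimplex ℝ (𝒳 × 𝒴) := by
  obtain ⟨k, q, rfl⟩ := exists_jointPoint_eq hs
  refine ⟨margXY_nonneg q.2.1, ?_⟩
  change ∑ t : 𝒳 × 𝒴, ∑ u, q.1 (u, t) = 1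
  rw [Finset.sum_comm, ← q.2.2, Fintype.sum_prod_type]

/-- The largest violation by a point of the region of the constraints that characterize rates of
at least `H` in the auxiliary problem with bound `u`. -/
noncomputable def violation (P : 𝒳 × 𝒴 → ℝ) (H u : ℝ) (s : (𝒳 × 𝒴 → ℝ) × ℝ × ℝ × ℝ) : ℝ :=
  max (max (crossEntropy P s.1 - entropy s.1)
      (crossEntropy P s.1 - crossEntropyFst P s.1 - (s.2.2.2 - s.2.1)))
    (max (H - (crossEntropyFst P s.1 - s.2.1))
      (crossEntropyFst P s.1 - crossEntropySnd P s.1 - (s.2.1 - s.2.2.1) - u))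

theorem continuous_violation (P : 𝒳 × 𝒴 → ℝ) (H u : ℝ) : Continuous (violation P H u) := by
  have h1 : Continuous fun s : (𝒳 × 𝒴 → ℝ) × ℝ × ℝ × ℝ => crossEntropy P s.1 := by
    unfold crossEntropy; fun_prop
  have h2 : Continuous fun s : (𝒳 × 𝒴 → ℝ) × ℝ × ℝ × ℝ => crossEntropyFst P s.1 := by
    unfold crossEntropyFst; fun_prop
  have h3 : Continuous fun s : (𝒳 × 𝒴 → ℝ) × ℝ × ℝ × ℝ => crossEntropySnd P s.1 := by
    unfold crossEntropySnd; fun_prop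
  have h4 : Continuous fun s : (𝒳 × 𝒴 → ℝ) × ℝ × ℝ × ℝ => entropy s.1 :=
    continuous_entropy.comp continuous_fst
  unfold violation
  fun_prop

/-- By compactness, arbitrarily small violations of the constraints give an exact solution. -/
theorem exists_auxRates_ge (P : FinDist (𝒳 × 𝒴)) {H u : ℝ}
    (h : ∀ τ : ℝ, 0 < τ → ∃ s ∈ auxRegion 𝒳 𝒴, (∀ t, P.1 t = 0 → s.1 t = 0) ∧
      violation P.1 H u s ≤ τ) : ∃ v ∈ auxRates P u, H ≤ v := by
  set S : Set ((𝒳 × 𝒴 → ℝ) × ℝ × ℝ × ℝ) :=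
    auxRegion 𝒳 𝒴 ∩ {s | ∀ t, P.1 t = 0 → s.1 t = 0} with hS
  have hSc : IsCompact S := by
    refine isCompact_auxRegion.inter_right ?_
    simp only [Set.ofPred_forall]
    exact isClosed_iInter fun t => isClosed_iInter fun _ => isClosed_eq (by fun_prop) (by fun_prop)
  obtain ⟨s1, hs1, hs1', -⟩ := h 1 one_pos
  obtain ⟨s, ⟨hs, hs0⟩, hmin⟩ := hSc.exists_isMinOn ⟨s1, hs1, hs1'⟩
    (continuous_violation P.1 H u).continuousOn
  have hv : violation P.1 H u s ≤ 0 := by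
    refine le_of_forall_pos_le_add fun τ hτ => ?_
    obtain ⟨s', h1, h2, h3⟩ := h τ hτ
    rw [zero_add]
    exact (hmin ⟨h1, h2⟩).trans h3
  simp only [violation, max_le_iff] at hv
  obtain ⟨⟨v1, v2⟩, v3, v4⟩ := hv
  have hq := fst_mem_of_mem_auxRegion hs
  have hsP : s.1 = P.1 := by
    refine eq_of_gibbs hq.1 P.2.1 (fun t ht => ?_) (by rw [hq.2]; exact P.2.2.le) ?_
    · exact lt_of_le_of_ne (P.2.1 t) fun h0 => ht.ne' (hs0 t h0.symm)
    · simp only [mul_sub, Finset.sum_sub_distrib]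
      simp only [crossEntropy, entropy] at v1
      linarith
  have c1 : crossEntropy P.1 P.1 = entropy P.1 := rfl
  have c2 : crossEntropyFst P.1 P.1 = entropyFst P.1 := by
    simp only [crossEntropyFst, entropyFst, entropy, Fintype.sum_prod_type, Finset.sum_mul]
  have c3 : crossEntropySnd P.1 P.1 = entropySnd P.1 := by
    simp only [crossEntropySnd, entropySnd, entropy, Fintype.sum_prod_type_right, Finset.sum_mul]
  rw [hsP, c1, c2] at v2
  rw [hsP, c2] at v3
  rw [hsP, c2, c3] at v4
  refine ⟨entropyFst P.1 - s.2.1, ?_, by linarith⟩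
  rw [mem_auxRates_iff]
  exact ⟨s, hs, hsP, by linarith, by linarith, rfl⟩

/-- The converse: an achievable rate is at most some rate of the auxiliary problem with bound
`u(ε)`. -/
theorem exists_auxRates_ge_of_isAchievableRate [Nonempty 𝒯] (P : FinDist (𝒳 × 𝒴))
    (W : Channel 𝒯 𝒵) {ε H : ℝ} (h0 : 0 < ε) (h1 : ε < 1) (hH : IsAchievableRate P W ε H) :
    ∃ v ∈ auxRates P (upperRate W ε), H ≤ v := by
  classical
  obtain ⟨c, -, hc⟩ := hH
  refine exists_auxRates_ge P fun τ hτ => ?_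
  obtain ⟨k, hk, hp⟩ := exists_diagonal (p := fun k n => ∃ π : Protocol 𝒳 𝒴 𝒯 𝒵 n,
      errorProb P W π ≤ ε ∧
      |entropyK P W π / (n : ℝ) - Real.logb 2 (π.card : ℝ) / (n : ℝ)| ≤ 1 / ((k : ℝ) + 1) ∧
      entropyK P W π / (n : ℝ) > H - 1 / ((k : ℝ) + 1)) fun k => by
    filter_upwards [hc (1 / ((k : ℝ) + 1)) (by positivity) (1 / ((k : ℝ) + 1)) (by positivity)]
      with n hn
    obtain ⟨π, a1, -, a3, a4⟩ := hn
    exact ⟨π, a1, a3, a4⟩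
  -- the input process made of the channel inputs of the protocols
  obtain ⟨T0⟩ := nonempty_inputProcess (𝒯 := 𝒯)
  have hT : ∃ T : InputProcess 𝒯, ∀ᶠ n in Filter.atTop, ∃ π : Protocol 𝒳 𝒴 𝒯 𝒵 n,
      T n = inputLaw P π ∧ errorProb P W π ≤ ε ∧
      |entropyK P W π / (n : ℝ) - Real.logb 2 (π.card : ℝ) / (n : ℝ)| ≤ 1 / ((k n : ℝ) + 1) ∧
      entropyK P W π / (n : ℝ) > H - 1 / ((k n : ℝ) + 1) := by
    refine ⟨fun n => if hn : ∃ π : Protocol 𝒳 𝒴 𝒯 𝒵 n, errorProb P W π ≤ ε ∧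
      |entropyK P W π / (n : ℝ) - Real.logb 2 (π.card : ℝ) / (n : ℝ)| ≤ 1 / ((k n : ℝ) + 1) ∧
      entropyK P W π / (n : ℝ) > H - 1 / ((k n : ℝ) + 1) then inputLaw P hn.choose else T0 n, ?_⟩
    filter_upwards [hp] with n hn
    exact ⟨hn.choose, by rw [dif_pos hn], hn.choose_spec⟩
  obtain ⟨T, hT⟩ := hT
  set R : ℝ := upperRate W ε + τ / 2 with hR
  have hF : ε < spectrumLimsup W T R := by
    by_contra hcon
    have := le_upperRate h0 h1 (not_lt.1 hcon)
    linarith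
  set η : ℝ := (spectrumLimsup W T R - ε) / 2 with hη
  have hη0 : 0 < η := by linarith
  have hfreq : ∃ᶠ n in Filter.atTop, ε + η < spectrumProb W T R n :=
    Filter.frequently_lt_of_lt_limsup (isCoboundedUnder_spectrumProb W T R)
      (by change _ < spectrumLimsup W T R; linarith)
  set L : ℝ := Real.logb 2 η⁻¹ with hL
  have hinv : Filter.Tendsto (fun n : ℕ => (n : ℝ)⁻¹) Filter.atTop (nhds 0) :=
    tendsto_inv_atTop_nhds_zero_nat
  have hbk : Filter.Tendsto (fun n : ℕ => 1 / ((k n : ℝ) + 1)) Filter.atTop (nhds 0) :=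
    tendsto_one_div_add_atTop_nhds_zero_nat.comp hk
  have t1 : ∀ᶠ n : ℕ in Filter.atTop, L * (n : ℝ)⁻¹ < τ / 4 := by
    have := hinv.const_mul L
    rw [mul_zero] at this
    exact this.eventually_lt_const (by linarith)
  have t2 : ∀ᶠ n : ℕ in Filter.atTop, (1 + η⁻¹) * (1 / ((k n : ℝ) + 1)) +
      (2 * η⁻¹ + L) * (n : ℝ)⁻¹ < τ := by
    have := (hbk.const_mul (1 + η⁻¹)).add (hinv.const_mul (2 * η⁻¹ + L))
    rw [mul_zero, mul_zero, add_zero] at this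
    exact this.eventually_lt_const hτ
  obtain ⟨n, hn, ⟨π, p1, p2, p3, p4⟩, t1, t2, hn0⟩ := (hfreq.and_eventually
    (hT.and (t1.and (t2.and (Filter.eventually_gt_atTop 0))))).exists
  have hn' : (0 : ℝ) < n := by exact_mod_cast hn0
  obtain ⟨s, hs, q0, q1, q2, q3, q4⟩ := exists_mem_auxRegion_of_protocol P W hn0 π T p1 hη0
    (R := R) (by linarith)
  refine ⟨s, hs, q0, ?_⟩
  rw [← hL] at q1 q2 q3 q4
  rw [div_eq_mul_inv] at q1 q2 q4
  have q5 := entropyK_le_logb_card P W π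
  have q6 : entropyK P W π / n ≤ Real.logb 2 π.card / n := div_le_div_of_nonneg_right q5 hn'.le
  have q7 := (abs_le.1 p3).1
  set β := 1 / ((k n : ℝ) + 1)
  have hd : Real.logb 2 π.card / n - entropyK P W π / n ≤ β := by linarith
  have q8 : H - τ ≤ (Real.logb 2 π.card - η⁻¹ * (Real.logb 2 π.card - entropyK P W π + 2) - L) / n := by
    have e : (Real.logb 2 π.card - η⁻¹ * (Real.logb 2 π.card - entropyK P W π + 2) - L) / n =
        Real.logb 2 π.card / n - η⁻¹ * (Real.logb 2 π.card / n - entropyK P W π / n)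
          - (2 * η⁻¹ + L) * (n : ℝ)⁻¹ := by field_simp; ring
    have := mul_le_mul_of_nonneg_left hd (inv_pos.2 hη0).le
    rw [e]
    linarith
  simp only [violation, max_le_iff]
  refine ⟨⟨by linarith, by linarith⟩, by linarith, by linarith⟩

end Converse

/-! ### Channel coding: Feinstein's lemma -/

/-- **Feinstein's lemma**. If the information density is at most `log θ` with probability at most
`F`, there is a code with `N ≤ θ (e - F)` messages and maximal error probability at most `e`.
Codewords are added greedily; values of `dec` that are at least `N` mean that no message is
decoded. -/
theorem exists_channel_code {𝒜 𝒞 : Type*} [Fintype 𝒜] [Fintype 𝒞] [Nonempty 𝒜] {p : 𝒜 → ℝ}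
    (hp : p ∈ stdSimplex ℝ 𝒜) {V : 𝒜 → 𝒞 → ℝ} (hV : ∀ a, V a ∈ stdSimplex ℝ 𝒞) {θ e F : ℝ}
    (hθ : 0 < θ)
    (hF : ∑ a, ∑ z, (if V a z ≤ θ * ∑ a', p a' * V a' z then p a * V a z else 0) ≤ F)
    (N : ℕ) (hN : N ≤ θ * (e - F)) :
    ∃ (c : ℕ → 𝒜) (dec : 𝒞 → ℕ), ∀ j < N, ∑ z, (if dec z = j then 0 else V (c j) z) ≤ e := by
  classical
  set r : 𝒞 → ℝ := fun z => ∑ a, p a * V a z with hr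
  have hr0 : ∀ z, 0 ≤ r z := fun z =>
    Finset.sum_nonneg fun a _ => mul_nonneg (hp.1 a) ((hV a).1 z)
  suffices H : ∀ m : ℕ, m ≤ N → ∃ (c : ℕ → 𝒜) (dec : 𝒞 → ℕ), ∀ j < m,
      1 - e ≤ ∑ z, (if dec z = j then V (c j) z else 0) ∧
      ∀ z, dec z = j → θ * r z ≤ V (c j) z by
    obtain ⟨c, dec, h⟩ := H N le_rfl
    refine ⟨c, dec, fun j hj => ?_⟩
    have h1 := (h j hj).1
    have h2 : ∑ z, (if dec z = j then V (c j) z else 0) +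
        ∑ z, (if dec z = j then 0 else V (c j) z) = 1 := by
      rw [← Finset.sum_add_distrib, ← (hV (c j)).2]
      refine Finset.sum_congr rfl fun z _ => ?_
      split_ifs <;> simp
    linarith
  intro m
  induction m with
  | zero => exact fun _ => ⟨fun _ => Classical.arbitrary 𝒜, fun _ => 0, fun j hj => by omega⟩
  | succ m ih =>
    intro hm
    obtain ⟨c, dec, h⟩ := ih (by omega)
    -- the decoding sets chosen so far have small output probability
    have hD : ∑ z, (if dec z < m then r z else 0) ≤ m / θ := by
      have h1 : ∀ z, (if dec z < m then r z else 0) =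
          ∑ j ∈ Finset.range m, if dec z = j then r z else 0 := fun z => by
        rw [Finset.sum_ite_eq]; simp
      simp only [h1]
      rw [Finset.sum_comm]
      calc _ ≤ ∑ j ∈ Finset.range m, 1 / θ := by
            refine Finset.sum_le_sum fun j hj => ?_
            rw [le_div_iff₀ hθ, ← (hV (c j)).2, Finset.sum_mul]
            refine Finset.sum_le_sum fun z _ => ?_
            split_ifs with h2
            · rw [mul_comm]; exact (h j (Finset.mem_range.1 hj)).2 z h2
            · rw [zero_mul]; exact (hV (c j)).1 z
        _ = m / θ := by simp [div_eq_mul_inv]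
    have hnew : ∃ a, 1 - e ≤ ∑ z, (if ¬ dec z < m ∧ θ * r z < V a z then V a z else 0) := by
      by_contra hcon
      simp only [not_exists, not_le] at hcon
      have h1 : ∀ a, ∑ z, p a * V a z ≤
          ∑ z, (if V a z ≤ θ * r z then p a * V a z else 0) +
            ∑ z, (if dec z < m then p a * V a z else 0) + p a * (1 - e) := fun a => by
        have h2 := mul_le_mul_of_nonneg_left (hcon a).le (hp.1 a)
        rw [Finset.mul_sum] at h2
        refine le_trans ?_ (add_le_add_right h2 _)
        rw [← Finset.sum_add_distrib, ← Finset.sum_add_distrib]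
        refine Finset.sum_le_sum fun z _ => ?_
        have h3 : 0 ≤ p a * V a z := mul_nonneg (hp.1 a) ((hV a).1 z)
        by_cases h4 : V a z ≤ θ * r z
        · rw [if_pos h4]; split_ifs <;> simp [h3]
        · by_cases h5 : dec z < m
          · simp [h4, h5]
          · simp [h4, h5, not_le.1 h4]
      have h2 := Finset.sum_le_sum fun a (_ : a ∈ Finset.univ) => h1 a
      have h3 : ∑ a, ∑ z, p a * V a z = 1 := by
        rw [← hp.2]
        refine Finset.sum_congr rfl fun a _ => ?_
        rw [← Finset.mul_sum, (hV a).2, mul_one]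
      have h4 : ∑ a, ∑ z, (if dec z < m then p a * V a z else 0) =
          ∑ z, (if dec z < m then r z else 0) := by
        rw [Finset.sum_comm]
        refine Finset.sum_congr rfl fun z _ => ?_
        split_ifs <;> simp [hr]
      rw [Finset.sum_add_distrib, Finset.sum_add_distrib, h3, h4, ← Finset.sum_mul, hp.2,
        one_mul] at h2
      have h5 : e - F ≤ m / θ := by linarith
      rw [le_div_iff₀ hθ] at h5
      have h6 : ((m + 1 : ℕ) : ℝ) ≤ N := by exact_mod_cast hm
      push_cast at h6
      linarith
    obtain ⟨a, ha⟩ := hnew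
    refine ⟨fun j => if j < m then c j else a, fun z => if dec z < m then dec z else
      if θ * r z < V a z then m else m + 1, fun j hj => ?_⟩
    rcases Nat.lt_succ_iff_lt_or_eq.1 hj with hj | rfl
    · have e1 : ∀ z, ((if dec z < m then dec z else if θ * r z < V a z then m else m + 1) = j) ↔
          dec z = j := fun z => by
        split_ifs <;> omega
      simp only [e1, if_pos hj]
      exact h j hj
    · have e1 : ∀ z, ((if dec z < j then dec z else if θ * r z < V a z then j else j + 1) = j) ↔
          ¬ dec z < j ∧ θ * r z < V a z := fun z => by
        split_ifs with h1 h2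
        · simp [h1]; omega
        · simp [h1, h2]
        · simp [h2]
      simp only [e1, lt_irrefl, if_false]
      exact ⟨ha, fun z hz => hz.2.le⟩

/-! ### Averages over i.i.d. sequences -/

section Product

variable {α ι : Type*} [Fintype α] [Fintype ι] [DecidableEq ι]

theorem sum_prod_mul_prod (p : α → ℝ) (g : ι → α → ℝ) :
    ∑ x : ι → α, (∏ i, p (x i)) * ∏ i, g i (x i) = ∏ i, ∑ a, p a * g i a := by
  classical
  have := Finset.prod_univ_sum (fun _ : ι => (Finset.univ : Finset α)) fun i a => p a * g i a
  rw [Fintype.piFinset_univ] at this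
  rw [this]
  exact Finset.sum_congr rfl fun x _ => Finset.prod_mul_distrib.symm

theorem sum_prod_mul_coord {p : α → ℝ} (hp : ∑ a, p a = 1) (i : ι) (f : α → ℝ) :
    ∑ x : ι → α, (∏ j, p (x j)) * f (x i) = ∑ a, p a * f a := by
  have h := sum_prod_mul_prod p fun (j : ι) a => if j = i then f a else 1
  have e1 : ∀ x : ι → α, (∏ j, if j = i then f (x j) else 1) = f (x i) := fun x => by
    rw [Finset.prod_eq_single i] <;> simp +contextual
  simp only [e1] at h
  rw [h, Finset.prod_eq_single i]
  · simp
  · intro j _ hj; simp [hj, hp]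
  · simp

theorem sum_prod_mul_coord_mul_coord {p : α → ℝ} (hp : ∑ a, p a = 1) {i j : ι} (hij : i ≠ j)
    (f g : α → ℝ) : ∑ x : ι → α, (∏ k, p (x k)) * (f (x i) * g (x j)) =
      (∑ a, p a * f a) * ∑ a, p a * g a := by
  have h := sum_prod_mul_prod p fun (k : ι) a => if k = i then f a else if k = j then g a else 1
  have e1 : ∀ x : ι → α, (∏ k, if k = i then f (x k) else if k = j then g (x k) else 1) =
      f (x i) * g (x j) := fun x => by
    rw [Finset.prod_eq_mul i j hij] <;> simp +contextual [hij.symm]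
  simp only [e1] at h
  rw [h, Finset.prod_eq_mul i j hij]
  · simp [hij.symm]
  · rintro k _ ⟨h1, h2⟩; simp [h1, h2, hp]
  · simp
  · simp

theorem sum_prod_mul_sq_sum {p : α → ℝ} (hp : ∑ a, p a = 1) {f : α → ℝ}
    (hf : ∑ a, p a * f a = 0) : ∑ x : ι → α, (∏ j, p (x j)) * (∑ i, f (x i)) ^ 2 =
      Fintype.card ι * ∑ a, p a * f a ^ 2 := by
  have e1 : ∀ x : ι → α, (∏ j, p (x j)) * (∑ i, f (x i)) ^ 2 =
      ∑ i, ∑ j, (∏ k, p (x k)) * (f (x i) * f (x j)) := fun x => by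
    rw [sq, Finset.sum_mul_sum, Finset.mul_sum]
    exact Finset.sum_congr rfl fun i _ => Finset.mul_sum _ _ _
  simp only [e1]
  rw [Finset.sum_comm]
  have e2 : ∀ i : ι, ∑ x : ι → α, ∑ j, (∏ k, p (x k)) * (f (x i) * f (x j)) =
      ∑ a, p a * f a ^ 2 := fun i => by
    rw [Finset.sum_comm, Finset.sum_eq_single i]
    · rw [sum_prod_mul_coord hp i fun a => f a * f a]
      simp only [sq]
    · intro j _ hj
      rw [sum_prod_mul_coord_mul_coord hp hj.symm, hf, zero_mul]
    · simp
  simp [e2]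

end Product

open Classical in
/-- The weak law of large numbers: sequences whose sum of `f` deviates from its mean by more than
`n δ` have vanishing probability, by Chebyshev's inequality. -/
theorem eventually_sum_atypical_le {α : Type*} [Fintype α] {p : α → ℝ} (hp : p ∈ stdSimplex ℝ α)
    (f : α → ℝ) {δ s : ℝ} (hδ : 0 < δ) (hs : 0 < s) : ∀ᶠ n : ℕ in Filter.atTop,
      ∑ x : Fin n → α, (if |∑ i, f (x i) - n * ∑ a, p a * f a| ≤ n * δ then 0
        else ∏ i, p (x i)) ≤ s := by
  set μ := ∑ a, p a * f a with hμ
  set σ := ∑ a, p a * (f a - μ) ^ 2 with hσ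
  have hf0 : ∑ a, p a * (f a - μ) = 0 := by
    simp only [mul_sub, Finset.sum_sub_distrib, ← Finset.sum_mul, hp.2]; simp [hμ]
  have hlim : Filter.Tendsto (fun n : ℕ => σ / δ ^ 2 * (n : ℝ)⁻¹) Filter.atTop (nhds 0) := by
    simpa using tendsto_inv_atTop_nhds_zero_nat.const_mul (σ / δ ^ 2)
  filter_upwards [hlim.eventually_le_const hs, Filter.eventually_gt_atTop 0] with n hn hn0
  have hn' : (0 : ℝ) < n := by exact_mod_cast hn0
  refine le_trans ?_ hn
  have key : ∀ x : Fin n → α, (if |∑ i, f (x i) - n * μ| ≤ n * δ then 0 else ∏ i, p (x i)) ≤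
      (∏ i, p (x i)) * (∑ i, (f (x i) - μ)) ^ 2 * ((n : ℝ) * δ)⁻¹ ^ 2 := fun x => by
    have h0 : 0 ≤ ∏ i, p (x i) := Finset.prod_nonneg fun i _ => hp.1 _
    split_ifs with h
    · positivity
    · rw [not_le] at h
      have e : ∑ i, (f (x i) - μ) = ∑ i, f (x i) - n * μ := by
        rw [Finset.sum_sub_distrib]; simp
      rw [e, mul_assoc]
      refine le_mul_of_one_le_right h0 ?_
      rw [← mul_pow, ← sq_abs, one_le_sq_iff_one_le_abs, abs_abs, abs_mul, abs_inv,
        abs_of_pos (by positivity : 0 < (n : ℝ) * δ), ← div_eq_mul_inv, one_le_div (by positivity)]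
      exact h.le
  refine (Finset.sum_le_sum fun x _ => key x).trans ?_
  rw [← Finset.sum_mul, sum_prod_mul_sq_sum (f := fun a => f a - μ) hp.2 hf0, Fintype.card_fin,
    ← hσ]
  apply le_of_eq
  field_simp

/-! ### Covering and random binning -/

theorem exists_le_of_sum_mul_le {ι : Type*} [Fintype ι] {q : ι → ℝ} (hq : q ∈ stdSimplex ℝ ι)
    {f : ι → ℝ} {a : ℝ} (h : ∑ i, q i * f i ≤ a) : ∃ i, f i ≤ a := by
  by_contra hcon
  push Not at hcon
  have h1 : ∑ i, q i * (f i - a) ≤ 0 := by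
    simp only [mul_sub, Finset.sum_sub_distrib, ← Finset.sum_mul, hq.2]; linarith
  have h2 : ∀ i ∈ Finset.univ, 0 ≤ q i * (f i - a) := fun i _ =>
    mul_nonneg (hq.1 i) (by linarith [hcon i])
  have h3 := (Finset.sum_eq_zero_iff_of_nonneg h2).1 (le_antisymm h1 (Finset.sum_nonneg h2))
  have h4 : ∀ i, q i = 0 := fun i => by
    rcases mul_eq_zero.1 (h3 i (Finset.mem_univ i)) with h | h
    · exact h
    · linarith [hcon i]
  have := hq.2
  simp [h4] at this

theorem prod_mem_stdSimplex {α ι : Type*} [Fintype α] [Fintype ι] [DecidableEq ι] {p : α → ℝ}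
    (hp : p ∈ stdSimplex ℝ α) : (fun x : ι → α => ∏ i, p (x i)) ∈ stdSimplex ℝ (ι → α) := by
  refine ⟨fun x => Finset.prod_nonneg fun i _ => hp.1 _, ?_⟩
  have := sum_prod_mul_prod p fun (_ : ι) _ => 1
  simpa [hp.2] using this

theorem one_sub_pow_le {a b α : ℝ} (ha : a ≤ 1) (hb0 : 0 ≤ b) (hb1 : b ≤ 1) (hα : 0 < α)
    (hab : b ≤ α * a) (M : ℕ) : (1 - a) ^ M ≤ 1 - b + Real.exp (-(M / α)) := by
  have h1 : (1 - a) ^ M ≤ Real.exp (-a) ^ M :=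
    pow_le_pow_left₀ (by linarith) (Real.one_sub_le_exp_neg a) M
  have h2 : Real.exp (-a) ^ M ≤ Real.exp (b * -(M / α)) := by
    rw [← Real.exp_nat_mul]
    refine Real.exp_le_exp.2 ?_
    have h3 : b / α ≤ a := by rw [div_le_iff₀ hα]; linarith
    have h4 := mul_le_mul_of_nonneg_left h3 (Nat.cast_nonneg (α := ℝ) M)
    have h5 : b * -(M / α) = -(M * (b / α)) := by ring
    rw [h5]; linarith
  have h3 := convexOn_exp.2 (Set.mem_univ 0) (Set.mem_univ (-(M / α : ℝ)))
    (by linarith : 0 ≤ 1 - b) hb0 (by ring)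
  simp only [smul_eq_mul, mul_zero, zero_add, Real.exp_zero, mul_one] at h3
  have h4 : b * Real.exp (-(M / α)) ≤ Real.exp (-(M / α)) :=
    mul_le_of_le_one_left (Real.exp_pos _).le hb1
  linarith

open Classical in
/-- One-shot covering with binning. A random codebook `c` covers `x` by a codeword `c m` with
`A (c m) x`; the bin of `m` and the side information `y`, by way of the test `T`, determine `m`.
Averaging over bins chosen independently of everything else decouples the codewords competing with
the chosen one from the choice. -/
theorem exists_covering_code {𝒰 𝒳 𝒴 : Type*} [Fintype 𝒰] [Fintype 𝒳] [Fintype 𝒴] {pU : 𝒰 → ℝ}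
    (hpU : pU ∈ stdSimplex ℝ 𝒰) {p : 𝒳 × 𝒴 → ℝ} (hp : p ∈ stdSimplex ℝ (𝒳 × 𝒴))
    (A : 𝒰 → 𝒳 → Prop) (T : 𝒰 → 𝒴 → Prop) {g : 𝒳 → ℝ} {α ζ₁ ζ₂ τ : ℝ} (hα : 0 < α)
    (hg0 : ∀ x, 0 ≤ g x) (hg1 : ∀ x, g x ≤ ∑ y, p (x, y))
    (hgα : ∀ x, g x ≤ α * (∑ y, p (x, y)) * ∑ u, (if A u x then pU u else 0))
    (hgs : 1 - ζ₁ ≤ ∑ x, g x)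
    (hA : ∀ u x, A u x → ∑ y, (if T u y then 0 else p (x, y)) ≤ ζ₂ * ∑ y, p (x, y))
    (hζ₂ : 0 ≤ ζ₂)
    (hT : ∑ y, (∑ x, p (x, y)) * ∑ u, (if T u y then pU u else 0) ≤ τ)
    (M B : ℕ) (hB : 0 < B) :
    ∃ (c : Fin M → 𝒰) (Φ : 𝒳 → Option (Fin M)) (bin : Fin M → Fin B)
      (dec : 𝒴 → Fin B → Option (Fin M)), (∀ x m, Φ x = some m → A (c m) x) ∧
      ∑ x, ∑ y, (if ∃ m, Φ x = some m ∧ dec y (bin m) = some m then 0 else p (x, y)) ≤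
        ζ₁ + Real.exp (-(M / α)) + ζ₂ + M * τ / B := by
  have hB' : (0 : ℝ) < B := by exact_mod_cast hB
  set pX : 𝒳 → ℝ := fun x => ∑ y, p (x, y) with hpX
  set pY : 𝒴 → ℝ := fun y => ∑ x, p (x, y) with hpY
  have hpX0 : ∀ x, 0 ≤ pX x := fun x => Finset.sum_nonneg fun _ _ => hp.1 _
  have hpY0 : ∀ y, 0 ≤ pY y := fun x => Finset.sum_nonneg fun _ _ => hp.1 _
  have hpX1 : ∑ x, pX x = 1 := by rw [← hp.2, Fintype.sum_prod_type]
  set E₁ : (Fin M → 𝒰) → ℝ := fun c => ∑ x, if ∃ m, A (c m) x then 0 else pX x with hE₁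
  set E₃ : (Fin M → 𝒰) → ℝ := fun c => ∑ y, pY y * ∑ m, if T (c m) y then 1 else 0 with hE₃
  -- average over codebooks of the probability that no codeword covers
  have avg₁ : ∑ c : Fin M → 𝒰, (∏ m, pU (c m)) * E₁ c ≤ ζ₁ + Real.exp (-(M / α)) := by
    have h1 : ∀ x, ∑ c : Fin M → 𝒰, (∏ m, pU (c m)) * (if ∃ m, A (c m) x then 0 else pX x) =
        pX x * (1 - ∑ u, if A u x then pU u else 0) ^ M := fun x => by
      have h2 := sum_prod_mul_prod pU fun (_ : Fin M) u => if A u x then 0 else 1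
      have h3 : ∑ u, pU u * (if A u x then 0 else 1) = 1 - ∑ u, if A u x then pU u else 0 := by
        rw [eq_sub_iff_add_eq, ← Finset.sum_add_distrib]
        refine (Finset.sum_congr rfl fun u _ => ?_).trans hpU.2
        split_ifs <;> simp
      rw [h3, Finset.prod_const, Finset.card_univ, Fintype.card_fin] at h2
      rw [← h2, Finset.mul_sum]
      refine Finset.sum_congr rfl fun c _ => ?_
      by_cases h : ∃ m, A (c m) x
      · obtain ⟨m, hm⟩ := h
        have h0 : (∏ i, if A (c i) x then (0 : ℝ) else 1) = 0 :=
          Finset.prod_eq_zero (Finset.mem_univ m) (if_pos hm)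
        rw [if_pos ⟨m, hm⟩, h0]
        ring
      · rw [if_neg h, Finset.prod_eq_one fun m _ => if_neg fun hm => h ⟨m, hm⟩]
        ring
    have h4 : ∀ x, pX x * (1 - ∑ u, if A u x then pU u else 0) ^ M ≤
        pX x - g x + pX x * Real.exp (-(M / α)) := fun x => by
      rcases (hpX0 x).eq_or_lt with h0 | h0
      · have : g x = 0 := le_antisymm ((hg1 x).trans h0.symm.le) (hg0 x)
        rw [← h0, this]; simp
      · have ha : (∑ u, if A u x then pU u else 0) ≤ 1 := by
          rw [← hpU.2]
          refine Finset.sum_le_sum fun u _ => ?_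
          split_ifs
          · exact le_rfl
          · exact hpU.1 u
        have h5 := one_sub_pow_le ha (div_nonneg (hg0 x) h0.le) ((div_le_one h0).2 (hg1 x)) hα
          (by rw [div_le_iff₀ h0]; linarith [hgα x]) M
        have h6 := mul_le_mul_of_nonneg_left h5 h0.le
        have h7 : pX x * (1 - g x / pX x + Real.exp (-(M / α))) =
            pX x - g x + pX x * Real.exp (-(M / α)) := by field_simp
        linarith
    simp only [hE₁, Finset.mul_sum]
    rw [Finset.sum_comm]
    calc _ ≤ ∑ x, (pX x - g x + pX x * Real.exp (-(M / α))) :=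
          Finset.sum_le_sum fun x _ => (h1 x).trans_le (h4 x)
      _ ≤ _ := by
          rw [Finset.sum_add_distrib, Finset.sum_sub_distrib, ← Finset.sum_mul, hpX1]; linarith
  -- average over codebooks of the number of codewords passing the test
  have avg₃ : ∑ c : Fin M → 𝒰, (∏ m, pU (c m)) * E₃ c ≤ M * τ := by
    have h1 : ∀ y m, ∑ c : Fin M → 𝒰, (∏ m, pU (c m)) * (if T (c m) y then 1 else 0) =
        ∑ u, if T u y then pU u else 0 := fun y m => by
      rw [sum_prod_mul_coord hpU.2 m fun u => if T u y then 1 else 0]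
      simp
    have h2 : ∑ c : Fin M → 𝒰, (∏ m, pU (c m)) * E₃ c =
        ∑ y, pY y * ∑ m : Fin M, ∑ c : Fin M → 𝒰, (∏ m, pU (c m)) * (if T (c m) y then 1 else 0) := by
      simp only [hE₃, Finset.mul_sum]
      rw [Finset.sum_comm]
      refine Finset.sum_congr rfl fun y _ => ?_
      rw [Finset.sum_comm]
      exact Finset.sum_congr rfl fun m _ => Finset.sum_congr rfl fun c _ => by ring
    rw [h2]
    simp only [h1, Finset.sum_const, Finset.card_univ, Fintype.card_fin, nsmul_eq_mul]
    calc _ = M * ∑ y, pY y * ∑ u, (if T u y then pU u else 0) := by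
          rw [Finset.mul_sum]; exact Finset.sum_congr rfl fun y _ => by ring
      _ ≤ _ := mul_le_mul_of_nonneg_left hT (Nat.cast_nonneg M)
  obtain ⟨c, hc⟩ := exists_le_of_sum_mul_le (prod_mem_stdSimplex (ι := Fin M) hpU)
    (f := fun c => E₁ c + E₃ c / B) (a := ζ₁ + Real.exp (-(M / α)) + M * τ / B) (by
      have h1 : ∀ c : Fin M → 𝒰, (∏ m, pU (c m)) * (E₁ c + E₃ c / B) =
          (∏ m, pU (c m)) * E₁ c + (∏ m, pU (c m)) * E₃ c / B := fun c => by ring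
      simp only [h1]
      rw [Finset.sum_add_distrib, ← Finset.sum_div]
      have h2 := div_le_div_of_nonneg_right avg₃ hB'.le
      linarith)
  set Φ : 𝒳 → Option (Fin M) := fun x => if h : ∃ m, A (c m) x then some h.choose else none with hΦ
  have hΦA : ∀ x m, Φ x = some m → A (c m) x := fun x m h => by
    simp only [hΦ] at h
    split_ifs at h with h1
    · rw [← Option.some.inj h]; exact h1.choose_spec
  -- weight of the confusions under a binning
  set E₂ : (Fin M → Fin B) → ℝ := fun b => ∑ x, ∑ y, p (x, y) * ∑ m, ∑ m',
    if m' ≠ m ∧ Φ x = some m ∧ T (c m') y then (if b m = b m' then 1 else 0) else 0 with hE₂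
  have hunif : (fun _ : Fin B => (B : ℝ)⁻¹) ∈ stdSimplex ℝ (Fin B) :=
    ⟨fun _ => by positivity, by simp [hB'.ne']⟩
  have avg₂ : ∑ b : Fin M → Fin B, (∏ _m : Fin M, (B : ℝ)⁻¹) * E₂ b ≤ E₃ c / B := by
    have h1 : ∀ m m', m' ≠ m → ∑ b : Fin M → Fin B, (∏ _m : Fin M, (B : ℝ)⁻¹) *
        (if b m = b m' then 1 else 0) = (B : ℝ)⁻¹ := fun m m' hm => by
      have h2 : ∀ b : Fin M → Fin B, (if b m = b m' then (1 : ℝ) else 0) =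
          ∑ j, (if b m = j then 1 else 0) * (if b m' = j then 1 else 0) := fun b => by
        simp [eq_comm]
      simp only [h2, Finset.mul_sum]
      rw [Finset.sum_comm]
      have h3 := fun j : Fin B => sum_prod_mul_coord_mul_coord hunif.2 hm.symm
        (fun k => if k = j then 1 else 0) (fun k => if k = j then 1 else 0)
      simp only [h3]
      simp [hB'.ne']
    have h4 : ∑ b : Fin M → Fin B, (∏ _m : Fin M, (B : ℝ)⁻¹) * E₂ b =
        ∑ x, ∑ y, p (x, y) * ∑ m, ∑ m', if m' ≠ m ∧ Φ x = some m ∧ T (c m') y then (B : ℝ)⁻¹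
          else 0 := by
      simp only [hE₂, Finset.mul_sum (s := (Finset.univ : Finset 𝒳))]
      rw [Finset.sum_comm]
      refine Finset.sum_congr rfl fun x _ => ?_
      simp only [Finset.mul_sum (s := (Finset.univ : Finset 𝒴))]
      rw [Finset.sum_comm]
      refine Finset.sum_congr rfl fun y _ => ?_
      have h5 : ∀ b : Fin M → Fin B, (∏ _m : Fin M, (B : ℝ)⁻¹) * (p (x, y) * ∑ m, ∑ m',
          if m' ≠ m ∧ Φ x = some m ∧ T (c m') y then (if b m = b m' then 1 else 0) else 0) =
          p (x, y) * ∑ m, ∑ m', if m' ≠ m ∧ Φ x = some m ∧ T (c m') y then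
            (∏ _m : Fin M, (B : ℝ)⁻¹) * (if b m = b m' then 1 else 0) else 0 := fun b => by
        rw [mul_left_comm]
        congr 1
        simp only [Finset.mul_sum]
        refine Finset.sum_congr rfl fun m _ => Finset.sum_congr rfl fun m' _ => ?_
        split_ifs <;> simp
      simp only [h5]
      rw [← Finset.mul_sum]
      congr 1
      rw [Finset.sum_comm]
      refine Finset.sum_congr rfl fun m _ => ?_
      rw [Finset.sum_comm]
      refine Finset.sum_congr rfl fun m' _ => ?_
      by_cases h : m' ≠ m ∧ Φ x = some m ∧ T (c m') y
      · simp only [if_pos h]; exact h1 m m' h.1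
      · simp only [if_neg h, Finset.sum_const_zero]
    rw [h4]
    have h6 : ∀ x y, (∑ m, ∑ m', if m' ≠ m ∧ Φ x = some m ∧ T (c m') y then (B : ℝ)⁻¹ else 0) ≤
        (∑ m', if T (c m') y then 1 else 0) / (B : ℝ) := fun x y => by
      rw [Finset.sum_comm, Finset.sum_div]
      refine Finset.sum_le_sum fun m' _ => ?_
      by_cases hT' : T (c m') y
      · rw [if_pos hT', one_div]
        rcases hx : Φ x with _ | m0
        · simp only [reduceCtorEq, false_and, and_false, if_false, Finset.sum_const_zero]
          positivity
        · calc _ ≤ ∑ m, if m0 = m then (B : ℝ)⁻¹ else 0 := by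
                refine Finset.sum_le_sum fun m _ => ?_
                by_cases h : m0 = m
                · simp only [h, if_true]
                  split_ifs
                  · exact le_rfl
                  · positivity
                · simp [h]
            _ = _ := by simp
      · simp [hT']
    calc _ ≤ ∑ x, ∑ y, p (x, y) * ((∑ m', if T (c m') y then 1 else 0) / (B : ℝ)) :=
          Finset.sum_le_sum fun x _ => Finset.sum_le_sum fun y _ =>
            mul_le_mul_of_nonneg_left (h6 x y) (hp.1 _)
      _ = E₃ c / B := by
          rw [Finset.sum_comm, Finset.sum_div]
          refine Finset.sum_congr rfl fun y _ => ?_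
          rw [← Finset.sum_mul, mul_div_assoc]
  obtain ⟨b, hb⟩ := exists_le_of_sum_mul_le (prod_mem_stdSimplex (ι := Fin M) hunif) avg₂
  refine ⟨c, Φ, b, fun y j => if h : ∃ m, b m = j ∧ T (c m) y then some h.choose else none,
    hΦA, ?_⟩
  have hmain : ∀ x y, (if ∃ m, Φ x = some m ∧
      (if h : ∃ m', b m' = b m ∧ T (c m') y then some h.choose else none) = some m then 0
        else p (x, y)) ≤ (if ∃ m, A (c m) x then 0 else p (x, y)) +
      (if ∃ m, Φ x = some m ∧ ¬ T (c m) y then p (x, y) else 0) +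
      p (x, y) * ∑ m, ∑ m', if m' ≠ m ∧ Φ x = some m ∧ T (c m') y then
        (if b m = b m' then (1 : ℝ) else 0) else 0 := fun x y => by
    have hp0 := hp.1 (x, y)
    have hn : 0 ≤ ∑ m, ∑ m', if m' ≠ m ∧ Φ x = some m ∧ T (c m') y then
        (if b m = b m' then (1 : ℝ) else 0) else 0 :=
      Finset.sum_nonneg fun m _ => Finset.sum_nonneg fun m' _ => by split_ifs <;> norm_num
    have hn' := mul_nonneg hp0 hn
    have i1 : 0 ≤ if ∃ m, A (c m) x then 0 else p (x, y) := by split_ifs <;> simp [hp0]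
    have i2 : 0 ≤ if ∃ m, Φ x = some m ∧ ¬ T (c m) y then p (x, y) else 0 := by
      split_ifs <;> simp [hp0]
    by_cases h : ∃ m, Φ x = some m ∧
      (if h : ∃ m', b m' = b m ∧ T (c m') y then some h.choose else none) = some m
    · rw [if_pos h]; linarith
    rw [if_neg h]
    by_cases h1 : ∃ m, A (c m) x
    swap
    · rw [if_neg h1]; linarith
    have h2 : Φ x = some h1.choose := by simp only [hΦ, dif_pos h1]
    by_cases h3 : ∃ m, Φ x = some m ∧ ¬ T (c m) y
    · rw [if_pos h3] at i2 ⊢; linarith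
    -- the covering codeword passes the test, so another codeword of its bin does too
    set m := h1.choose
    have h4 : T (c m) y := by
      by_contra h5; exact h3 ⟨m, h2, h5⟩
    have h5 : ∃ m', b m' = b m ∧ T (c m') y := ⟨m, rfl, h4⟩
    have h6 : h5.choose ≠ m := fun h7 => h ⟨m, h2, by rw [dif_pos h5, h7]⟩
    have h7 : (1 : ℝ) ≤ ∑ m, ∑ m', if m' ≠ m ∧ Φ x = some m ∧ T (c m') y then
        (if b m = b m' then (1 : ℝ) else 0) else 0 := by
      have h8 : ∀ m m' : Fin M, 0 ≤ if m' ≠ m ∧ Φ x = some m ∧ T (c m') y then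
        (if b m = b m' then (1 : ℝ) else 0) else 0 := fun m m' => by split_ifs <;> norm_num
      calc (1 : ℝ) = if h5.choose ≠ m ∧ Φ x = some m ∧ T (c h5.choose) y then
            (if b m = b h5.choose then (1 : ℝ) else 0) else 0 := by
            rw [if_pos ⟨h6, h2, h5.choose_spec.2⟩, if_pos h5.choose_spec.1.symm]
        _ ≤ ∑ m', if m' ≠ m ∧ Φ x = some m ∧ T (c m') y then
            (if b m = b m' then (1 : ℝ) else 0) else 0 :=
          Finset.single_le_sum (f := fun m' => if m' ≠ m ∧ Φ x = some m ∧ T (c m') y then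
            (if b m = b m' then (1 : ℝ) else 0) else 0) (fun m' _ => h8 m m')
            (Finset.mem_univ h5.choose)
        _ ≤ _ := Finset.single_le_sum (f := fun m => ∑ m', if m' ≠ m ∧ Φ x = some m ∧ T (c m') y
            then (if b m = b m' then (1 : ℝ) else 0) else 0)
            (fun m _ => Finset.sum_nonneg fun m' _ => h8 m m') (Finset.mem_univ m)
    have h8 := mul_le_mul_of_nonneg_left h7 hp0
    linarith
  have hsum := Finset.sum_le_sum fun x (_ : x ∈ Finset.univ) =>
    Finset.sum_le_sum fun y (_ : y ∈ Finset.univ) => hmain x y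
  simp only [Finset.sum_add_distrib] at hsum
  have s1 : ∑ x, ∑ y, (if ∃ m, A (c m) x then 0 else p (x, y)) = E₁ c := by
    refine Finset.sum_congr rfl fun x _ => ?_
    split_ifs <;> simp [hpX]
  have s2 : ∑ x, ∑ y, (if ∃ m, Φ x = some m ∧ ¬ T (c m) y then p (x, y) else 0) ≤ ζ₂ := by
    calc _ ≤ ∑ x, ζ₂ * pX x := by
          refine Finset.sum_le_sum fun x _ => ?_
          rcases hx : Φ x with _ | m
          · simp only [reduceCtorEq, false_and, exists_false, if_false, Finset.sum_const_zero]
            exact mul_nonneg hζ₂ (hpX0 x)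
          · refine le_trans (le_of_eq ?_) (hA (c m) x (hΦA x m hx))
            refine Finset.sum_congr rfl fun y _ => ?_
            by_cases h : T (c m) y <;> simp [h]
      _ = ζ₂ := by rw [← Finset.mul_sum, hpX1, mul_one]
  rw [s1] at hsum
  change _ ≤ E₁ c + _ + E₂ b at hsum
  linarith

/-! ### Protocols from source codes and channel codes -/

section Combine

variable {𝒳 𝒴 𝒯 𝒵 : Type*} [Fintype 𝒳] [Fintype 𝒴] [Fintype 𝒯] [Fintype 𝒵]

/-- There is a scheme extracting from `X ^ n` a value `Φ (X ^ n)` in `Fin (M + 1)` of rate about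
`v`: all values except the last one, which signals a failure, are of probability at most about
`2 ^ (-n v)`. The value is determined, up to an error of probability at most `s`, by `Y ^ n` and
its bin, which is one of `B` many. -/
def SourceCode (P : FinDist (𝒳 × 𝒴)) (n B : ℕ) (v γ s : ℝ) : Prop :=
  ∃ (M : ℕ) (Φ : (Fin n → 𝒳) → Fin (M + 1)) (bin : Fin (M + 1) → ℕ)
    (dec : (Fin n → 𝒴) → ℕ → Fin (M + 1)), 2 ≤ M ∧
    (M + 1 : ℝ) ≤ (2 : ℝ) ^ ((n : ℝ) * (v + γ)) ∧ (∀ m, bin m < B) ∧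
    (∀ m, m ≠ Fin.last M →
      mass (sourceLaw P n) (fun t => Φ t.1) m ≤ (2 : ℝ) ^ (-((n : ℝ) * (v - γ)))) ∧
    mass (sourceLaw P n) (fun t => Φ t.1) (Fin.last M) ≤ γ ∧
    ∑ t, sourceLaw P n t * (if dec t.2 (bin (Φ t.1)) = Φ t.1 then 0 else 1) ≤ s

/-- The bin of the extracted value is sent over the channel. -/
theorem exists_protocol {P : FinDist (𝒳 × 𝒴)} {W : Channel 𝒯 𝒵} {n B : ℕ} {v γ s e : ℝ}
    (hn : 0 < n) (hγ1 : γ ≤ 1) (hS : SourceCode P n B v γ s) {c : ℕ → Fin n → 𝒯}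
    {dch : (Fin n → 𝒵) → ℕ}
    (hc : ∀ j < B, ∑ z, (if dch z = j then 0 else (W n (c j)).1 z) ≤ e) :
    ∃ π : Protocol 𝒳 𝒴 𝒯 𝒵 n, errorProb P W π ≤ s + e ∧
      Real.logb 2 (π.card : ℝ) / n ≤ v + γ ∧ (1 - γ) * (v - γ) ≤ entropyK P W π / n := by
  classical
  obtain ⟨M, Φ, bin, dec, hM, hMle, hbin, hmass, hlast, herr⟩ := hS
  have hn' : (0 : ℝ) < n := by exact_mod_cast hn
  set π : Protocol 𝒳 𝒴 𝒯 𝒵 n := ⟨M + 1, by omega, Φ, fun x => c (bin (Φ x)),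
    fun y z => dec y (dch z)⟩ with hπ
  refine ⟨π, ?_, ?_, ?_⟩
  · have h1 : ∀ t, tripleLaw P W π t * (if π.Φ t.1 = π.Ψ t.2.1 t.2.2 then 0 else 1) ≤
        tripleLaw P W π t * (if dec t.2.1 (bin (Φ t.1)) = Φ t.1 then 0 else 1) +
        tripleLaw P W π t * (if dch t.2.2 = bin (Φ t.1) then 0 else 1) := fun t => by
      rw [← mul_add]
      refine mul_le_mul_of_nonneg_left ?_ ((tripleLaw_mem P W π).1 t)
      by_cases h1 : dch t.2.2 = bin (Φ t.1)
      · by_cases h2 : dec t.2.1 (bin (Φ t.1)) = Φ t.1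
        · have : π.Φ t.1 = π.Ψ t.2.1 t.2.2 := by
            change Φ t.1 = dec t.2.1 (dch t.2.2)
            rw [h1, h2]
          simp [this, h1, h2]
        · rw [if_pos h1, if_neg h2]; split_ifs <;> norm_num
      · rw [if_neg h1]; split_ifs <;> norm_num
    have h2 := sum_tripleLaw_mul P W π
      fun x y => if dec y (bin (Φ x)) = Φ x then (0 : ℝ) else 1
    have h3 : ∑ t, tripleLaw P W π t * (if dch t.2.2 = bin (Φ t.1) then (0 : ℝ) else 1) ≤ e := by
      simp only [Fintype.sum_prod_type, tripleLaw_eq]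
      calc _ ≤ ∑ x, ∑ y, sourceLaw P n (x, y) * e := by
            refine Finset.sum_le_sum fun x _ => Finset.sum_le_sum fun y _ => ?_
            simp only [mul_assoc, ← Finset.mul_sum]
            refine mul_le_mul_of_nonneg_left ?_ ((sourceLaw_mem P n).1 _)
            simpa using hc (bin (Φ x)) (hbin _)
        _ = e := by
            simp only [← Finset.sum_mul]
            rw [← Fintype.sum_prod_type, (sourceLaw_mem P n).2, one_mul]
    rw [errorProb_eq]
    refine (Finset.sum_le_sum fun t _ => h1 t).trans ?_
    rw [Finset.sum_add_distrib]
    linarith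
  · rw [div_le_iff₀ hn', Real.logb_le_iff_le_rpow (by norm_num)
      (by exact_mod_cast Nat.succ_pos M)]
    have : ((π.card : ℕ) : ℝ) = M + 1 := by simp [hπ]
    rw [this, mul_comm]; exact hMle
  · rw [le_div_iff₀ hn']
    have hK0 := entropyK_nonneg P W π
    rcases le_total (v - γ) 0 with h0 | h0
    · have : (1 - γ) * (v - γ) * n ≤ 0 :=
        mul_nonpos_of_nonpos_of_nonneg
          (mul_nonpos_of_nonneg_of_nonpos (by linarith) h0) hn'.le
      linarith
    have hm := mass_mem_stdSimplex (sourceLaw_mem P n) fun t => Φ t.1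
    set p := mass (sourceLaw P n) fun t => Φ t.1 with hp
    have hpe : entropyK P W π = -∑ k, p k * Real.logb 2 (p k) := by
      rw [entropyK, sum_pairLaw]; rfl
    have h1 : ∀ k ∈ Finset.univ, (if k = Fin.last M then 0 else p k) * ((n : ℝ) * (v - γ)) ≤
        -(p k * Real.logb 2 (p k)) := fun k _ => by
      have hk1 : p k ≤ 1 := by
        rw [← hm.2]
        exact Finset.single_le_sum (fun i _ => hm.1 i) (Finset.mem_univ k)
      split_ifs with h
      · rw [zero_mul, neg_nonneg]
        exact mul_nonpos_of_nonneg_of_nonpos (hm.1 k)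
          (Real.logb_nonpos (by norm_num) (hm.1 k) hk1)
      · rcases (hm.1 k).eq_or_lt with h2 | h2
        · simp [← h2]
        · have h3 := hmass k h
          rw [← Real.logb_le_iff_le_rpow (by norm_num) h2] at h3
          have := mul_le_mul_of_nonneg_left h3 h2.le
          linarith
    have h2 := Finset.sum_le_sum h1
    have h3 : ∑ k, (if k = Fin.last M then 0 else p k) = 1 - p (Fin.last M) := by
      rw [eq_sub_iff_add_eq, ← hm.2]
      have : p (Fin.last M) = ∑ k, if k = Fin.last M then p k else 0 := by simp
      rw [this, ← Finset.sum_add_distrib]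
      refine Finset.sum_congr rfl fun k _ => ?_
      split_ifs <;> simp
    rw [← Finset.sum_mul, h3, Finset.sum_neg_distrib, ← hpe] at h2
    have h4 : (1 - γ) * ((n : ℝ) * (v - γ)) ≤ (1 - p (Fin.last M)) * ((n : ℝ) * (v - γ)) :=
      mul_le_mul_of_nonneg_right (by linarith) (by positivity)
    linarith

theorem nonempty_of_finDist (P : FinDist (𝒳 × 𝒴)) : Nonempty (𝒳 × 𝒴) := by
  by_contra h
  rw [not_nonempty_iff] at h
  have := P.2.2
  simp at this

theorem entropyK_le (P : FinDist (𝒳 × 𝒴)) (W : Channel 𝒯 𝒵) {n : ℕ} (π : Protocol 𝒳 𝒴 𝒯 𝒵 n) :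
    entropyK P W π ≤ n * Real.logb 2 (Fintype.card 𝒳) := by
  obtain ⟨x, -⟩ := nonempty_of_finDist P
  have : Nonempty 𝒳 := ⟨x⟩
  classical
  rw [entropyK_eq]
  have h1 := ent_le_logb_card (sourceLaw_mem P n) fun t => t.1
  rw [Fintype.card_fun, Fintype.card_fin, Nat.cast_pow, Real.logb_pow] at h1
  exact (ent_mono (sourceLaw_mem P n).1 fun t t' h => by rw [h]).trans h1

/-- The bound on the alphabet size in the definition of achievability is automatic, with a constant
that depends only on the source alphabet. -/
theorem isAchievableRate_iff {P : FinDist (𝒳 × 𝒴)} {W : Channel 𝒯 𝒵} {ε H : ℝ} :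
    IsAchievableRate P W ε H ↔ ∀ β : ℝ, 0 < β → ∀ δ : ℝ, 0 < δ → ∀ᶠ n : ℕ in Filter.atTop,
      ∃ π : Protocol 𝒳 𝒴 𝒯 𝒵 n, errorProb P W π ≤ ε ∧
        |entropyK P W π / (n : ℝ) - Real.logb 2 (π.card : ℝ) / (n : ℝ)| ≤ β ∧
        entropyK P W π / (n : ℝ) > H - δ := by
  constructor
  · rintro ⟨c, -, hc⟩ β hβ δ hδ
    filter_upwards [hc β hβ δ hδ] with n hn
    obtain ⟨π, h1, -, h3, h4⟩ := hn
    exact ⟨π, h1, h3, h4⟩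
  · intro h
    obtain ⟨x, -⟩ := nonempty_of_finDist P
    have : Nonempty 𝒳 := ⟨x⟩
    have hX : (1 : ℝ) ≤ Fintype.card 𝒳 := by exact_mod_cast Fintype.card_pos
    refine ⟨Real.logb 2 (Fintype.card 𝒳) + 1,
      by linarith [Real.logb_nonneg (by norm_num : (1 : ℝ) < 2) hX], fun β hβ δ hδ => ?_⟩
    filter_upwards [h (min β 1) (by positivity) δ hδ, Filter.eventually_gt_atTop 0] with n hn hn0
    obtain ⟨π, h1, h2, h3⟩ := hn
    have hn' : (0 : ℝ) < n := by exact_mod_cast hn0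
    refine ⟨π, h1, ?_, h2.trans (min_le_left _ _), h3⟩
    have hc0 : (0 : ℝ) < π.card := by
      have := π.three_le_card
      exact_mod_cast (by omega : 0 < π.card)
    rw [← Real.logb_le_iff_le_rpow (by norm_num) hc0]
    have h4 := (abs_le.1 (h2.trans (min_le_right _ _))).1
    have h5 : Real.logb 2 (π.card : ℝ) / n ≤ 1 + entropyK P W π / n := by linarith
    have h6 := entropyK_le P W π
    rw [div_le_iff₀ hn', add_mul, div_mul_cancel₀ _ hn'.ne'] at h5
    linarith

/-- It suffices to find protocols whose rates approach `v`. -/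
theorem isAchievableRate_of_forall {P : FinDist (𝒳 × 𝒴)} {W : Channel 𝒯 𝒵} {ε v : ℝ}
    (hv : 0 ≤ v) (h : ∀ γ : ℝ, 0 < γ → γ ≤ 1 → ∀ᶠ n : ℕ in Filter.atTop,
      ∃ π : Protocol 𝒳 𝒴 𝒯 𝒵 n, errorProb P W π ≤ ε ∧
      Real.logb 2 (π.card : ℝ) / n ≤ v + γ ∧ (1 - γ) * (v - γ) ≤ entropyK P W π / n) :
    IsAchievableRate P W ε v := by
  rw [isAchievableRate_iff]
  intro β hβ δ hδ
  set γ := min 1 (min β δ / (2 + v)) with hγ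
  have hγ0 : 0 < γ := by positivity
  have hγ1 : γ ≤ 1 := min_le_left _ _
  have hγ2 : γ * (2 + v) ≤ min β δ := by
    rw [← le_div_iff₀ (by linarith)]; exact min_le_right _ _
  have hγβ := hγ2.trans (min_le_left _ _)
  have hγδ := hγ2.trans (min_le_right _ _)
  filter_upwards [h γ hγ0 hγ1] with n hn
  obtain ⟨π, h1, h2, h3⟩ := hn
  have h4 := div_le_div_of_nonneg_right (entropyK_le_logb_card P W π) (Nat.cast_nonneg (α := ℝ) n)
  refine ⟨π, h1, ?_, ?_⟩
  · rw [abs_le]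
    constructor <;> nlinarith
  · nlinarith

/-- Feinstein's lemma along the input process `T`: rates up to `R` are possible with error
probability bounded away from `ε`, if `F_T(R) < ε`. -/
theorem exists_channel_codes [Nonempty 𝒯] {W : Channel 𝒯 𝒵} {T : InputProcess 𝒯} {ε R : ℝ}
    (h : spectrumLimsup W T R < ε) : ∃ η : ℝ, 0 < η ∧ ∀ᶠ n : ℕ in Filter.atTop,
      ∀ N : ℕ, (N : ℝ) ≤ (2 : ℝ) ^ ((n : ℝ) * R) * η →
        ∃ (c : ℕ → Fin n → 𝒯) (dch : (Fin n → 𝒵) → ℕ),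
          ∀ j < N, ∑ z, (if dch z = j then 0 else (W n (c j)).1 z) ≤ ε - η := by
  refine ⟨(ε - spectrumLimsup W T R) / 3, by linarith, ?_⟩
  set η := (ε - spectrumLimsup W T R) / 3 with hη
  have h1 : ∀ᶠ n in Filter.atTop, spectrumProb W T R n < ε - 2 * η :=
    Filter.eventually_lt_of_limsup_lt (by change spectrumLimsup W T R < _; linarith)
      (isBoundedUnder_spectrumProb W T R)
  filter_upwards [h1, Filter.eventually_gt_atTop 0] with n hn hn0 N hN
  have hn' : (0 : ℝ) < n := by exact_mod_cast hn0
  refine exists_channel_code (T n).2 (fun t => (W n t).2) (θ := (2 : ℝ) ^ ((n : ℝ) * R))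
    (F := spectrumProb W T R n) (by positivity) ?_ N (hN.trans ?_)
  · refine Finset.sum_le_sum fun t _ => Finset.sum_le_sum fun z _ => ?_
    rcases (ioLaw_nonneg W T n t z).eq_or_lt with h0 | h0
    · change (if _ then ioLaw W T n t z else 0) ≤ _
      rw [← h0]; simp
    · have hZ := h0.trans_le (ioLaw_le_sum W T n t z)
      have hW : 0 < (W n t).1 z := lt_of_le_of_ne ((W n t).2.1 z) fun h1 => by
        simp [ioLaw, ← h1] at h0
      have hiff : infoDensity W T n t z / n ≤ R ↔
          (W n t).1 z ≤ (2 : ℝ) ^ ((n : ℝ) * R) * ∑ t', (T n).1 t' * (W n t').1 z := by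
        rw [div_le_iff₀ hn', infoDensity_eq h0, ← Real.logb_div hW.ne' hZ.ne',
          Real.logb_le_iff_le_rpow (by norm_num) (by positivity), div_le_iff₀ hZ, mul_comm R]
        rfl
      simp only [hiff]
      exact le_rfl
  · refine mul_le_mul_of_nonneg_left ?_ (by positivity)
    linarith

theorem two_rpow_tendsto_atTop {a : ℝ} (ha : 0 < a) :
    Filter.Tendsto (fun n : ℕ => (2 : ℝ) ^ ((n : ℝ) * a)) Filter.atTop Filter.atTop := by
  have h : (fun n : ℕ => (2 : ℝ) ^ ((n : ℝ) * a)) = fun n : ℕ => ((2 : ℝ) ^ a) ^ n := by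
    funext n
    rw [mul_comm, Real.rpow_mul (by norm_num), Real.rpow_natCast]
  rw [h]
  exact tendsto_pow_atTop_atTop_of_one_lt (Real.one_lt_rpow (by norm_num) ha)

/-- A larger nonnegative exponent absorbs constants. -/
theorem eventually_two_rpow_add_le {a b : ℝ} (ha : 0 ≤ a) (hab : a < b) (c : ℝ) {η : ℝ}
    (hη : 0 < η) : ∀ᶠ n : ℕ in Filter.atTop,
      (2 : ℝ) ^ ((n : ℝ) * a) + c ≤ (2 : ℝ) ^ ((n : ℝ) * b) * η := by
  filter_upwards [(two_rpow_tendsto_atTop (sub_pos.2 hab)).eventually_ge_atTop ((1 + |c|) / η)]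
    with n hn
  rw [div_le_iff₀ hη] at hn
  have h1 : (1 : ℝ) ≤ (2 : ℝ) ^ ((n : ℝ) * a) :=
    Real.one_le_rpow (by norm_num) (by positivity)
  have h2 : (2 : ℝ) ^ ((n : ℝ) * b) = (2 : ℝ) ^ ((n : ℝ) * a) * (2 : ℝ) ^ ((n : ℝ) * (b - a)) := by
    rw [← Real.rpow_add (by norm_num)]; congr 1; ring
  have h3 : c ≤ (2 : ℝ) ^ ((n : ℝ) * a) * |c| :=
    (le_abs_self c).trans (le_mul_of_one_le_left (abs_nonneg c) h1)
  rw [h2, mul_assoc]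
  have h4 := mul_le_mul_of_nonneg_left hn (by positivity : (0 : ℝ) ≤ (2 : ℝ) ^ ((n : ℝ) * a))
  linarith

end Combine

/-! ### Jointly typical sequences -/

section Typical

variable {α β : Type*} [Fintype α] [Fintype β]

theorem sum_pair_seq {n : ℕ} (F : (Fin n → α) → (Fin n → β) → ℝ) :
    ∑ w : Fin n → α × β, F (fun i => (w i).1) (fun i => (w i).2) = ∑ a, ∑ b, F a b := by
  classical
  rw [← Fintype.sum_prod_type' F,
    ← (Equiv.arrowProdEquivProdArrow (Fin n) (fun _ => α) fun _ => β).sum_comp]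
  rfl

/-- The information density of one pair of letters. -/
noncomputable def pairDensity (q : α × β → ℝ) (t : α × β) : ℝ :=
  Real.logb 2 (q t / ((∑ b, q (t.1, b)) * ∑ a, q (a, t.2)))

/-- Sequences of positive probability under the i.i.d. law of `q` whose information density is
within `n δ` of `n` times the mutual information. -/
def IsTypicalPair (q : α × β → ℝ) (δ : ℝ) {n : ℕ} (a : Fin n → α) (b : Fin n → β) : Prop :=
  0 < ∏ i, q (a i, b i) ∧ |∑ i, pairDensity q (a i, b i) - n * mutualInfo q| ≤ n * δ

theorem IsTypicalPair.bounds {q : α × β → ℝ} (hq : ∀ t, 0 ≤ q t) {δ : ℝ} {n : ℕ} {a : Fin n → α}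
    {b : Fin n → β} (h : IsTypicalPair q δ a b) :
    ∏ i, q (a i, b i) ≤ (2 : ℝ) ^ ((n : ℝ) * (mutualInfo q + δ)) *
      ((∏ i, ∑ b', q (a i, b')) * ∏ i, ∑ a', q (a', b i)) ∧
    (∏ i, ∑ b', q (a i, b')) * (∏ i, ∑ a', q (a', b i)) ≤
      (2 : ℝ) ^ (-((n : ℝ) * (mutualInfo q - δ))) * ∏ i, q (a i, b i) := by
  obtain ⟨h0, h1⟩ := h
  have hpos : ∀ i, 0 < q (a i, b i) := fun i =>
    lt_of_le_of_ne (hq _) fun h2 => h0.ne' (Finset.prod_eq_zero (Finset.mem_univ i) h2.symm)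
  have hA : ∀ i, 0 < ∑ b', q (a i, b') := fun i => (hpos i).trans_le
    (Finset.single_le_sum (f := fun b' => q (a i, b')) (fun _ _ => hq _) (Finset.mem_univ _))
  have hB : ∀ i, 0 < ∑ a', q (a', b i) := fun i => (hpos i).trans_le
    (Finset.single_le_sum (f := fun a' => q (a', b i)) (fun _ _ => hq _) (Finset.mem_univ _))
  set S := ∑ i, pairDensity q (a i, b i) with hS
  have e : ∏ i, q (a i, b i) =
      (2 : ℝ) ^ S * ((∏ i, ∑ b', q (a i, b')) * ∏ i, ∑ a', q (a', b i)) := by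
    rw [hS, Real.rpow_sum_of_pos (by norm_num), ← Finset.prod_mul_distrib,
      ← Finset.prod_mul_distrib]
    refine Finset.prod_congr rfl fun i _ => ?_
    have := hpos i; have := hA i; have := hB i
    rw [pairDensity, Real.rpow_logb (by norm_num) (by norm_num) (by positivity)]
    field_simp
  have hAB : 0 ≤ (∏ i, ∑ b', q (a i, b')) * ∏ i, ∑ a', q (a', b i) :=
    mul_nonneg (Finset.prod_nonneg fun i _ => (hA i).le) (Finset.prod_nonneg fun i _ => (hB i).le)
  obtain ⟨h2, h3⟩ := abs_le.1 h1
  constructor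
  · rw [e]
    exact mul_le_mul_of_nonneg_right
      (Real.rpow_le_rpow_of_exponent_le (by norm_num) (by linarith)) hAB
  · rw [e, ← mul_assoc, ← Real.rpow_add (by norm_num)]
    refine le_mul_of_one_le_left hAB (Real.one_le_rpow (by norm_num) (by linarith))

open Classical in
theorem eventually_atypicalPair_le {q : α × β → ℝ} (hq : q ∈ stdSimplex ℝ (α × β)) {δ s : ℝ}
    (hδ : 0 < δ) (hs : 0 < s) : ∀ᶠ n : ℕ in Filter.atTop,
      ∑ a : Fin n → α, ∑ b : Fin n → β,
        (if IsTypicalPair q δ a b then 0 else ∏ i, q (a i, b i)) ≤ s := by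
  filter_upwards [eventually_sum_atypical_le hq (pairDensity q) hδ hs] with n hn
  refine le_trans (le_of_eq ?_) hn
  rw [← sum_pair_seq fun a b => if IsTypicalPair q δ a b then 0 else ∏ i, q (a i, b i)]
  refine Finset.sum_congr rfl fun w _ => ?_
  have hμ : ∑ t, q t * pairDensity q t = mutualInfo q := by
    rw [Fintype.sum_prod_type]; rfl
  have h0 : 0 ≤ ∏ i, q (w i) := Finset.prod_nonneg fun i _ => hq.1 _
  simp only [IsTypicalPair, Prod.mk.eta, hμ]
  rcases h0.eq_or_lt with h1 | h1
  · simp [← h1]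
  · simp [h1]

theorem mutualInfo_nonneg {q : α × β → ℝ} (hq : q ∈ stdSimplex ℝ (α × β)) : 0 ≤ mutualInfo q := by
  have hA : ∀ t, 0 < q t → 0 < ∑ b, q (t.1, b) := fun t h => h.trans_le
    (Finset.single_le_sum (f := fun b' => q (t.1, b')) (fun _ _ => hq.1 _) (Finset.mem_univ t.2))
  have hB : ∀ t, 0 < q t → 0 < ∑ a, q (a, t.2) := fun t h => h.trans_le
    (Finset.single_le_sum (f := fun a' => q (a', t.2)) (fun _ _ => hq.1 _) (Finset.mem_univ t.1))
  have key := gibbs (w := q) (r := fun t => (∑ b, q (t.1, b)) * ∑ a, q (a, t.2)) hq.1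
    (fun t => mul_nonneg (Finset.sum_nonneg fun _ _ => hq.1 _)
      (Finset.sum_nonneg fun _ _ => hq.1 _)) (fun t h => mul_pos (hA t h) (hB t h)) (by
      have h1 : ∑ a, ∑ b, q (a, b) = 1 := by rw [← Fintype.sum_prod_type]; exact hq.2
      have h2 : ∑ b, ∑ a, q (a, b) = 1 := by rw [← Fintype.sum_prod_type_right]; exact hq.2
      rw [Fintype.sum_prod_type]
      simp only [← Finset.mul_sum, ← Finset.sum_mul, h1, h2, hq.2]
      norm_num)
  have e : mutualInfo q = -∑ t, q t *
      (Real.logb 2 ((∑ b, q (t.1, b)) * ∑ a, q (a, t.2)) - Real.logb 2 (q t)) := by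
    rw [mutualInfo, Fintype.sum_prod_type, ← Finset.sum_neg_distrib]
    refine Finset.sum_congr rfl fun a _ => ?_
    rw [← Finset.sum_neg_distrib]
    refine Finset.sum_congr rfl fun b _ => ?_
    rcases (hq.1 (a, b)).eq_or_lt with h0 | h0
    · simp [← h0]
    · have := hA _ h0
      have := hB _ h0
      rw [Real.logb_div h0.ne' (by positivity)]
      ring
  linarith

end Typical

/-! ### Source codes from an auxiliary variable -/

section CoverSource

variable {𝒳 𝒴 : Type*} [Fintype 𝒳] [Fintype 𝒴]

theorem margUX_mem {𝒰 : Type*} [Fintype 𝒰] {q : 𝒰 × 𝒳 × 𝒴 → ℝ}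
    (hq : q ∈ stdSimplex ℝ (𝒰 × 𝒳 × 𝒴)) : margUX q ∈ stdSimplex ℝ (𝒰 × 𝒳) :=
  ⟨margUX_nonneg hq.1, by
    rw [← hq.2]; simp only [Fintype.sum_prod_type, margUX]⟩

theorem margUY_mem {𝒰 : Type*} [Fintype 𝒰] {q : 𝒰 × 𝒳 × 𝒴 → ℝ}
    (hq : q ∈ stdSimplex ℝ (𝒰 × 𝒳 × 𝒴)) : margUY q ∈ stdSimplex ℝ (𝒰 × 𝒴) :=
  ⟨margUY_nonneg hq.1, by
    rw [← hq.2]; simp only [Fintype.sum_prod_type, margUY]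
    exact Finset.sum_congr rfl fun u _ => Finset.sum_comm⟩

theorem margU_mem {𝒰 : Type*} [Fintype 𝒰] {q : 𝒰 × 𝒳 × 𝒴 → ℝ}
    (hq : q ∈ stdSimplex ℝ (𝒰 × 𝒳 × 𝒴)) : margU q ∈ stdSimplex ℝ 𝒰 :=
  ⟨fun u => Finset.sum_nonneg fun _ _ => hq.1 _, by
    rw [← hq.2, Fintype.sum_prod_type]; rfl⟩

open Classical in
/-- The Markov lemma in averaged form: if `(U, Y)` is typical with high probability, then most
pairs `(u, x)` are such that `(u, Y)` is typical with high conditional probability given `x`. -/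
theorem sum_bad_le {𝒰 𝒳 𝒴 : Type*} [Fintype 𝒰] [Fintype 𝒳] [Fintype 𝒴] {Q : 𝒰 × 𝒳 × 𝒴 → ℝ}
    (hQ : ∀ t, 0 ≤ Q t) {p : 𝒳 × 𝒴 → ℝ} (hp : ∀ t, 0 ≤ p t)
    (hM : ∀ u x y, Q (u, x, y) * ∑ y', p (x, y') = margUX Q (u, x) * p (x, y))
    (T : 𝒰 → 𝒴 → Prop) {ζ s : ℝ} (hζ : 0 < ζ)
    (hs : ∑ u, ∑ y, (if T u y then 0 else margUY Q (u, y)) ≤ s) :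
    ∑ u, ∑ x, (if ∑ y, (if T u y then 0 else p (x, y)) ≤ ζ * ∑ y, p (x, y) then 0
      else margUX Q (u, x)) ≤ s / ζ := by
  have h1 : ∀ u x, (if ∑ y, (if T u y then 0 else p (x, y)) ≤ ζ * ∑ y, p (x, y) then 0
      else margUX Q (u, x)) ≤ (∑ y, if T u y then 0 else Q (u, x, y)) / ζ := fun u x => by
    have hX : 0 ≤ ∑ y, p (x, y) := Finset.sum_nonneg fun _ _ => hp _
    split_ifs with h
    · refine div_nonneg (Finset.sum_nonneg fun y _ => ?_) hζ.le
      split_ifs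
      · exact le_rfl
      · exact hQ _
    · rw [not_le] at h
      have hle : ∑ y, (if T u y then 0 else p (x, y)) ≤ ∑ y, p (x, y) := by
        refine Finset.sum_le_sum fun y _ => ?_
        split_ifs
        · exact hp _
        · exact le_rfl
      have hX' : 0 < ∑ y, p (x, y) := by
        refine lt_of_le_of_ne hX fun h0 => ?_
        rw [← h0] at h hle
        linarith
      have h2 : (∑ y, if T u y then 0 else Q (u, x, y)) * ∑ y, p (x, y) =
          margUX Q (u, x) * ∑ y, (if T u y then 0 else p (x, y)) := by
        rw [Finset.sum_mul, Finset.mul_sum]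
        refine Finset.sum_congr rfl fun y _ => ?_
        split_ifs
        · simp
        · exact hM u x y
      rw [le_div_iff₀ hζ]
      refine le_of_mul_le_mul_right ?_ hX'
      rw [h2, mul_assoc]
      exact mul_le_mul_of_nonneg_left h.le (Finset.sum_nonneg fun _ _ => hQ _)
  calc _ ≤ ∑ u, ∑ x, (∑ y, if T u y then 0 else Q (u, x, y)) / ζ :=
        Finset.sum_le_sum fun u _ => Finset.sum_le_sum fun x _ => h1 u x
    _ = (∑ u, ∑ y, (if T u y then 0 else margUY Q (u, y))) / ζ := by
        simp only [← Finset.sum_div]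
        congr 1
        refine Finset.sum_congr rfl fun u _ => ?_
        rw [Finset.sum_comm]
        refine Finset.sum_congr rfl fun y _ => ?_
        split_ifs
        · simp
        · rfl
    _ ≤ s / ζ := div_le_div_of_nonneg_right hs hζ.le

set_option maxHeartbeats 1000000 in
/-- Covering `X ^ n` by about `2 ^ (n I(U;X))` sequences of law `U ^ n`, in about
`2 ^ (n (I(U;X) - I(U;Y)))` bins. -/
theorem eventually_sourceCode {P : FinDist (𝒳 × 𝒴)} {k : ℕ} (q : FinDist (Fin k × 𝒳 × 𝒴))
    (hP : margXY q.1 = P.1) (hM : IsMarkovChain q.1) {γ : ℝ} (hγ : 0 < γ) :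
    ∀ᶠ n : ℕ in Filter.atTop, ∃ B : ℕ,
      (B : ℝ) ≤ (2 : ℝ) ^ ((n : ℝ) *
        (mutualInfo (margUX q.1) - mutualInfo (margUY q.1) + γ)) + 1 ∧
      SourceCode P n B (mutualInfo (margUX q.1)) γ γ := by
  classical
  set I₁ := mutualInfo (margUX q.1) with hI₁
  set I₂ := mutualInfo (margUY q.1) with hI₂
  have hI₁0 : 0 ≤ I₁ := mutualInfo_nonneg (margUX_mem q.2)
  set δ := γ / 4 with hδ
  have hδ0 : 0 < δ := by positivity
  set ζ := γ / 5 with hζ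
  have hζ0 : 0 < ζ := by positivity
  have t0 := two_rpow_tendsto_atTop hδ0
  have t1 : ∀ᶠ n : ℕ in Filter.atTop, Real.exp (-(2 : ℝ) ^ ((n : ℝ) * δ)) ≤ γ / 5 :=
    (Real.tendsto_exp_neg_atTop_nhds_zero.comp t0).eventually_le_const (by positivity)
  have t2 : ∀ᶠ n : ℕ in Filter.atTop, 2 * (2 : ℝ) ^ ((n : ℝ) * (-δ)) ≤ γ / 5 := by
    have := (two_rpow_mul_tendsto (R := -δ) (by linarith)).const_mul 2
    rw [mul_zero] at this
    exact this.eventually_le_const (by positivity)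
  have t3 : ∀ᶠ n : ℕ in Filter.atTop, (2 : ℝ) ^ ((n : ℝ) * (I₁ + 2 * δ)) + 2 ≤
      (2 : ℝ) ^ ((n : ℝ) * (I₁ + γ)) * 1 :=
    eventually_two_rpow_add_le (by linarith) (by linarith) 2 one_pos
  filter_upwards [t0.eventually_ge_atTop 2, t1, t2, t3,
    eventually_atypicalPair_le (margUX_mem q.2) hδ0 (s := γ / 5) (by positivity),
    eventually_atypicalPair_le (margUY_mem q.2) hδ0 (s := ζ * (γ / 5)) (by positivity)]
    with n n0 n1 n2 n3 n4 n5
  -- laws of the blocks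
  set pU : (Fin n → Fin k) → ℝ := fun u => ∏ i, margU q.1 (u i) with hpU
  have hpUm : pU ∈ stdSimplex ℝ _ := prod_mem_stdSimplex (margU_mem q.2)
  set Q : (Fin n → Fin k) × (Fin n → 𝒳) × (Fin n → 𝒴) → ℝ := fun t =>
    ∏ i, q.1 (t.1 i, t.2.1 i, t.2.2 i) with hQ
  have hQ0 : ∀ t, 0 ≤ Q t := fun t => Finset.prod_nonneg fun i _ => q.2.1 _
  have hQX : ∀ u x, margUX Q (u, x) = ∏ i, margUX q.1 (u i, x i) := fun u x =>
    sum_prod_pair_snd (fun t : (Fin k × 𝒳) × 𝒴 => q.1 (t.1.1, t.1.2, t.2))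
      (fun i => (u i, x i))
  have hQY : ∀ u y, margUY Q (u, y) = ∏ i, margUY q.1 (u i, y i) := fun u y =>
    sum_prod_pair_fst (fun t : 𝒳 × (Fin k × 𝒴) => q.1 (t.2.1, t.1, t.2.2))
      (fun i => (u i, y i))
  have hpX : ∀ x, ∑ y, sourceLaw P n (x, y) = ∏ i, ∑ u, margUX q.1 (u, x i) := fun x => by
    simp only [sum_margUX, hP, sourceLaw, sum_prod_pair_snd]
  have hpY : ∀ y, ∑ x, sourceLaw P n (x, y) = ∏ i, ∑ u, margUY q.1 (u, y i) := fun y => by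
    simp only [sum_margUY, hP, sourceLaw, sum_prod_pair_fst]
  have hpUX : ∀ u : Fin n → Fin k, ∏ i, ∑ x, margUX q.1 (u i, x) = pU u := fun u => by
    simp only [margU_eq_sum_margUX, hpU]
  have hpUY : ∀ u : Fin n → Fin k, ∏ i, ∑ y, margUY q.1 (u i, y) = pU u := fun u => by
    simp only [margU_eq_sum_margUY, hpU]
  have hMn : ∀ u x y, Q (u, x, y) * ∑ y', sourceLaw P n (x, y') =
      margUX Q (u, x) * sourceLaw P n (x, y) := fun u x y => by
    rw [hpX, hQX, sourceLaw, hQ, ← Finset.prod_mul_distrib, ← Finset.prod_mul_distrib]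
    refine Finset.prod_congr rfl fun i _ => ?_
    have := hM (u i) (x i) (y i)
    rw [hP] at this
    rw [← this]
    rfl
  set T : (Fin n → Fin k) → (Fin n → 𝒴) → Prop := fun u y => IsTypicalPair (margUY q.1) δ u y
    with hT
  set G : (Fin n → Fin k) → (Fin n → 𝒳) → Prop := fun u x =>
    ∑ y, (if T u y then 0 else sourceLaw P n (x, y)) ≤ ζ * ∑ y, sourceLaw P n (x, y) with hG
  set A : (Fin n → Fin k) → (Fin n → 𝒳) → Prop := fun u x =>
    IsTypicalPair (margUX q.1) δ u x ∧ G u x with hA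
  set g : (Fin n → 𝒳) → ℝ := fun x => ∑ u, if A u x then margUX Q (u, x) else 0 with hg
  set α : ℝ := (2 : ℝ) ^ ((n : ℝ) * (I₁ + δ)) with hα
  have hα0 : 0 < α := by positivity
  have hUX0 := margUX_nonneg hQ0
  have hA1 : ∀ u x, A u x → margUX Q (u, x) ≤ α * (pU u * ∑ y, sourceLaw P n (x, y)) ∧
      pU u * (∑ y, sourceLaw P n (x, y)) ≤
        (2 : ℝ) ^ (-((n : ℝ) * (I₁ - δ))) * margUX Q (u, x) := fun u x h => by
    have := h.1.bounds (margUX_nonneg q.2.1)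
    rwa [hpUX, ← hpX, ← hQX] at this
  have hg0 : ∀ x, 0 ≤ g x := fun x => Finset.sum_nonneg fun u _ => by
    split_ifs
    · exact hUX0 _
    · exact le_rfl
  have hsumX : ∀ x, ∑ u, margUX Q (u, x) = ∑ y, sourceLaw P n (x, y) := fun x => by
    simp only [hQX, hpX]
    exact sum_prod_pair_fst (margUX q.1) x
  have hg1 : ∀ x, g x ≤ ∑ y, sourceLaw P n (x, y) := fun x => by
    rw [← hsumX]
    refine Finset.sum_le_sum fun u _ => ?_
    split_ifs
    · exact le_rfl
    · exact hUX0 _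
  have hgα : ∀ x, g x ≤ α * (∑ y, sourceLaw P n (x, y)) * ∑ u, (if A u x then pU u else 0) :=
    fun x => by
      rw [Finset.mul_sum]
      refine Finset.sum_le_sum fun u _ => ?_
      split_ifs with h
      · refine (hA1 u x h).1.trans (le_of_eq ?_); ring
      · simp
  have hbad := sum_bad_le hQ0 (sourceLaw_mem P n).1 hMn T hζ0 (s := ζ * (γ / 5)) (by
    simp only [hQY]; exact n5)
  have htot : ∑ u, ∑ x, margUX Q (u, x) = 1 := by
    rw [Finset.sum_comm]
    simp only [hsumX]
    rw [← Fintype.sum_prod_type]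
    exact (sourceLaw_mem P n).2
  have hgs : 1 - (γ / 5 + γ / 5) ≤ ∑ x, g x := by
    have h1 : ∀ u x, margUX Q (u, x) ≤ (if A u x then margUX Q (u, x) else 0) +
        ((if IsTypicalPair (margUX q.1) δ u x then 0 else ∏ i, margUX q.1 (u i, x i)) +
        if G u x then 0 else margUX Q (u, x)) := fun u x => by
      have := hUX0 (u, x)
      rw [← hQX]
      by_cases h1 : IsTypicalPair (margUX q.1) δ u x <;> by_cases h2 : G u x <;>
        simp [hA, h1, h2, this]
    have h2 := Finset.sum_le_sum fun u (_ : u ∈ Finset.univ) =>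
      Finset.sum_le_sum fun x (_ : x ∈ Finset.univ) => h1 u x
    rw [htot] at h2
    simp only [Finset.sum_add_distrib] at h2
    have h3 : ∑ x, g x = ∑ u, ∑ x, (if A u x then margUX Q (u, x) else 0) := Finset.sum_comm
    have h4 : ζ * (γ / 5) / ζ = γ / 5 := by field_simp
    rw [h4] at hbad
    rw [h3]
    linarith
  have hTτ : ∑ y, (∑ x, sourceLaw P n (x, y)) * ∑ u, (if T u y then pU u else 0) ≤
      (2 : ℝ) ^ (-((n : ℝ) * (I₂ - δ))) := by
    have h1 : ∀ u y, (∑ x, sourceLaw P n (x, y)) * (if T u y then pU u else 0) ≤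
        (2 : ℝ) ^ (-((n : ℝ) * (I₂ - δ))) * margUY Q (u, y) := fun u y => by
      split_ifs with h
      · have := (h.bounds (margUY_nonneg q.2.1)).2
        rw [hpUY, ← hpY, ← hQY] at this
        rw [mul_comm]; exact this
      · rw [mul_zero]
        exact mul_nonneg (by positivity) (margUY_nonneg hQ0 _)
    have h2 : ∑ y, ∑ u, margUY Q (u, y) = 1 := by
      rw [Finset.sum_comm, ← htot]
      simp only [margU_eq_sum_margUX, margU_eq_sum_margUY]
    simp only [Finset.mul_sum]
    refine (Finset.sum_le_sum fun y _ => Finset.sum_le_sum fun u _ => h1 u y).trans ?_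
    simp only [← Finset.mul_sum, h2, mul_one]
    exact le_rfl
  -- sizes of the codebook and of the set of bins
  set M : ℕ := ⌈(2 : ℝ) ^ ((n : ℝ) * (I₁ + 2 * δ))⌉₊ with hMdef
  set B : ℕ := ⌈(2 : ℝ) ^ ((n : ℝ) * (I₁ - I₂ + 4 * δ))⌉₊ with hBdef
  have hB0 : 0 < B := Nat.ceil_pos.2 (by positivity)
  have hMlow : (2 : ℝ) ^ ((n : ℝ) * (I₁ + 2 * δ)) ≤ M := Nat.le_ceil _
  have hMup : (M : ℝ) ≤ (2 : ℝ) ^ ((n : ℝ) * (I₁ + 2 * δ)) + 1 :=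
    (Nat.ceil_lt_add_one (by positivity)).le
  have hBlow : (2 : ℝ) ^ ((n : ℝ) * (I₁ - I₂ + 4 * δ)) ≤ B := Nat.le_ceil _
  have hBup : (B : ℝ) ≤ (2 : ℝ) ^ ((n : ℝ) * (I₁ - I₂ + 4 * δ)) + 1 :=
    (Nat.ceil_lt_add_one (by positivity)).le
  obtain ⟨c, Φ, bin, dec, hΦ, herr⟩ := exists_covering_code hpUm (sourceLaw_mem P n) A T
    (g := g) hα0 hg0 hg1 (fun x => by convert hgα x) hgs (fun u x h => h.2) hζ0.le hTτ M B hB0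
  have hMα : (2 : ℝ) ^ ((n : ℝ) * δ) ≤ M / α := by
    rw [le_div_iff₀ hα0, hα, ← Real.rpow_add (by norm_num)]
    refine le_trans (le_of_eq ?_) hMlow
    congr 1; ring
  have hexp : Real.exp (-(M / α)) ≤ γ / 5 := le_trans (Real.exp_le_exp.2 (by linarith)) n1
  have hcol : M * (2 : ℝ) ^ (-((n : ℝ) * (I₂ - δ))) / B ≤ γ / 5 := by
    refine le_trans ?_ n2
    rw [div_le_iff₀ (by exact_mod_cast hB0)]
    have h1 : (1 : ℝ) ≤ (2 : ℝ) ^ ((n : ℝ) * (I₁ + 2 * δ)) :=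
      Real.one_le_rpow (by norm_num) (by positivity)
    calc M * (2 : ℝ) ^ (-((n : ℝ) * (I₂ - δ)))
        ≤ (2 * (2 : ℝ) ^ ((n : ℝ) * (I₁ + 2 * δ))) * (2 : ℝ) ^ (-((n : ℝ) * (I₂ - δ))) :=
          mul_le_mul_of_nonneg_right (by linarith) (by positivity)
      _ = 2 * (2 : ℝ) ^ ((n : ℝ) * (-δ)) * (2 : ℝ) ^ ((n : ℝ) * (I₁ - I₂ + 4 * δ)) := by
          rw [mul_assoc, mul_assoc, ← Real.rpow_add (by norm_num), ← Real.rpow_add (by norm_num)]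
          congr 2; ring
      _ ≤ _ := mul_le_mul_of_nonneg_left hBlow (by positivity)
  have herr' : ∑ x, ∑ y, (if ∃ m, Φ x = some m ∧ dec y (bin m) = some m then 0
      else sourceLaw P n (x, y)) ≤ γ := by
    refine herr.trans ?_
    have : ζ = γ / 5 := rfl
    linarith
  have h4δ : 4 * δ = γ := by rw [hδ]; ring
  refine ⟨B, by rw [h4δ] at hBup; exact hBup, M,
    fun x => (Φ x).elim (Fin.last M) Fin.castSucc,
    fun m => if h : m.val < M then (bin ⟨m.val, h⟩).val else 0,
    fun y j => if h : j < B then (dec y ⟨j, h⟩).elim (Fin.last M) Fin.castSucc else Fin.last M,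
    ?_, ?_, ?_, ?_, ?_, ?_⟩
  · have h1 : (2 : ℝ) ≤ M := by
      refine n0.trans (le_trans ?_ hMlow)
      exact Real.rpow_le_rpow_of_exponent_le (by norm_num)
        (mul_le_mul_of_nonneg_left (by linarith) (Nat.cast_nonneg n))
    exact_mod_cast h1
  · linarith
  · intro m
    dsimp only
    split_ifs
    · exact (bin _).2
    · exact hB0
  · intro m hm
    obtain ⟨m, rfl⟩ := Fin.exists_castSucc_eq.2 hm
    have hsub : ∀ x, (Φ x).elim (Fin.last M) Fin.castSucc = m.castSucc → A (c m) x := fun x h => by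
      rcases hx : Φ x with _ | m'
      · rw [hx] at h
        exact absurd h.symm (Fin.castSucc_lt_last m).ne
      · rw [hx] at h
        have : m' = m := Fin.castSucc_injective M h
        exact hΦ x m (by rw [hx, this])
    have hm1 : mass (sourceLaw P n) (fun t => (Φ t.1).elim (Fin.last M) Fin.castSucc) m.castSucc ≤
        ∑ x, if A (c m) x then ∑ y, sourceLaw P n (x, y) else 0 := by
      unfold mass
      rw [Fintype.sum_prod_type]
      refine Finset.sum_le_sum fun x _ => ?_
      by_cases h : A (c m) x
      · rw [if_pos h]
        refine Finset.sum_le_sum fun y _ => ?_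
        split_ifs
        · exact le_rfl
        · exact (sourceLaw_mem P n).1 _
      · rw [if_neg h]
        refine (Finset.sum_eq_zero fun y _ => ?_).le
        rw [if_neg fun h' => h (hsub x h')]
    refine hm1.trans ?_
    have hexpo : (2 : ℝ) ^ (-((n : ℝ) * (I₁ - δ))) ≤ (2 : ℝ) ^ (-((n : ℝ) * (I₁ - γ))) :=
      Real.rpow_le_rpow_of_exponent_le (by norm_num)
        (neg_le_neg (mul_le_mul_of_nonneg_left (by linarith) (Nat.cast_nonneg n)))
    refine le_trans ?_ hexpo
    rcases (hpUm.1 (c m)).eq_or_lt with h0 | h0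
    · -- a codeword of probability zero is typical with no `x`
      refine le_trans (le_of_eq (Finset.sum_eq_zero fun x _ => ?_)) (by positivity)
      refine if_neg fun h => ?_
      have h1 := (hA1 _ x h).1
      rw [← h0, zero_mul, mul_zero, hQX] at h1
      exact absurd h.1.1 (not_lt.2 h1)
    · refine le_of_mul_le_mul_left ?_ h0
      rw [Finset.mul_sum]
      calc _ ≤ ∑ x, (2 : ℝ) ^ (-((n : ℝ) * (I₁ - δ))) * margUX Q (c m, x) := by
            refine Finset.sum_le_sum fun x _ => ?_
            split_ifs with h
            · exact (hA1 _ x h).2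
            · rw [mul_zero]; exact mul_nonneg (by positivity) (hUX0 _)
        _ = _ := by
            rw [← Finset.mul_sum, mul_comm]
            congr 1
            simp only [hQX, ← hpUX]
            exact sum_prod_pair_snd (margUX q.1) (c m)
  · refine le_trans ?_ herr'
    unfold mass
    rw [Fintype.sum_prod_type]
    refine Finset.sum_le_sum fun x _ => Finset.sum_le_sum fun y _ => ?_
    have hs0 := (sourceLaw_mem P n).1 (x, y)
    by_cases h : ∃ m, Φ x = some m ∧ dec y (bin m) = some m
    · obtain ⟨m, h1, h2⟩ := h
      have h3 : (Φ x).elim (Fin.last M) Fin.castSucc ≠ Fin.last M := by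
        rw [h1]
        exact (Fin.castSucc_lt_last m).ne
      rw [if_neg h3, if_pos ⟨m, h1, h2⟩]
    · rw [if_neg h]
      split_ifs
      · exact le_rfl
      · exact hs0
  · refine le_trans ?_ herr'
    rw [Fintype.sum_prod_type]
    refine Finset.sum_le_sum fun x _ => Finset.sum_le_sum fun y _ => ?_
    have hs0 := (sourceLaw_mem P n).1 (x, y)
    by_cases h : ∃ m, Φ x = some m ∧ dec y (bin m) = some m
    · rw [if_pos h]
      obtain ⟨m, h1, h2⟩ := h
      simp [h1, h2]
    · rw [if_neg h]
      split_ifs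
      · simpa using hs0
      · simp

end CoverSource

/-! ### Common functions of the source -/

section CommonFunction

variable {𝒳 𝒴 : Type*} [Fintype 𝒳] [Fintype 𝒴]

/-- If `U – X – Y` is a Markov chain with `I(U;X) ≤ I(U;Y)`, then `U – Y – X` is one as well. -/
theorem IsMarkovChain.swap {𝒰 : Type*} [Fintype 𝒰] {q : 𝒰 × 𝒳 × 𝒴 → ℝ} (hq : ∀ t, 0 ≤ q t)
    (hM : IsMarkovChain q) (hI : mutualInfo (margUX q) ≤ mutualInfo (margUY q)) :
    IsMarkovChain fun t : 𝒰 × 𝒴 × 𝒳 => q (t.1, t.2.2, t.2.1) := by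
  set q' : 𝒰 × 𝒴 × 𝒳 → ℝ := fun t => q (t.1, t.2.2, t.2.1) with hq'
  have h1 : entropy q' = entropy q := by
    unfold entropy
    congr 1
    exact ((Equiv.refl 𝒰).prodCongr (Equiv.prodComm 𝒴 𝒳)).sum_comp
      fun t => q t * Real.logb 2 (q t)
  have h2 : margU q' = margU q := by
    funext u
    exact (Equiv.prodComm 𝒴 𝒳).sum_comp fun t => q (u, t)
  have h3 : entropy (margXY q') = entropy (margXY q) := by
    unfold entropy
    congr 1
    exact (Equiv.prodComm 𝒴 𝒳).sum_comp fun t => margXY q t * Real.logb 2 (margXY q t)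
  have h4 : entropyFst (margXY q') = entropySnd (margXY q) := rfl
  have h5 : margUX q' = margUY q := rfl
  rw [isMarkovChain_iff hq] at hM
  rw [mutualInfo_margUX hq, mutualInfo_margUY hq] at hI
  rw [isMarkovChain_iff fun t => hq _, h3, h4]
  have h6 : (jointPoint q').2.2.2 - (jointPoint q').2.1 =
      (jointPoint q).2.2.2 - (jointPoint q).2.2.1 := by
    simp only [jointPoint, h1, h2, h5]
  linarith

/-- If `I(U;X) - I(U;Y) ≤ 0`, the conditional law of `U` given `X = x` equals that given `Y = y`
almost surely. It is thus a common function of `X` and `Y`, and `I(U;X)` is at most its entropy. -/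
theorem exists_common_function {P : FinDist (𝒳 × 𝒴)} {r v : ℝ} (hv : v ∈ auxRates P r)
    (hr : r ≤ 0) : ∃ (f : 𝒳 → 𝒳) (g : 𝒴 → 𝒳), (∀ x y, P.1 (x, y) ≠ 0 → f x = g y) ∧ 0 ≤ v ∧
      v ≤ entropy (mass P.1 fun t => f t.1) := by
  classical
  obtain ⟨k, q, hP, hM, hI, rfl⟩ := hv
  obtain ⟨x₀, -⟩ := nonempty_of_finDist P
  have : Nonempty 𝒳 := ⟨x₀⟩
  have hM' := hM.swap q.2.1 (by linarith)
  set w := margUX q.1 with hw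
  have hwm := margUX_mem q.2
  set pX : 𝒳 → ℝ := fun x => ∑ u, w (u, x) with hpX
  set pY : 𝒴 → ℝ := fun y => ∑ u, margUY q.1 (u, y) with hpY
  have hpX0 : ∀ x, 0 ≤ pX x := fun x => Finset.sum_nonneg fun u _ => hwm.1 _
  have hpXw : ∀ u x, w (u, x) ≤ pX x := fun u x =>
    Finset.single_le_sum (f := fun u => w (u, x)) (fun _ _ => hwm.1 _) (Finset.mem_univ u)
  have hpXP : ∀ x, pX x = ∑ y, P.1 (x, y) := fun x => by rw [hpX, ← hP]; exact sum_margUX q.1 x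
  have hpYP : ∀ y, pY y = ∑ x, P.1 (x, y) := fun y => by rw [hpY, ← hP]; exact sum_margUY q.1 y
  set cX : 𝒳 → Fin k → ℝ := fun x u => w (u, x) / pX x with hcX
  set cY : 𝒴 → Fin k → ℝ := fun y u => margUY q.1 (u, y) / pY y with hcY
  have hc : ∀ x y, P.1 (x, y) ≠ 0 → cX x = cY y := fun x y h => by
    have h0 : 0 < P.1 (x, y) := lt_of_le_of_ne (P.2.1 _) h.symm
    have hx : 0 < pX x := h0.trans_le (by
      rw [hpXP]
      exact Finset.single_le_sum (f := fun y => P.1 (x, y)) (fun _ _ => P.2.1 _)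
        (Finset.mem_univ y))
    have hy : 0 < pY y := h0.trans_le (by
      rw [hpYP]
      exact Finset.single_le_sum (f := fun x => P.1 (x, y)) (fun _ _ => P.2.1 _)
        (Finset.mem_univ x))
    funext u
    have h1 : q.1 (u, x, y) * pX x = w (u, x) * P.1 (x, y) := by
      rw [← hP, ← hM u x y]
      rfl
    have h2 : q.1 (u, x, y) * pY y = margUY q.1 (u, y) * P.1 (x, y) := by
      rw [← hP]
      exact hM' u y x
    have h3 : cX x u * P.1 (x, y) = cY y u * P.1 (x, y) := by
      simp only [hcX, hcY]
      rw [div_mul_eq_mul_div, div_mul_eq_mul_div, ← h1, ← h2, mul_div_cancel_right₀ _ hx.ne',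
        mul_div_cancel_right₀ _ hy.ne']
    exact mul_right_cancel₀ h h3
  set f : 𝒳 → 𝒳 := fun x => Function.invFun cX (cX x) with hf
  have hcf : ∀ x, cX (f x) = cX x := fun x => Function.invFun_eq ⟨x, rfl⟩
  refine ⟨f, fun y => Function.invFun cX (cY y), fun x y h => by simp only [hf, hc x y h],
    mutualInfo_nonneg hwm, ?_⟩
  set m := mass w (fun t => f t.2) with hm
  have hm1 : mass P.1 (fun t => f t.1) = m := by
    have e1 : mass w Prod.snd = pX := by
      funext x
      simp only [mass, Fintype.sum_prod_type, hpX]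
      exact Finset.sum_congr rfl fun u _ => by simp
    have e2 : mass P.1 Prod.fst = pX := by
      funext x
      rw [hpXP]
      simp only [mass, Fintype.sum_prod_type]
      rw [Finset.sum_eq_single x] <;> simp +contextual
    funext a
    rw [hm, mass_comp P.1 Prod.fst f, mass_comp w Prod.snd f, e1, e2]
  rw [hm1, hm, entropy_mass]
  have h1 : ent w Prod.fst ≤ ent w fun t => (t.1, f t.2) :=
    ent_mono hwm.1 fun t t' h => (Prod.mk.inj h).1
  have hcpos : ∀ t : Fin k × 𝒳, 0 < w t → 0 < cX t.2 t.1 := fun t ht =>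
    div_pos ht (ht.trans_le (hpXw t.1 t.2))
  have h2 : ent w (fun t => (t.1, f t.2)) ≤
      -∑ t, w t * Real.logb 2 (cX (f t.2) t.1 * m (f t.2)) := by
    refine ent_le_cross hwm (fun t => (t.1, f t.2)) (r := fun s => cX s.2 s.1 * m s.2)
      (fun s => mul_nonneg (div_nonneg (hwm.1 _) (hpX0 _)) (mass_nonneg hwm.1 _ _)) ?_
      fun t ht => ?_
    · have h3 : ∑ a, m a = 1 := by rw [hm, sum_mass]; exact hwm.2
      rw [Fintype.sum_prod_type_right, ← h3]
      refine Finset.sum_le_sum fun a _ => ?_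
      dsimp only
      rw [← Finset.sum_mul]
      refine mul_le_of_le_one_left (mass_nonneg hwm.1 _ _) ?_
      simp only [hcX, ← Finset.sum_div]
      exact div_self_le_one _
    · refine mul_pos ?_ (ht.trans_le (le_mass hwm.1 (fun t => f t.2) t))
      rw [hcf]
      exact hcpos t ht
  have h3 : ∑ t, w t * Real.logb 2 (cX (f t.2) t.1 * m (f t.2)) =
      ∑ t, w t * Real.logb 2 (w t) - ∑ t, w t * Real.logb 2 (pX t.2) +
        ∑ t, w t * Real.logb 2 (m (f t.2)) := by
    rw [← Finset.sum_sub_distrib, ← Finset.sum_add_distrib]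
    refine Finset.sum_congr rfl fun t _ => ?_
    rcases (hwm.1 t).eq_or_lt with h0 | h0
    · rw [hw, ← h0]; simp
    have h4 : 0 < m (f t.2) := h0.trans_le (le_mass hwm.1 (fun t => f t.2) t)
    have h5 : 0 < pX t.2 := h0.trans_le (hpXw t.1 t.2)
    rw [hcf, Real.logb_mul (hcpos t h0).ne' h4.ne']
    simp only [hcX]
    rw [Real.logb_div h0.ne' h5.ne']
    ring
  have h4 : ∑ t, w t * Real.logb 2 (pX t.2) = -entropy pX := by
    rw [entropy, neg_neg, Fintype.sum_prod_type_right]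
    simp only [← Finset.sum_mul, hpX]
  have h5 : ent w (fun t => f t.2) = -∑ t, w t * Real.logb 2 (m (f t.2)) := rfl
  have h6 : entropy w = -∑ t, w t * Real.logb 2 (w t) := rfl
  have h7 : entropy (fun u => ∑ x, w (u, x)) = ent w Prod.fst := by
    rw [← entropy_mass]
    congr 1
    funext u
    simp only [mass, Fintype.sum_prod_type]
    rw [Finset.sum_eq_single u] <;> simp +contextual
  rw [mutualInfo_eq hwm.1, h7]
  have h8 : entropy (fun x => ∑ u, w (u, x)) = entropy pX := rfl
  linarith

theorem mass_sourceLaw {𝒱 : Type*} (P : FinDist (𝒳 × 𝒴)) (f : 𝒳 → 𝒱) {n : ℕ} (v : Fin n → 𝒱) :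
    mass (sourceLaw P n) (fun t i => f (t.1 i)) v = ∏ i, mass P.1 (fun t => f t.1) (v i) := by
  classical
  have h1 := sum_prod_mul_prod (ι := Fin n) P.1 fun i t => if f t.1 = v i then 1 else 0
  simp only [mul_ite, mul_one, mul_zero] at h1
  simp only [mass]
  rw [← h1, Fintype.sum_prod_type]
  dsimp only
  have h2 := sum_pair_seq fun x y => if (fun i => f (x i)) = v then sourceLaw P n (x, y) else 0
  refine Eq.trans (by convert h2.symm) ?_
  refine Finset.sum_congr rfl fun t _ => ?_
  rw [Finset.prod_boole]
  simp [funext_iff, sourceLaw]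

/-- If `f X = g Y` almost surely, both ends can compute the index of `f (X ^ n)` in a list of its
typical values. -/
theorem eventually_sourceCode_of_common {𝒱 : Type*} [Fintype 𝒱] {P : FinDist (𝒳 × 𝒴)} {f : 𝒳 → 𝒱}
    {g : 𝒴 → 𝒱} (hfg : ∀ x y, P.1 (x, y) ≠ 0 → f x = g y) {γ : ℝ} (hγ : 0 < γ) :
    ∀ᶠ n : ℕ in Filter.atTop,
      SourceCode P n 1 (entropy (mass P.1 fun t => f t.1)) γ 0 := by
  classical
  set pV := mass P.1 fun t => f t.1 with hpV
  have hpm : pV ∈ stdSimplex ℝ 𝒱 := mass_mem_stdSimplex P.2 _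
  set h := entropy pV with hh
  have hh0 : 0 ≤ h := by
    rw [hh, hpV, entropy_mass]; exact ent_nonneg P.2 _
  have hmean : ∑ a, pV a * -Real.logb 2 (pV a) = h := by
    rw [hh, entropy, ← Finset.sum_neg_distrib]
    exact Finset.sum_congr rfl fun a _ => by ring
  set δ := γ / 2 with hδ
  have hδ0 : 0 < δ := by positivity
  filter_upwards [eventually_sum_atypical_le hpm (fun a => -Real.logb 2 (pV a)) hδ0 hγ,
    eventually_two_rpow_add_le (a := h + δ) (b := h + γ) (by linarith) (by linarith) 3 one_pos]
    with n n1 n2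
  rw [hmean] at n1
  have hpn := prod_mem_stdSimplex (ι := Fin n) hpm
  set A : Finset (Fin n → 𝒱) := {v | 0 < ∏ i, pV (v i) ∧
    |∑ i, -Real.logb 2 (pV (v i)) - n * h| ≤ n * δ} with hA
  have hbd : ∀ v ∈ A, (2 : ℝ) ^ (-((n : ℝ) * (h + δ))) ≤ ∏ i, pV (v i) ∧
      ∏ i, pV (v i) ≤ (2 : ℝ) ^ (-((n : ℝ) * (h - δ))) := fun v hv => by
    obtain ⟨h0, h1⟩ := (Finset.mem_filter.1 hv).2
    have hpos : ∀ i, 0 < pV (v i) := fun i => lt_of_le_of_ne (hpm.1 _) fun h2 =>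
      h0.ne' (Finset.prod_eq_zero (Finset.mem_univ i) h2.symm)
    have e : ∏ i, pV (v i) = (2 : ℝ) ^ (∑ i, Real.logb 2 (pV (v i))) := by
      rw [Real.rpow_sum_of_pos (by norm_num)]
      exact Finset.prod_congr rfl fun i _ =>
        (Real.rpow_logb (by norm_num) (by norm_num) (hpos i)).symm
    rw [Finset.sum_neg_distrib] at h1
    obtain ⟨h2, h3⟩ := abs_le.1 h1
    rw [e]
    constructor <;> refine Real.rpow_le_rpow_of_exponent_le (by norm_num) (by linarith)
  have hcard : (A.card : ℝ) ≤ (2 : ℝ) ^ ((n : ℝ) * (h + δ)) := by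
    have h1 : ∑ _v ∈ A, (2 : ℝ) ^ (-((n : ℝ) * (h + δ))) ≤ 1 := by
      rw [← hpn.2]
      exact (Finset.sum_le_sum fun v hv => (hbd v hv).1).trans
        (Finset.sum_le_sum_of_subset_of_nonneg (Finset.subset_univ _) fun v _ _ => hpn.1 v)
    rw [Finset.sum_const, nsmul_eq_mul, Real.rpow_neg (by norm_num), ← div_eq_mul_inv,
      div_le_one (by positivity)] at h1
    exact h1
  set M := A.card + 2 with hM
  set idx : (Fin n → 𝒱) → Fin (M + 1) := fun v =>
    if hv : v ∈ A then Fin.castLE (by omega) (A.equivFin ⟨v, hv⟩) else Fin.last M with hidx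
  have hidx1 : ∀ v ∈ A, ((idx v : Fin (M + 1)) : ℕ) < A.card := fun v hv => by
    simp only [hidx, dif_pos hv]
    exact (A.equivFin ⟨v, hv⟩).2
  have hidx2 : ∀ v, idx v ≠ Fin.last M → v ∈ A := fun v hv => by
    by_contra h1
    exact hv (by simp only [hidx, dif_neg h1])
  have hidx3 : ∀ v ∈ A, ∀ v' ∈ A, idx v = idx v' → v = v' := fun v hv v' hv' he => by
    simp only [hidx, dif_pos hv, dif_pos hv'] at he
    have := A.equivFin.injective (Fin.castLE_injective _ he)
    exact congrArg Subtype.val this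
  have hmass : ∀ m, mass (sourceLaw P n) (fun t => idx fun i => f (t.1 i)) m =
      mass (fun v : Fin n → 𝒱 => ∏ i, pV (v i)) idx m := fun m => by
    rw [mass_comp (sourceLaw P n) (fun t i => f (t.1 i)) idx]
    congr 1
    funext v
    exact mass_sourceLaw P f v
  refine ⟨M, fun x => idx fun i => f (x i), fun _ => 0, fun y _ => idx fun i => g (y i),
    by omega, ?_, fun _ => one_pos, fun m hm => ?_, ?_, ?_⟩
  · rw [hM]; push_cast; linarith
  · rw [hmass]
    have hle : (2 : ℝ) ^ (-((n : ℝ) * (h - δ))) ≤ (2 : ℝ) ^ (-((n : ℝ) * (h - γ))) :=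
      Real.rpow_le_rpow_of_exponent_le (by norm_num)
        (neg_le_neg (mul_le_mul_of_nonneg_left (by linarith) (Nat.cast_nonneg n)))
    by_cases hex : ∃ v, idx v = m
    · obtain ⟨v, rfl⟩ := hex
      have hv := hidx2 v hm
      have : mass (fun v : Fin n → 𝒱 => ∏ i, pV (v i)) idx (idx v) = ∏ i, pV (v i) := by
        unfold mass
        rw [Finset.sum_eq_single v]
        · simp
        · intro v' _ hne
          refine if_neg fun he => hne ?_
          exact hidx3 v' (hidx2 v' (he ▸ hm)) v hv he
        · simp
      rw [this]
      exact (hbd v hv).2.trans hle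
    · rw [not_exists] at hex
      have : mass (fun v : Fin n → 𝒱 => ∏ i, pV (v i)) idx m = 0 :=
        Finset.sum_eq_zero fun v _ => if_neg (hex v)
      rw [this]
      positivity
  · rw [hmass]
    refine le_trans (Finset.sum_le_sum fun v _ => ?_) n1
    rcases (hpn.1 v).eq_or_lt with h0 | h0
    · have h1 : ∏ i, pV (v i) = 0 := h0.symm
      simp [h1]
    by_cases hv : |∑ i, -Real.logb 2 (pV (v i)) - n * h| ≤ n * δ
    · rw [if_pos hv, if_neg]
      intro he
      have h1 := hidx1 v (Finset.mem_filter.2 ⟨Finset.mem_univ _, h0, hv⟩)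
      rw [he, Fin.val_last] at h1
      omega
    · rw [if_neg hv]
      split_ifs
      · exact le_rfl
      · exact h0.le
  · refine (Finset.sum_eq_zero fun t _ => ?_).le
    by_cases h0 : sourceLaw P n t = 0
    · rw [h0, zero_mul]
    have h1 : (fun i => g (t.2 i)) = fun i => f (t.1 i) := by
      funext i
      refine (hfg _ _ fun h2 => h0 ?_).symm
      exact Finset.prod_eq_zero (Finset.mem_univ i) h2
    simp [h1]

end CommonFunction

/-! ### The capacity -/

section Capacity

variable {𝒳 𝒴 𝒯 𝒵 : Type*} [Fintype 𝒳] [Fintype 𝒴] [Fintype 𝒯] [Fintype 𝒵]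

theorem SourceCode.mono {P : FinDist (𝒳 × 𝒴)} {n B : ℕ} {v γ γ' s s' : ℝ}
    (h : SourceCode P n B v γ s) (hγ : γ ≤ γ') (hs : s ≤ s') : SourceCode P n B v γ' s' := by
  obtain ⟨M, Φ, bin, dec, hM, h1, h2, h3, h4, h5⟩ := h
  have hn : (0 : ℝ) ≤ n := Nat.cast_nonneg n
  refine ⟨M, Φ, bin, dec, hM, h1.trans ?_, h2, fun m hm => (h3 m hm).trans ?_, h4.trans hγ,
    h5.trans hs⟩
  · exact Real.rpow_le_rpow_of_exponent_le (by norm_num)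
      (mul_le_mul_of_nonneg_left (by linarith) hn)
  · exact Real.rpow_le_rpow_of_exponent_le (by norm_num)
      (neg_le_neg (mul_le_mul_of_nonneg_left (by linarith) hn))

/-- Below the lower rate of the channel, the bin of the auxiliary sequence can be transmitted. -/
theorem isAchievableRate_of_lt_lowerRate [Nonempty 𝒯] {P : FinDist (𝒳 × 𝒴)} {W : Channel 𝒯 𝒵}
    {ε r v : ℝ} (h0 : 0 < ε) (hr0 : 0 ≤ r) (hr : r < lowerRate W ε) (hv : v ∈ auxRates P r) :
    IsAchievableRate P W ε v := by
  obtain ⟨T, R, hrR, hT⟩ := exists_of_lt_lowerRate h0 hr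
  obtain ⟨η, hη, hcode⟩ := exists_channel_codes hT
  obtain ⟨k, q, hP, hM, hI, rfl⟩ := hv
  refine isAchievableRate_of_forall (mutualInfo_nonneg (margUX_mem q.2)) fun γ hγ hγ1 => ?_
  -- the loss of the source code, within the margins in rate and in error probability
  set γ' := min γ (min η ((R - r) / 2)) with hγ'
  have hγ'0 : 0 < γ' := lt_min hγ (lt_min hη (by linarith))
  have hγ'γ : γ' ≤ γ := min_le_left _ _
  have hγ'η : γ' ≤ η := (min_le_right _ _).trans (min_le_left _ _)
  have hγ'R : γ' ≤ (R - r) / 2 := (min_le_right _ _).trans (min_le_right _ _)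
  filter_upwards [hcode, eventually_sourceCode q hP hM hγ'0,
    eventually_two_rpow_add_le (a := r + γ') (b := R) (by linarith) (by linarith) 1 hη,
    Filter.eventually_gt_atTop 0] with n n1 n2 n3 n4
  obtain ⟨B, hB, hS⟩ := n2
  have hBR : (B : ℝ) ≤ (2 : ℝ) ^ ((n : ℝ) * R) * η := by
    refine hB.trans (le_trans ?_ n3)
    gcongr
    norm_num
  obtain ⟨c, dch, hc⟩ := n1 B hBR
  obtain ⟨π, h1, h2, h3⟩ := exists_protocol n4 hγ1 (hS.mono hγ'γ hγ'η) hc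
  exact ⟨π, by linarith, h2, h3⟩

/-- At auxiliary rate zero the channel is not needed. -/
theorem isAchievableRate_of_nonpos [Nonempty 𝒯] {P : FinDist (𝒳 × 𝒴)} {W : Channel 𝒯 𝒵}
    {ε r v : ℝ} (h0 : 0 < ε) (hr : r ≤ 0) (hv : v ∈ auxRates P r) :
    ∃ h, v ≤ h ∧ IsAchievableRate P W ε h := by
  obtain ⟨f, g, hfg, hv0, hvh⟩ := exists_common_function hv hr
  refine ⟨_, hvh, isAchievableRate_of_forall (hv0.trans hvh) fun γ hγ hγ1 => ?_⟩
  filter_upwards [eventually_sourceCode_of_common hfg hγ, Filter.eventually_gt_atTop 0] with n n1 n2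
  obtain ⟨π, h1, h2, h3⟩ := exists_protocol (W := W) (e := 0) n2 hγ1 n1
    (c := fun _ _ => Classical.arbitrary 𝒯) (dch := fun _ => 0) fun j hj => by
      rw [Nat.lt_one_iff.1 hj]; simp
  exact ⟨π, by linarith, h2, h3⟩

theorem IsAchievableRate.mono {P : FinDist (𝒳 × 𝒴)} {W : Channel 𝒯 𝒵} {ε H H' : ℝ}
    (h : IsAchievableRate P W ε H) (hH : H' ≤ H) : IsAchievableRate P W ε H' := by
  rw [isAchievableRate_iff] at h ⊢
  intro β hβ δ hδ
  filter_upwards [h β hβ δ hδ] with n hn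
  obtain ⟨π, h1, h2, h3⟩ := hn
  exact ⟨π, h1, h2, by linarith⟩

/-- The set of achievable rates is closed from below. -/
theorem isAchievableRate_of_forall_lt {P : FinDist (𝒳 × 𝒴)} {W : Channel 𝒯 𝒵} {ε H : ℝ}
    (h : ∀ H' < H, IsAchievableRate P W ε H') : IsAchievableRate P W ε H := by
  rw [isAchievableRate_iff]
  intro β hβ δ hδ
  have h1 := h (H - δ / 2) (by linarith)
  rw [isAchievableRate_iff] at h1
  filter_upwards [h1 β hβ (δ / 2) (by linarith)] with n hn
  obtain ⟨π, h1, h2, h3⟩ := hn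
  exact ⟨π, h1, h2, by linarith⟩

/-- **Direct part**: every `I(U;X)` with `I(U;X) - I(U;Y)` at most the lower rate of the channel is
achievable. When that rate is positive, time sharing with a constant `U` gives a margin. -/
theorem isAchievableRate_of_mem_auxRates [Nonempty 𝒯] {P : FinDist (𝒳 × 𝒴)} {W : Channel 𝒯 𝒵}
    {ε v : ℝ} (h0 : 0 < ε) (h1 : ε < 1) (hv : v ∈ auxRates P (lowerRate W ε)) :
    IsAchievableRate P W ε v := by
  rcases (lowerRate_nonneg W h0 h1).eq_or_lt with hl | hl
  · obtain ⟨h, hvh, hh⟩ := isAchievableRate_of_nonpos (W := W) h0 hl.ge hv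
    exact hh.mono hvh
  · have hv0 : 0 ≤ v := by
      obtain ⟨k, q, -, -, -, rfl⟩ := hv
      exact mutualInfo_nonneg (margUX_mem q.2)
    refine isAchievableRate_of_forall_lt fun H hH => ?_
    set t := 1 - min (1 / 2) ((v - H) / (v + 1)) with ht
    have hm0 : 0 < min (1 / 2) ((v - H) / (v + 1)) :=
      lt_min (by norm_num) (div_pos (by linarith) (by linarith))
    have hm1 : min (1 / 2) ((v - H) / (v + 1)) ≤ 1 / 2 := min_le_left _ _
    have hm2 : min (1 / 2) ((v - H) / (v + 1)) * (v + 1) ≤ v - H := by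
      rw [← le_div_iff₀ (by linarith)]; exact min_le_right _ _
    have htv : H ≤ t * v := by rw [ht]; nlinarith
    refine (isAchievableRate_of_lt_lowerRate h0 (r := t * lowerRate W ε) ?_ ?_
      (mul_mem_auxRates hv ?_ ?_)).mono htv
    · exact mul_nonneg (by linarith) hl.le
    · exact mul_lt_of_lt_one_left hl (by linarith)
    · linarith
    · linarith

theorem isGreatest_ucrCapacity [Nonempty 𝒯] (P : FinDist (𝒳 × 𝒴)) (W : Channel 𝒯 𝒵) {ε : ℝ}
    (h0 : 0 < ε) (h1 : ε < 1) :
    IsGreatest {H : ℝ | IsAchievableRate P W ε H} (ucrCapacity P W ε) := by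
  have hbdd : BddAbove {H : ℝ | IsAchievableRate P W ε H} := by
    refine ⟨auxMax P (upperRate W ε), fun H hH => ?_⟩
    obtain ⟨v, hv, hHv⟩ := exists_auxRates_ge_of_isAchievableRate P W h0 h1 hH
    exact hHv.trans ((isGreatest_auxMax P ((lowerRate_nonneg W h0 h1).trans
      (lowerRate_le_upperRate W h0 h1))).2 hv)
  have hne : {H : ℝ | IsAchievableRate P W ε H}.Nonempty :=
    ⟨0, isAchievableRate_of_mem_auxRates h0 h1 (zero_mem_auxRates P (lowerRate_nonneg W h0 h1))⟩
  refine ⟨isAchievableRate_of_forall_lt fun H hH => ?_, fun H hH => le_csSup hbdd hH⟩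
  obtain ⟨H', hH', hlt⟩ := exists_lt_of_lt_csSup hne hH
  exact IsAchievableRate.mono hH' hlt.le

end Capacity

end UCR

theorem theorem2 {𝒳 𝒴 𝒯 𝒵 : Type*} [Fintype 𝒳] [Fintype 𝒴] [Fintype 𝒯] [Fintype 𝒵]
    [Nonempty 𝒯] (P : UCR.FinDist (𝒳 × 𝒴)) (W : UCR.Channel 𝒯 𝒵) :
    (∀ ε : ℝ, 0 < ε → ε < 1 →
      -- the three maxima exist
      IsGreatest {H : ℝ | UCR.IsAchievableRate P W ε H} (UCR.ucrCapacity P W ε) ∧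
      IsGreatest (UCR.auxRates P (UCR.lowerRate W ε)) (UCR.auxMax P (UCR.lowerRate W ε)) ∧
      IsGreatest (UCR.auxRates P (UCR.upperRate W ε)) (UCR.auxMax P (UCR.upperRate W ε)) ∧
      -- the two bounds
      UCR.auxMax P (UCR.lowerRate W ε) ≤ UCR.ucrCapacity P W ε ∧
      UCR.ucrCapacity P W ε ≤ UCR.auxMax P (UCR.upperRate W ε) ∧
      -- both hold with equality wherever `l(ε) = u(ε)`
      (UCR.lowerRate W ε = UCR.upperRate W ε →
        UCR.ucrCapacity P W ε = UCR.auxMax P (UCR.lowerRate W ε) ∧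
        UCR.ucrCapacity P W ε = UCR.auxMax P (UCR.upperRate W ε))) ∧
    -- the exceptional set is at most countable
    {ε : ℝ | 0 < ε ∧ ε < 1 ∧ UCR.lowerRate W ε ≠ UCR.upperRate W ε}.Countable := by
  refine ⟨fun ε h0 h1 => ?_, UCR.countable_lowerRate_ne_upperRate W⟩
  have hl := UCR.lowerRate_nonneg W h0 h1
  have hC := UCR.isGreatest_ucrCapacity P W h0 h1
  have hML := UCR.isGreatest_auxMax P hl
  have hMU := UCR.isGreatest_auxMax P (hl.trans (UCR.lowerRate_le_upperRate W h0 h1))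
  have hlow : UCR.auxMax P (UCR.lowerRate W ε) ≤ UCR.ucrCapacity P W ε :=
    hC.2 (UCR.isAchievableRate_of_mem_auxRates h0 h1 hML.1)
  have hup : UCR.ucrCapacity P W ε ≤ UCR.auxMax P (UCR.upperRate W ε) := by
    obtain ⟨v, hv, hle⟩ := UCR.exists_auxRates_ge_of_isAchievableRate P W h0 h1 hC.1
    exact hle.trans (hMU.2 hv)
  refine ⟨hC, hML, hMU, hlow, hup, fun he => ?_⟩
  rw [he] at hlow ⊢
  exact ⟨le_antisymm hup hlow, le_antisymm hup hlow⟩
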